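/- Write points of the plane as $(y,z)$. For an open interval $I$ let $\Omega=(0,\infty)\times I$. All functions are real valued, and $\partial_y,\partial_y^2$ of $v,\psi$ are weak derivatives on $\Omega$. Let \[ E_0=\Big\{(v,\psi):\ \partial_y v,\ \tfrac{v}{1+y},\ \partial_y^2\psi,\ \tfrac{\psi}{1+y^2}\in L^2(\Omega)\Big\},\qquad E_{0,0}=\Big\{(v,\psi):\ \partial_y v,\ \tfrac{v}{y},\ \partial_y^2\psi,\ \tfrac{\psi}{y^2}\in L^2(\Omega)\Big\}, \] \[ \widetilde E_0=\{(v,\psi)\in E_0:\ v,\psi\in L^2(\Omega)\}. \] Membership in $E_{0,0}$ expresses the homogeneous conditions $v=\partial_y\psi=\psi=0$ at $y=0$. Let $H^{1/2}_0=\{f\in H^{1/2}(0,\infty):\int_0^1|f|^2\,\frac{dy}{y}<\infty\}$ and $H^{-1/2}=(H^{1/2}_0)'$. The system is \[ \partial_z v+z\,\partial_y v-\tfrac12\partial_y^4\psi=s_\psi,\qquad \partial_z\psi+z\,\partial_y\psi+\tfrac12\partial_y^2 v=s_v , \] and for test functions $w,\phi$ put \[ B(v,\psi;w,\phi)=\int_\Omega\Big(-v\,\partial_z\phi-z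 v\,\partial_y\phi-\tfrac12\partial_y^2\psi\,\partial_y^2\phi\Big)+\int_\Omega\Big(-\psi\,\partial_z w-z\psi\,\partial_y w-\tfrac12\partial_y v\,\partial_y w\Big). \] The source $s$ is an arbitrary functional $(w,\phi)\mapsto s(w,\phi)$ of the test functions; for functions $s_\psi,s_v$ it is $\int_\Omega(s_\psi\phi+s_v w)$. The boundary data at $y=0$ are those of a given pair $r=(r_v,r_\psi)$ ($r=0$ is the homogeneous case), in the sense that $(v,\psi)-r\in E_{0,0}$. A pair $(v,\psi)\in\widetilde E_0$ with $(v,\psi)-r\in E_{0,0}$ is a weak solution - (I) on $y>0,\ z>0$ with $\psi|_{z=0}=0$, if $B(v,\psi;w,\phi)=s(w,\phi)$ for all $w\in C_c^\infty((0,\infty)\times[0,\infty))$ and $\phi\in C_c^\infty((0,\infty)\times(0,\infty))$; - (II) on $y>0,\ 0<z<H$ with $\psi|_{z=0}=0$ and $\psi|_{z=H}=\Lambda v|_{z=H}$, where $H>0$ and $\Lambda:H^{1/2}_0\to H^{-1/2}$ is bounded, linear and non-positive ($\langle\Lambda f,f\rangle\le 0$ for all $f$), if there is $a\in H^{1/2}_0$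 (the trace of $v$ at $z=H$) such that \[ B(v,\psi;w,\phi)+\int_0^\infty a(y)\,\phi(y,H)\,dy+\langle\Lambda a,w(\cdot,H)\rangle=s(w,\phi) \] for all $w\in C_c^\infty((0,\infty)\times[0,H])$ and $\phi\in C_c^\infty((0,\infty)\times(0,H])$; - (III) on $y>0,\ z>H$ with $v|_{z=H}=v_H$, where $H>0$ and $v_H\in H^{1/2}_0$, if $B(v,\psi;w,\phi)-\int_0^\infty v_H(y)\,\phi(y,H)\,dy=s(w,\phi)$ for all $w\in C_c^\infty((0,\infty)\times(H,\infty))$ and $\phi\in C_c^\infty((0,\infty)\times[H,\infty))$. **Theorem.** In each of the cases (I), (II), (III), for given source and boundary data there is at most one weak solution in $\widetilde E_0$: any two such solutions $(v_1,\psi_1)$ and $(v_2,\psi_2)$ satisfy $v_1=v_2$ and $\psi_1=\psi_2$ almost everywhere in $\Omega$. -/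

import Mathlib

open MeasureTheory Set
open scoped ContDiff

noncomputable section

namespace EquatorialLayer

/-! Points of the plane are `p = (y, z)`, so `p.1 = y` and `p.2 = z`. -/

/-- The domain `{(y, z) : y > 0, z ∈ I}`. -/
def dom (I : Set ℝ) : Set (ℝ × ℝ) := Ioi (0 : ℝ) ×ˢ I

/-- The classical partial derivative `∂_y^k φ`. -/
def dY (k : ℕ) (φ : ℝ × ℝ → ℝ) (p : ℝ × ℝ) : ℝ := iteratedDeriv k (fun y => φ (y, p.2)) p.1

/-- The classical partial derivative `∂_z φ`. -/
def dZ (φ : ℝ × ℝ → ℝ) (p : ℝ × ℝ) : ℝ := deriv (fun z => φ (p.1, z)) p.2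

/-- Smooth functions with compact support contained in `(0, ∞) × J`. For an interval `I` of `z`
that is relatively closed in the open set `J`, the restrictions to `(0, ∞) × I` of these functions
are the smooth functions (up to the boundary) with compact support in `(0, ∞) × I`. -/
structure IsTest (J : Set ℝ) (φ : ℝ × ℝ → ℝ) : Prop where
  smooth : ContDiff ℝ ∞ φ
  compact : HasCompactSupport φ
  supp : tsupport φ ⊆ Ioi (0 : ℝ) ×ˢ J

/-- `g` is the weak derivative `∂_y^k f` on the open set `(0, ∞) × I`. -/
structure IsWeakDY (I : Set ℝ) (k : ℕ) (f g : ℝ × ℝ → ℝ) : Prop where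
  locInt : LocallyIntegrableOn f (dom I)
  locInt' : LocallyIntegrableOn g (dom I)
  eq : ∀ φ : ℝ × ℝ → ℝ, IsTest I φ →
    ∫ p in dom I, f p * dY k φ p = (-1) ^ k * ∫ p in dom I, g p * φ p

/-- `f` has a weak derivative `∂_y^k f` on `(0, ∞) × I`. -/
def HasWeakDY (I : Set ℝ) (k : ℕ) (f : ℝ × ℝ → ℝ) : Prop := ∃ g, IsWeakDY I k f g

open Classical in
/-- The weak derivative `∂_y^k f` on `(0, ∞) × I` (unique almost everywhere), `0` if there is
none. -/
def wDY (I : Set ℝ) (k : ℕ) (f : ℝ × ℝ → ℝ) : ℝ × ℝ → ℝ :=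
  if h : HasWeakDY I k f then h.choose else 0

/-- `f ∈ L²((0, ∞) × I)`. -/
def MemL2 (I : Set ℝ) (f : ℝ × ℝ → ℝ) : Prop := MemLp f 2 (volume.restrict (dom I))

/-- The energy space `E₀`: `∂_y v`, `v / (1 + y)`, `∂_y² ψ`, `ψ / (1 + y²)` belong to `L²`. -/
structure MemE (I : Set ℝ) (v ψ : ℝ × ℝ → ℝ) : Prop where
  hasDv : HasWeakDY I 1 v
  hasDψ : HasWeakDY I 2 ψ
  dv : MemL2 I (wDY I 1 v)
  v : MemL2 I (fun p => v p / (1 + p.1))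
  dψ : MemL2 I (wDY I 2 ψ)
  ψ : MemL2 I (fun p => ψ p / (1 + p.1 ^ 2))

/-- The energy space `E₀,₀` with homogeneous conditions at `y = 0`:
`∂_y v`, `v / y`, `∂_y² ψ`, `ψ / y²` belong to `L²`. -/
structure MemE0 (I : Set ℝ) (v ψ : ℝ × ℝ → ℝ) : Prop where
  hasDv : HasWeakDY I 1 v
  hasDψ : HasWeakDY I 2 ψ
  dv : MemL2 I (wDY I 1 v)
  v : MemL2 I (fun p => v p / p.1)
  dψ : MemL2 I (wDY I 2 ψ)
  ψ : MemL2 I (fun p => ψ p / p.1 ^ 2)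

/-- The space `Ẽ₀`: elements of `E₀` with `v, ψ ∈ L²`. -/
structure MemEtilde (I : Set ℝ) (v ψ : ℝ × ℝ → ℝ) : Prop where
  energy : MemE I v ψ
  v : MemL2 I v
  ψ : MemL2 I ψ

/-- The left-hand side of the weak formulation, tested with `(w, φ)`. -/
def weakForm (I : Set ℝ) (v ψ w φ : ℝ × ℝ → ℝ) : ℝ :=
  (∫ p in dom I, (-(v p * dZ φ p) - p.2 * v p * dY 1 φ p - 1 / 2 * wDY I 2 ψ p * dY 2 φ p)) +
  ∫ p in dom I, (-(ψ p * dZ w p) - p.2 * ψ p * dY 1 w p - 1 / 2 * wDY I 1 v p * dY 1 w p)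

/-- Lebesgue measure on `(0, ∞)`. -/
abbrev halfLine : Measure ℝ := volume.restrict (Ioi 0)

/-- `H^{1/2}_0(0, ∞)`: functions of `H^{1/2}(0, ∞)` (Gagliardo seminorm) with
`∫_0^1 |f|² / y dy < ∞`. Only the values on `(0, ∞)` matter. -/
def HHalf : Submodule ℝ (ℝ → ℝ) where
  carrier := {f | MemLp f 2 halfLine ∧
    MemLp (fun y => f y / √y) 2 (volume.restrict (Ioo 0 1)) ∧
    MemLp (fun q : ℝ × ℝ => (f q.1 - f q.2) / (q.1 - q.2)) 2 (halfLine.prod halfLine)}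
  zero_mem' := by
    refine ⟨MemLp.zero, ?_, ?_⟩ <;> simp
  add_mem' := by
    rintro f g ⟨h1, h2, h3⟩ ⟨k1, k2, k3⟩
    refine ⟨h1.add k1, ?_, ?_⟩
    · convert h2.add k2 using 1
      ext y
      simp only [Pi.add_apply]
      ring
    · convert h3.add k3 using 1
      ext q
      simp only [Pi.add_apply]
      ring
  smul_mem' := by
    rintro c f ⟨h1, h2, h3⟩
    refine ⟨h1.const_smul c, ?_, ?_⟩
    · convert h2.const_smul c using 1
      ext y
      simp only [Pi.smul_apply, smul_eq_mul]
      ring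
    · convert h3.const_smul c using 1
      ext q
      simp only [Pi.smul_apply, smul_eq_mul]
      ring

/-- The norm of `H^{1/2}_0(0, ∞)`. -/
def hHalfNorm (f : ℝ → ℝ) : ℝ :=
  √((∫ y in Ioi (0 : ℝ), f y ^ 2) + (∫ y in Ioo (0 : ℝ) 1, f y ^ 2 / y) +
    ∫ q, ((f q.1 - f q.2) / (q.1 - q.2)) ^ 2 ∂(halfLine.prod halfLine))

/-- A bounded linear operator `Λ : H^{1/2}_0 → H^{-1/2} = (H^{1/2}_0)'` with `⟨Λ f, f⟩ ≤ 0`. -/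
structure IsNonposOperator (Λ : HHalf →ₗ[ℝ] Module.Dual ℝ HHalf) : Prop where
  bounded : ∃ C : ℝ, ∀ f g : HHalf, |Λ f g| ≤ C * hHalfNorm f * hHalfNorm g
  nonpos : ∀ f : HHalf, Λ f f ≤ 0

/-- Smooth functions with compact support in `(0, ∞)` belong to `H^{1/2}_0(0, ∞)`. -/
theorem mem_HHalf_of_smooth {f : ℝ → ℝ} (hf : ContDiff ℝ 1 f) (hc : HasCompactSupport f)
    (h0 : f 0 = 0) : f ∈ HHalf := by
  obtain ⟨L, hL⟩ := hf.lipschitzWith_of_hasCompactSupport hc one_ne_zero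
  have hlip : ∀ x y, |f x - f y| ≤ L * |x - y| := fun x y => by
    simpa [Real.dist_eq] using hL.dist_le_mul x y
  obtain ⟨M, hM⟩ := hc.exists_bound_of_continuous hf.continuous
  have hM' : ∀ x, |f x| ≤ M := fun x => by simpa using hM x
  have hM0 : 0 ≤ M := (abs_nonneg _).trans (hM' 0)
  obtain ⟨R, hR0, hR⟩ : ∃ R : ℝ, 0 < R ∧ ∀ x, R < |x| → f x = 0 := by
    obtain ⟨R, hR0, hR⟩ := hc.isCompact.isBounded.subset_closedBall_lt 0 0
    refine ⟨R, hR0, fun x hx => ?_⟩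
    by_contra h
    have := hR (subset_tsupport f h)
    simp only [Metric.mem_closedBall, dist_zero_right, Real.norm_eq_abs] at this
    linarith
  have hmeas := hf.continuous.measurable
  refine ⟨(hf.continuous.memLp_of_hasCompactSupport hc), ?_, ?_⟩
  · refine MemLp.of_bound (C := L)
      (hmeas.div Real.continuous_sqrt.measurable).aestronglyMeasurable ?_
    filter_upwards [ae_restrict_mem measurableSet_Ioo] with y hy
    have h1 := hlip y 0
    rw [h0, sub_zero, sub_zero, abs_of_pos hy.1] at h1
    have hs : 0 < √y := Real.sqrt_pos.2 hy.1
    have hs1 : √y ≤ 1 := Real.sqrt_le_one.2 hy.2.le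
    have hL0 : (0 : ℝ) ≤ L := L.2
    rw [Real.norm_eq_abs, abs_div, abs_of_pos hs, div_le_iff₀ hs]
    refine h1.trans ?_
    have : y = √y * √y := (Real.mul_self_sqrt hy.1.le).symm
    nlinarith [mul_nonneg hL0 hs.le]
  · have hm : Measurable (fun q : ℝ × ℝ => (f q.1 - f q.2) / (q.1 - q.2)) := by fun_prop
    rw [memLp_two_iff_integrable_sq hm.aestronglyMeasurable]
    set K : ℝ := (L + 2 * M) ^ 2 * (2 * (1 + R) ^ 2) with hK
    have hI : Integrable (fun x : ℝ => (Icc (-R) R).indicator (fun _ => (1 : ℝ)) x) halfLine := by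
      refine Integrable.mono_measure ?_ Measure.restrict_le_self
      rw [integrable_indicator_iff measurableSet_Icc]
      exact integrableOn_const (by simp)
    have hJ : Integrable (fun x : ℝ => (1 + x ^ 2)⁻¹) halfLine :=
      integrable_inv_one_add_sq.mono_measure Measure.restrict_le_self
    have hdom := ((hI.mul_prod hJ).add (hJ.mul_prod hI)).const_mul K
    refine hdom.mono' (hm.pow_const 2).aestronglyMeasurable (Filter.Eventually.of_forall ?_)
    rintro ⟨x, y⟩
    have key : ∀ x y : ℝ, |x| ≤ R →
        ((f x - f y) / (x - y)) ^ 2 ≤ K * (1 + y ^ 2)⁻¹ := by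
      intro x y hx
      set t := |x - y| with ht
      have ht0 : 0 ≤ t := abs_nonneg _
      have hL0 : (0 : ℝ) ≤ L := L.2
      have ha : |(f x - f y) / (x - y)| * (1 + t) ≤ L + 2 * M := by
        rcases ht0.eq_or_lt with h | h
        · have : x - y = 0 := abs_eq_zero.1 (ht ▸ h.symm)
          rw [this]; simp; positivity
        · rw [abs_div, ← ht, div_mul_eq_mul_div, div_le_iff₀ h]
          have h1 := hlip x y
          have h2 : |f x - f y| ≤ 2 * M := by
            have := abs_sub (f x) (f y)
            linarith [hM' x, hM' y]
          nlinarith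
      have hb : 1 + y ^ 2 ≤ (2 * (1 + R) ^ 2) * (1 + t) ^ 2 := by
        have hy : |y| ≤ R + t := by
          have := abs_sub_abs_le_abs_sub y x
          rw [abs_sub_comm y x] at this
          linarith
        have : y ^ 2 ≤ (R + t) ^ 2 := by
          rw [← sq_abs]; exact pow_le_pow_left₀ (abs_nonneg _) hy 2
        nlinarith [mul_nonneg hR0.le ht0, mul_nonneg (mul_nonneg hR0.le ht0) ht0,
          mul_nonneg (mul_nonneg hR0.le ht0) (mul_nonneg hR0.le ht0), sq_nonneg R, sq_nonneg t,
          mul_nonneg (mul_nonneg hR0.le hR0.le) ht0]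
      rw [← div_eq_mul_inv, le_div_iff₀ (by positivity), ← sq_abs]
      calc |(f x - f y) / (x - y)| ^ 2 * (1 + y ^ 2)
          ≤ |(f x - f y) / (x - y)| ^ 2 * ((2 * (1 + R) ^ 2) * (1 + t) ^ 2) := by gcongr
        _ = (|(f x - f y) / (x - y)| * (1 + t)) ^ 2 * (2 * (1 + R) ^ 2) := by ring
        _ ≤ K := by rw [hK]; gcongr
    have hK0 : 0 ≤ K := by positivity
    have hx0 : 0 ≤ K * (1 + x ^ 2)⁻¹ := by positivity
    have hy0 : 0 ≤ K * (1 + y ^ 2)⁻¹ := by positivity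
    simp only [Pi.add_apply, Real.norm_eq_abs, abs_pow, sq_abs, indicator_apply, mem_Icc]
    by_cases hx : |x| ≤ R
    · have h1 := key x y hx
      rw [if_pos (abs_le.1 hx)]
      split_ifs <;> nlinarith
    · rw [if_neg (fun h => hx (abs_le.2 h))]
      by_cases hy : |y| ≤ R
      · have h1 := key y x hy
        rw [if_pos (abs_le.1 hy)]
        have h2 : ((f x - f y) / (x - y)) ^ 2 = ((f y - f x) / (y - x)) ^ 2 := by
          rw [← neg_sub (f y), ← neg_sub y, neg_div_neg_eq]
        rw [h2]
        linarith
      · rw [if_neg (fun h => hy (abs_le.2 h)), hR x (not_le.1 hx), hR y (not_le.1 hy)]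
        simp

theorem IsTest.trace_mem {J : Set ℝ} {w : ℝ × ℝ → ℝ} (hw : IsTest J w) (h : ℝ) :
    (fun y => w (y, h)) ∈ HHalf := by
  have hw0 : ∀ y ≤ 0, w (y, h) = 0 := fun y hy => by
    by_contra hne
    exact absurd (hw.supp (subset_tsupport w hne)).1 (not_lt.2 hy)
  refine mem_HHalf_of_smooth ?_ ?_ (hw0 0 le_rfl)
  · exact (hw.smooth.of_le (by exact_mod_cast le_top)).comp (by fun_prop)
  · refine HasCompactSupport.of_support_subset_isCompact
      (hw.compact.isCompact.image continuous_fst) ?_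
    intro y hy
    exact ⟨(y, h), subset_tsupport w hy, rfl⟩

/-- The trace `w(·, h)` of a test function, as an element of `H^{1/2}_0(0, ∞)`. -/
def IsTest.trace {J : Set ℝ} {w : ℝ × ℝ → ℝ} (hw : IsTest J w) (h : ℝ) : HHalf :=
  ⟨fun y => w (y, h), hw.trace_mem h⟩

/-- `(v, ψ)` belongs to `Ẽ₀` and has the same boundary values `v`, `∂_y ψ`, `ψ` at `y = 0` as
`(rv, rψ)`. For `rv = rψ = 0` these are the homogeneous conditions. -/
structure IsAdmissible (I : Set ℝ) (rv rψ v ψ : ℝ × ℝ → ℝ) : Prop where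
  mem : MemEtilde I v ψ
  boundary : MemE0 I (v - rv) (ψ - rψ)

/-- Weak solutions in `Ẽ₀` on `y > 0, z > 0`, with `ψ = 0` at `z = 0` and source `s`. -/
structure IsSolutionA (s : (ℝ × ℝ → ℝ) → (ℝ × ℝ → ℝ) → ℝ) (rv rψ v ψ : ℝ × ℝ → ℝ) : Prop where
  admissible : IsAdmissible (Ioi 0) rv rψ v ψ
  eq : ∀ w φ : ℝ × ℝ → ℝ, IsTest univ w → IsTest (Ioi 0) φ →
    weakForm (Ioi 0) v ψ w φ = s w φ

/-- Weak solutions in `Ẽ₀` on `y > 0, 0 < z < H`, with `ψ = 0` at `z = 0`, `ψ = Λ v` at `z = H` and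
source `s`. Here `a ∈ H^{1/2}_0` is the weak trace of `v` at `z = H`, and `Λ a` is that of `ψ`.
The boundary terms cancel when `φ(·, H) = -Λ* w(·, H)`. -/
structure IsSolutionB (H : ℝ) (Λ : HHalf →ₗ[ℝ] Module.Dual ℝ HHalf)
    (s : (ℝ × ℝ → ℝ) → (ℝ × ℝ → ℝ) → ℝ) (rv rψ v ψ : ℝ × ℝ → ℝ) : Prop where
  admissible : IsAdmissible (Ioo 0 H) rv rψ v ψ
  eq : ∃ a : HHalf, ∀ (w φ : ℝ × ℝ → ℝ) (hw : IsTest univ w), IsTest (Ioi 0) φ →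
    weakForm (Ioo 0 H) v ψ w φ + (∫ y in Ioi (0 : ℝ), (a : ℝ → ℝ) y * φ (y, H)) +
      Λ a (hw.trace H) = s w φ

/-- Weak solutions in `Ẽ₀` on `y > 0, z > H`, with `v = vH` at `z = H` and source `s`. -/
structure IsSolutionC (H : ℝ) (vH : HHalf)
    (s : (ℝ × ℝ → ℝ) → (ℝ × ℝ → ℝ) → ℝ) (rv rψ v ψ : ℝ × ℝ → ℝ) : Prop where
  admissible : IsAdmissible (Ioi H) rv rψ v ψ
  eq : ∀ w φ : ℝ × ℝ → ℝ, IsTest (Ioi H) w → IsTest univ φ →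
    weakForm (Ioi H) v ψ w φ - (∫ y in Ioi (0 : ℝ), (vH : ℝ → ℝ) y * φ (y, H)) = s w φ

end EquatorialLayer

end

/-!
# Uniqueness of weak solutions in a layer

By linearity, the difference `(v, ψ)` of two solutions solves the homogeneous equations. Formally,
testing the first equation with `ψ` and the second with `v` makes the terms with `∂_z` and the
transport terms cancel, and leaves `½ ∫ (∂_y v)² + (∂_y² ψ)²`, up to boundary terms that
vanish or have a sign. Hence `∂_y v = 0` and `∂_y² ψ = 0`, and since `v` and `ψ` vanish at
`y = 0`, they vanish everywhere (`IsHomogeneousPair.eq_zero`).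

*Conditions at `y = 0`.* As `v / y` and `ψ / y²` are square integrable, the weak derivatives `∂_y v`
and `∂_y² ψ` survive the extension of `v` and `ψ` by zero to the whole plane
(`IsWeakDY.isWeakPlane`).

*The energy identity.* Neither `v` nor `ψ` has a derivative `∂_z` in `L²`, so they cannot be used as
tests, and their traces at horizontal boundaries make no sense a priori. What makes the formal
computation rigorous is the correlation `C(s, t) = ∫ v(p) ψ(p - (s, t)) dp`, which is continuous.
Convolving `ψ` with kernels supported in `s > 0`, `t > 0` gives admissible tests for the equation of
`v`, and hence `∂_t C` for `s > 0`, `t > 0` (`corr_equation`). The tests of the other equation are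
required to vanish only on the other side of the layer, if at all, so they may be shifted by `t < 0`.
This gives `∂_t C` for `s < 0`, `t > 0`. Both formulas extend continuously to `s = 0` and `t = 0`, and
comparing them there gives the identity (`energy_identity`). The horizontal component of the shifts
moves the supports away from `y = 0`. On `z > H` the two equations exchange their roles.

*Unbounded layers.* On `z > 0` and `z > H` the transport coefficient `z` is unbounded, and the
identity is applied to `χ v` and `χ ψ` for cutoffs `χ(z)`. As `v` and `ψ` belong to `L²`, the error
`∫ χ χ' v ψ` tends to zero as the cutoffs expand (`IsHomogeneousPair.eq_zero_of_equations`).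

*The layer `0 < z < H`.* There both `v` and `ψ` have boundary values at `z = H`, namely `a` and `Λ a`.
The trace `a` is lifted to a function `A ∈ H¹` of the layer that vanishes at `y = 0`
(`exists_isLifting`), and `v - A` admits tests up to `z = H` with no boundary term. Testing the
equation of `ψ` with `A` turns the additional terms in the energy identity into `⟨Λ a, a⟩`, which is
not positive (`IsHomogeneousPair.energy_eq`). The lifting averages `a`, extended by zero, over points
to the left of `y` at distances comparable to `H - z` (`lift`), which makes it a limit of test
functions, and its derivatives are averages of difference quotients of `a`.
-/

namespace EquatorialLayer

open Filter Topology

/-! ### Square-integrable functions, translations and correlations -/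

section L2

variable {α : Type*} [MeasurableSpace α] {μ : Measure α}

theorem integrable_mul_of_memLp {f g : α → ℝ} (hf : MemLp f 2 μ) (hg : MemLp g 2 μ) :
    Integrable (fun x => f x * g x) μ :=
  hf.integrable_mul hg

theorem inner_toLp_eq {f g : α → ℝ} (hf : MemLp f 2 μ) (hg : MemLp g 2 μ) :
    inner ℝ (hf.toLp f) (hg.toLp g) = ∫ x, f x * g x ∂μ := by
  rw [L2.inner_def]
  refine integral_congr_ae ?_
  filter_upwards [hf.coeFn_toLp, hg.coeFn_toLp] with x h1 h2
  rw [h1, h2]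
  simp [mul_comm]

theorem abs_integral_mul_le {f g : α → ℝ} (hf : MemLp f 2 μ) (hg : MemLp g 2 μ) :
    |∫ x, f x * g x ∂μ| ≤ (eLpNorm f 2 μ).toReal * (eLpNorm g 2 μ).toReal := by
  rw [← inner_toLp_eq hf hg, ← Lp.norm_toLp f hf, ← Lp.norm_toLp g hg]
  exact abs_real_inner_le_norm _ _

theorem toReal_eLpNorm_two {f : α → ℝ} (hf : MemLp f 2 μ) :
    (eLpNorm f 2 μ).toReal = √(∫ x, f x ^ 2 ∂μ) := by
  rw [← Lp.norm_toLp f hf, ← Real.sqrt_sq (norm_nonneg (hf.toLp f)),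
    ← real_inner_self_eq_norm_sq, inner_toLp_eq hf hf]
  simp only [sq]

theorem toReal_eLpNorm_sub_le {u v w : α → ℝ} (hu : MemLp u 2 μ) (hv : MemLp v 2 μ)
    (hw : MemLp w 2 μ) :
    (eLpNorm (u - w) 2 μ).toReal ≤ (eLpNorm (u - v) 2 μ).toReal + (eLpNorm (v - w) 2 μ).toReal := by
  rw [← ENNReal.toReal_add (hu.sub hv).2.ne (hv.sub hw).2.ne]
  refine ENNReal.toReal_mono (ENNReal.add_ne_top.2 ⟨(hu.sub hv).2.ne, (hv.sub hw).2.ne⟩) ?_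
  have := eLpNorm_add_le (hu.sub hv).1 (hv.sub hw).1 (p := 2) (by norm_num)
  rwa [sub_add_sub_cancel] at this

theorem tendsto_integral_mul {ι : Type*} {l : Filter ι} {f g : α → ℝ} {u : ι → α → ℝ}
    (hf : MemLp f 2 μ) (hg : MemLp g 2 μ) (hu : ∀ i, MemLp (u i) 2 μ)
    (h : Tendsto (fun i => (eLpNorm (u i - g) 2 μ).toReal) l (𝓝 0)) :
    Tendsto (fun i => ∫ x, f x * u i x ∂μ) l (𝓝 (∫ x, f x * g x ∂μ)) := by
  rw [tendsto_iff_norm_sub_tendsto_zero]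
  have h2 := h.const_mul (eLpNorm f 2 μ).toReal
  rw [mul_zero] at h2
  refine squeeze_zero (fun _ => norm_nonneg _) (fun i => ?_) h2
  rw [← integral_sub (integrable_mul_of_memLp hf (hu i)) (integrable_mul_of_memLp hf hg)]
  have := abs_integral_mul_le hf ((hu i).sub hg)
  simpa only [Pi.sub_apply, mul_sub, Real.norm_eq_abs] using this

/-- Dominated convergence in `L²`. -/
theorem tendsto_eLpNorm_of_dominated {u : ℕ → α → ℝ} {g : α → ℝ} (bound : α → ℝ)
    (hb : MemLp bound 2 μ) (hg : MemLp g 2 μ) (hu : ∀ n, AEStronglyMeasurable (u n) μ)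
    (hub : ∀ n, ∀ᵐ x ∂μ, |u n x - g x| ≤ bound x)
    (hlim : ∀ᵐ x ∂μ, Tendsto (fun n => u n x) atTop (𝓝 (g x))) :
    Tendsto (fun n => (eLpNorm (u n - g) 2 μ).toReal) atTop (𝓝 0) := by
  have hm : ∀ n, MemLp (u n - g) 2 μ := fun n => by
    refine hb.mono ((hu n).sub hg.1) ?_
    filter_upwards [hub n] with x hx
    exact hx.trans (le_abs_self _)
  have key : Tendsto (fun n => ∫ x, (u n - g) x ^ 2 ∂μ) atTop (𝓝 (∫ _, 0 ∂μ)) := by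
    refine tendsto_integral_of_dominated_convergence (fun x => bound x ^ 2)
      (fun n => (hm n).1.pow 2) hb.integrable_sq (fun n => ?_) ?_
    · filter_upwards [hub n] with x hx
      rw [Real.norm_eq_abs, abs_pow]
      exact pow_le_pow_left₀ (abs_nonneg _) hx 2
    · filter_upwards [hlim] with x hx
      have := (hx.sub_const (g x)).pow 2
      simpa using this
  rw [integral_zero] at key
  have := (Real.continuous_sqrt.tendsto 0).comp key
  rw [Real.sqrt_zero] at this
  exact this.congr fun n => (toReal_eLpNorm_two (hm n)).symm

end L2

section Translation

variable {E : Type*} [NormedAddCommGroup E] [NormedSpace ℝ E] [FiniteDimensional ℝ E]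
  [MeasurableSpace E] [BorelSpace E] {μ : Measure E} [μ.IsAddHaarMeasure]

omit [NormedSpace ℝ E] [FiniteDimensional ℝ E] in
theorem memLp_translate {f : E → ℝ} (hf : MemLp f 2 μ) (s : E) :
    MemLp (fun x => f (x - s)) 2 μ :=
  hf.comp_measurePreserving (measurePreserving_sub_right μ s)

theorem continuous_toLp_translate {f : E → ℝ} (hf : MemLp f 2 μ) :
    Continuous fun s : E => (memLp_translate hf s).toLp (fun x => f (x - s)) := by
  let g : C(E, C(E, E)) := ContinuousMap.curry ⟨fun p : E × E => p.2 - p.1, by fun_prop⟩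
  have := (continuous_const (y := hf.toLp f)).compMeasurePreservingLp g.continuous
    (fun s => measurePreserving_sub_right μ s) (by simp)
  exact this

theorem continuous_eLpNorm_translate_sub {f : E → ℝ} (hf : MemLp f 2 μ) :
    Continuous fun s : E => (eLpNorm (fun x => f (x - s) - f x) 2 μ).toReal := by
  have := ((continuous_toLp_translate hf).sub (continuous_const (y := hf.toLp f))).norm
  refine this.congr fun s => ?_
  rw [Pi.sub_apply, ← MemLp.toLp_sub, Lp.norm_toLp]
  rfl

end Translation

/-- The correlation `s ↦ ∫ f(p) g(p - s) dp` of two functions on the plane. -/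
noncomputable def corr (f g : ℝ × ℝ → ℝ) (s : ℝ × ℝ) : ℝ := ∫ p, f p * g (p - s)

theorem corr_zero (f g : ℝ × ℝ → ℝ) : corr f g 0 = ∫ p, f p * g p := by
  simp [corr]

theorem corr_neg (f g : ℝ × ℝ → ℝ) (s : ℝ × ℝ) : corr f g (-s) = corr g f s := by
  unfold corr
  rw [← integral_sub_right_eq_self (fun p => f p * g (p - -s)) s]
  refine integral_congr_ae (.of_forall fun p => ?_)
  simp [mul_comm]

theorem continuous_corr {f g : ℝ × ℝ → ℝ} (hf : MemLp f 2) (hg : MemLp g 2) :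
    Continuous (corr f g) := by
  have := (continuous_const (y := hf.toLp f)).inner (𝕜 := ℝ) (continuous_toLp_translate hg)
  refine this.congr fun s => ?_
  exact inner_toLp_eq hf (memLp_translate hg s)

theorem abs_corr_le {f g : ℝ × ℝ → ℝ} (hf : MemLp f 2) (hg : MemLp g 2) (s : ℝ × ℝ) :
    |corr f g s| ≤ (eLpNorm f 2).toReal * (eLpNorm g 2).toReal := by
  have h := abs_integral_mul_le hf (memLp_translate hg s)
  have h2 : eLpNorm (fun x => g (x - s)) 2 volume = eLpNorm g 2 volume :=
    eLpNorm_comp_measurePreserving hg.1 (measurePreserving_sub_right volume s)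
  rwa [h2] at h

/-- Pairing `f` with the convolution `g ⋆ k` amounts to pairing `k` with the correlation
of `f` and `g`. -/
theorem integral_mul_convolution {f g k : ℝ × ℝ → ℝ} (hf : MemLp f 2) (hg : MemLp g 2)
    (hk : Integrable k) :
    ∫ p, f p * (∫ q, g q * k (p - q)) = ∫ s, k s * corr f g s := by
  have h1 : ∀ p, ∫ q, g q * k (p - q) = ∫ s, k s * g (p - s) := fun p => by
    rw [← integral_sub_left_eq_self (fun s => k s * g (p - s)) volume p]
    refine integral_congr_ae (.of_forall fun q => ?_)
    simp [mul_comm]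
  have hmeas : AEStronglyMeasurable (fun z : (ℝ × ℝ) × (ℝ × ℝ) => f z.1 * (k z.2 * g (z.1 - z.2)))
      (volume.prod volume) := by
    refine hf.1.comp_fst.mul (hk.1.comp_snd.mul ?_)
    exact hg.1.comp_quasiMeasurePreserving (quasiMeasurePreserving_sub volume volume)
  have hint : Integrable (Function.uncurry fun p s : ℝ × ℝ => f p * (k s * g (p - s)))
      (volume.prod volume) := by
    have hmeas' : AEStronglyMeasurable (Function.uncurry fun p s : ℝ × ℝ => f p * (k s * g (p - s)))
      (volume.prod volume) := hmeas
    rw [integrable_prod_iff' hmeas']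
    have habs : ∀ s p : ℝ × ℝ, f p * (k s * g (p - s)) = k s * (f p * g (p - s)) := fun s p => by
      ring
    refine ⟨.of_forall fun s => ?_, ?_⟩
    · simp only [Function.uncurry, habs]
      exact (integrable_mul_of_memLp hf (memLp_translate hg s)).const_mul _
    · refine (hk.norm.mul_const ((eLpNorm f 2).toReal * (eLpNorm g 2).toReal)).mono'
        hmeas'.norm.prod_swap.integral_prod_right' (.of_forall fun s => ?_)
      have h0 : 0 ≤ ∫ p, ‖f p * (k s * g (p - s))‖ := by positivity
      simp only [Function.uncurry]
      rw [Real.norm_of_nonneg h0]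
      simp only [habs, norm_mul]
      rw [integral_const_mul]
      refine mul_le_mul_of_nonneg_left ?_ (norm_nonneg _)
      refine (le_abs_self _).trans ?_
      have := abs_corr_le hf.norm hg.norm s
      rwa [eLpNorm_norm, eLpNorm_norm] at this
  simp only [h1, ← integral_const_mul]
  rw [integral_integral_swap hint]
  refine integral_congr_ae (.of_forall fun s => ?_)
  simp only [corr]
  rw [← integral_const_mul]
  refine integral_congr_ae (.of_forall fun p => ?_)
  simp only
  ring

/-! ### Partial derivatives of test functions -/

theorem dY_zero (φ : ℝ × ℝ → ℝ) : dY 0 φ = φ := by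
  ext p; simp [dY]

theorem dY_succ (k : ℕ) (φ : ℝ × ℝ → ℝ) : dY (k + 1) φ = dY 1 (dY k φ) := by
  ext p
  simp [dY, iteratedDeriv_succ]

theorem hasDerivAt_fst {φ : ℝ × ℝ → ℝ} {L : ℝ × ℝ →L[ℝ] ℝ} {p : ℝ × ℝ} (h : HasFDerivAt φ L p) :
    HasDerivAt (fun y => φ (y, p.2)) (L (1, 0)) p.1 := by
  have h2 : HasDerivAt (fun y : ℝ => (y, p.2)) ((1 : ℝ), (0 : ℝ)) p.1 :=
    (hasDerivAt_id p.1).prodMk (hasDerivAt_const _ _)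
  exact h.comp_hasDerivAt p.1 h2

theorem hasDerivAt_snd {φ : ℝ × ℝ → ℝ} {L : ℝ × ℝ →L[ℝ] ℝ} {p : ℝ × ℝ} (h : HasFDerivAt φ L p) :
    HasDerivAt (fun z => φ (p.1, z)) (L (0, 1)) p.2 := by
  have h2 : HasDerivAt (fun z : ℝ => (p.1, z)) ((0 : ℝ), (1 : ℝ)) p.2 :=
    (hasDerivAt_const _ _).prodMk (hasDerivAt_id p.2)
  exact h.comp_hasDerivAt p.2 h2

theorem dY_one_of_hasFDerivAt {φ : ℝ × ℝ → ℝ} {L : ℝ × ℝ →L[ℝ] ℝ} {p : ℝ × ℝ}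
    (h : HasFDerivAt φ L p) : dY 1 φ p = L (1, 0) := by
  simpa [dY] using (hasDerivAt_fst h).deriv

theorem dZ_of_hasFDerivAt {φ : ℝ × ℝ → ℝ} {L : ℝ × ℝ →L[ℝ] ℝ} {p : ℝ × ℝ}
    (h : HasFDerivAt φ L p) : dZ φ p = L (0, 1) :=
  (hasDerivAt_snd h).deriv

/-- Smooth functions with compact support in the plane, with no condition at `y = 0`. -/
structure IsTestPlane (φ : ℝ × ℝ → ℝ) : Prop where
  smooth : ContDiff ℝ ∞ φ
  compact : HasCompactSupport φ

theorem IsTest.plane {J : Set ℝ} {φ : ℝ × ℝ → ℝ} (h : IsTest J φ) : IsTestPlane φ :=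
  ⟨h.smooth, h.compact⟩

namespace IsTestPlane

variable {φ ψ : ℝ × ℝ → ℝ}

theorem hasFDerivAt (h : IsTestPlane φ) (p : ℝ × ℝ) : HasFDerivAt φ (fderiv ℝ φ p) p :=
  ((h.smooth.differentiable (by simp)) p).hasFDerivAt

theorem fderiv_apply (h : IsTestPlane φ) (e : ℝ × ℝ) : IsTestPlane (fun p => fderiv ℝ φ p e) :=
  ⟨(h.smooth.fderiv_right (m := ∞) (by simp)).clm_apply contDiff_const, h.compact.fderiv_apply ℝ e⟩

theorem dY_one_eq (h : IsTestPlane φ) : dY 1 φ = fun p => fderiv ℝ φ p (1, 0) := by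
  ext p; exact dY_one_of_hasFDerivAt (h.hasFDerivAt p)

theorem dZ_eq (h : IsTestPlane φ) : dZ φ = fun p => fderiv ℝ φ p (0, 1) := by
  ext p; exact dZ_of_hasFDerivAt (h.hasFDerivAt p)

theorem dZ (h : IsTestPlane φ) : IsTestPlane (dZ φ) := by
  rw [h.dZ_eq]; exact h.fderiv_apply _

theorem dY_one (h : IsTestPlane φ) : IsTestPlane (dY 1 φ) := by
  rw [h.dY_one_eq]; exact h.fderiv_apply _

theorem dY (h : IsTestPlane φ) (k : ℕ) : IsTestPlane (dY k φ) := by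
  induction k with
  | zero => rwa [dY_zero]
  | succ k ih => rw [dY_succ]; exact ih.dY_one

theorem continuous (h : IsTestPlane φ) : Continuous φ := h.smooth.continuous

theorem memLp (h : IsTestPlane φ) : MemLp φ 2 := h.continuous.memLp_of_hasCompactSupport h.compact

theorem integrable (h : IsTestPlane φ) : Integrable φ :=
  h.continuous.integrable_of_hasCompactSupport h.compact

theorem mul (h : IsTestPlane φ) (hψ : ContDiff ℝ ∞ ψ) : IsTestPlane (fun p => φ p * ψ p) :=
  ⟨h.smooth.mul hψ, h.compact.mul_right⟩

end IsTestPlane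

theorem IsTest.zero (J : Set ℝ) : IsTest J (fun _ => 0) :=
  ⟨contDiff_const, HasCompactSupport.zero, by simp [tsupport, Function.support]⟩

theorem IsTest.mul {J : Set ℝ} {φ ψ : ℝ × ℝ → ℝ} (h : IsTest J φ) (hψ : ContDiff ℝ ∞ ψ) :
    IsTest J (fun p => φ p * ψ p) :=
  ⟨h.smooth.mul hψ, h.compact.mul_right, (tsupport_mul_subset_left).trans h.supp⟩

/-! ### Convolutions as test functions -/

theorem integral_neg_add_sub {α : Type*} [MeasurableSpace α] {μ : Measure α} {a b c : α → ℝ}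
    (ha : Integrable a μ) (hb : Integrable b μ) (hc : Integrable c μ) :
    ∫ x, (-(a x) + b x - c x) ∂μ = -(∫ x, a x ∂μ) + (∫ x, b x ∂μ) - ∫ x, c x ∂μ := by
  have h1 := integral_sub (ha.neg.add hb) hc
  have h2 := integral_add ha.neg hb
  simp only [Pi.add_apply, Pi.neg_apply, integral_neg] at h1 h2
  rw [h1, h2]

/-- The convolution `f ⋆ k` on the plane. -/
noncomputable def conv (k f : ℝ × ℝ → ℝ) (p : ℝ × ℝ) : ℝ := ∫ q, f q * k (p - q)

theorem hasFDerivAt_conv {k f : ℝ × ℝ → ℝ} (hk : IsTestPlane k) (hf : LocallyIntegrable f)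
    (p : ℝ × ℝ) : ∃ L : ℝ × ℝ →L[ℝ] ℝ, HasFDerivAt (conv k f) L p ∧
      ∀ e, L e = conv (fun q => fderiv ℝ k q e) f p := by
  have hk1 : ContDiff ℝ 1 k := hk.smooth.of_le (by exact_mod_cast le_top)
  refine ⟨_, hk.compact.hasFDerivAt_convolution_right (ContinuousLinearMap.mul ℝ ℝ) hf hk1 p,
    fun e => ?_⟩
  rw [convolution_precompR_apply _ hf (hk.compact.fderiv ℝ) (hk1.continuous_fderiv (by simp))]
  rfl

theorem dZ_conv {k f : ℝ × ℝ → ℝ} (hk : IsTestPlane k) (hf : LocallyIntegrable f) :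
    dZ (conv k f) = conv (dZ k) f := by
  ext p
  obtain ⟨L, h1, h2⟩ := hasFDerivAt_conv hk hf p
  rw [dZ_of_hasFDerivAt h1, h2, hk.dZ_eq]

theorem dY_one_conv {k f : ℝ × ℝ → ℝ} (hk : IsTestPlane k) (hf : LocallyIntegrable f) :
    dY 1 (conv k f) = conv (dY 1 k) f := by
  ext p
  obtain ⟨L, h1, h2⟩ := hasFDerivAt_conv hk hf p
  rw [dY_one_of_hasFDerivAt h1, h2, hk.dY_one_eq]

theorem dY_conv {k f : ℝ × ℝ → ℝ} (hk : IsTestPlane k) (hf : LocallyIntegrable f) (j : ℕ) :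
    dY j (conv k f) = conv (dY j k) f := by
  induction j with
  | zero => simp only [dY_zero]
  | succ j ih => rw [dY_succ, ih, dY_one_conv (hk.dY j) hf, ← dY_succ]

open scoped Pointwise in
/-- A kernel supported in `s > 0` moves functions supported in `y ≥ 0` away from the boundary, so
the convolution vanishes near `y = 0`. -/
theorem isTest_conv {J T : Set ℝ} {k f : ℝ × ℝ → ℝ} (hk : IsTest T k)
    (hf : LocallyIntegrable f) {B : Set (ℝ × ℝ)} (hB : IsCompact B) (hfB : ∀ p ∉ B, f p = 0)
    (hBJ : ∀ p ∈ B, 0 ≤ p.1 ∧ ∀ t ∈ T, p.2 + t ∈ J) : IsTest J (conv k f) := by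
  have hsub : tsupport (conv k f) ⊆ B + tsupport k := by
    refine closure_minimal ?_ (hB.add hk.compact).isClosed
    refine (support_convolution_subset (ContinuousLinearMap.mul ℝ ℝ)).trans
      (Set.add_subset_add ?_ (subset_tsupport k))
    intro p hp
    by_contra h
    exact hp (hfB p h)
  refine ⟨?_, ?_, hsub.trans ?_⟩
  · exact hk.compact.contDiff_convolution_right (n := ⊤)
      (ContinuousLinearMap.mul ℝ ℝ) hf hk.smooth
  · exact (hB.add hk.compact).of_isClosed_subset (isClosed_tsupport _) hsub
  · rintro _ ⟨p, hp, q, hq, rfl⟩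
    have h1 := hBJ p hp
    have h2 := hk.supp hq
    exact ⟨add_pos_of_nonneg_of_pos h1.1 h2.1, h1.2 _ h2.2⟩

theorem dY_comp_sub (k : ℝ × ℝ → ℝ) (j : ℕ) (p q : ℝ × ℝ) :
    dY j (fun q => k (p - q)) q = (-1) ^ j * dY j k (p - q) := by
  have := iteratedDeriv_comp_const_sub (𝕜 := ℝ) j (fun y => k (y, p.2 - q.2)) p.1
  simp only [dY, Prod.fst_sub, Prod.snd_sub]
  exact congrFun this q.1

theorem IsTestPlane.comp_sub {k : ℝ × ℝ → ℝ} (hk : IsTestPlane k) (p : ℝ × ℝ) :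
    IsTestPlane (fun q => k (p - q)) :=
  ⟨hk.smooth.comp (contDiff_const.sub contDiff_id),
    hk.compact.comp_homeomorph (Homeomorph.subLeft p)⟩

/-- `g` is the weak derivative `∂_y^j f` on the whole plane. -/
def IsWeakPlane (j : ℕ) (f g : ℝ × ℝ → ℝ) : Prop :=
  ∀ φ, IsTestPlane φ → ∫ p, f p * dY j φ p = (-1) ^ j * ∫ p, g p * φ p

theorem IsWeakPlane.conv_eq {j : ℕ} {f g k : ℝ × ℝ → ℝ} (h : IsWeakPlane j f g)
    (hk : IsTestPlane k) : conv (dY j k) f = conv k g := by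
  ext p
  have := h _ (hk.comp_sub p)
  simp only [dY_comp_sub] at this
  have h2 : ∀ q, f q * ((-1) ^ j * dY j k (p - q)) = (-1) ^ j * (f q * dY j k (p - q)) := by
    intro q; ring
  simp only [h2, integral_const_mul] at this
  exact mul_left_cancel₀ (pow_ne_zero j (by norm_num)) this

/-- If `X` solves `∂_z X + F - (-∂_y)^j D = 0` weakly, tested on `(0, ∞) × J`, then its correlation
with a function `Y` that admits the tests `Y ⋆ k` solves the corresponding equation. -/
theorem corr_equation {J T S : Set ℝ} {X F D Y E k : ℝ × ℝ → ℝ} {j : ℕ}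
    (hX : MemLp X 2) (hF : MemLp F 2) (hD : MemLp D 2) (hY : MemLp Y 2) (hE : MemLp E 2)
    (heq : ∀ φ, IsTest J φ → ∫ p, (-(X p * dZ φ p) + F p * φ p - D p * dY j φ p) = 0)
    (hYE : IsWeakPlane j Y E) (hS : IsClosed S) (hYS : ∀ p, ¬(0 ≤ p.1 ∧ p.2 ∈ S) → Y p = 0)
    (hJ : ∀ z ∈ S, ∀ t ∈ T, z + t ∈ J) (hk : IsTest T k) :
    -(∫ s, dZ k s * corr X Y s) + (∫ s, k s * corr F Y s) - ∫ s, k s * corr D E s = 0 := by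
  -- `Y ⋆ k` is a test function only if `Y` has bounded support, hence the truncation. It is done
  -- before any derivative falls on `Y`, so that it need not be smooth.
  set Yn : ℕ → ℝ × ℝ → ℝ := fun n => (Metric.closedBall 0 (n : ℝ)).indicator Y with hYn
  have hball : ∀ n : ℕ, MeasurableSet (Metric.closedBall (0 : ℝ × ℝ) n) := fun n =>
    measurableSet_closedBall
  have hYn2 : ∀ n, MemLp (Yn n) 2 := fun n => hY.indicator (hball n)
  have hlim : Tendsto (fun n => (eLpNorm (Yn n - Y) 2).toReal) atTop (𝓝 0) := by
    refine tendsto_eLpNorm_of_dominated (fun p => |Y p|) hY.norm hY (fun n => (hYn2 n).1)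
      (fun n => .of_forall fun p => ?_) (.of_forall fun p => ?_)
    · simp only [hYn, indicator]; split_ifs <;> simp
    · refine tendsto_const_nhds.congr' ?_
      filter_upwards [eventually_ge_atTop ⌈‖p‖⌉₊] with n hn
      rw [hYn]
      simp only
      rw [indicator_of_mem]
      rw [mem_closedBall_zero_iff]
      exact (Nat.le_ceil _).trans (by exact_mod_cast hn)
  have hcorr : ∀ {G h : ℝ × ℝ → ℝ}, MemLp G 2 → IsTestPlane h →
      Tendsto (fun n => ∫ s, h s * corr G (Yn n) s) atTop (𝓝 (∫ s, h s * corr G Y s)) := by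
    intro G h hG hh
    refine tendsto_integral_of_dominated_convergence
      (fun s => |h s| * ((eLpNorm G 2).toReal * (eLpNorm Y 2).toReal)) (fun n => ?_)
      (hh.integrable.abs.mul_const _) (fun n => .of_forall fun s => ?_) (.of_forall fun s => ?_)
    · exact (hh.continuous.mul (continuous_corr hG (hYn2 n))).aestronglyMeasurable
    · rw [norm_mul]
      refine mul_le_mul_of_nonneg_left ((abs_corr_le hG (hYn2 n) s).trans ?_) (norm_nonneg _)
      refine mul_le_mul_of_nonneg_left ?_ ENNReal.toReal_nonneg
      exact ENNReal.toReal_mono hY.2.ne (eLpNorm_indicator_le _)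
    · refine Tendsto.const_mul _ ?_
      refine tendsto_integral_mul hG (memLp_translate hY s) (fun n => memLp_translate (hYn2 n) s) ?_
      refine hlim.congr fun n => ?_
      congr 1
      exact (eLpNorm_comp_measurePreserving ((hYn2 n).sub hY).1
        (measurePreserving_sub_right volume s)).symm
  have hn : ∀ n, -(∫ s, dZ k s * corr X (Yn n) s) + (∫ s, k s * corr F (Yn n) s)
      - ∫ s, dY j k s * corr D (Yn n) s = 0 := by
    intro n
    have hloc : LocallyIntegrable (Yn n) := (hYn2 n).locallyIntegrable (by norm_num)
    have htest : IsTest J (conv k (Yn n)) := by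
      refine isTest_conv (B := Metric.closedBall 0 (n : ℝ) ∩ {p | 0 ≤ p.1 ∧ p.2 ∈ S}) hk hloc
        ?_ ?_ ?_
      · refine (isCompact_closedBall _ _).inter_right ?_
        exact (isClosed_le continuous_const continuous_fst).inter (hS.preimage continuous_snd)
      · intro p hp
        simp only [hYn, indicator]
        split_ifs with h
        · exact hYS p fun h' => hp ⟨h, h'⟩
        · rfl
      · exact fun p hp => ⟨hp.2.1, hJ _ hp.2.2⟩
    have h := heq _ htest
    rw [dZ_conv hk.plane hloc, dY_conv hk.plane hloc] at h
    have t1 : MemLp (conv (dZ k) (Yn n)) 2 := by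
      rw [← dZ_conv hk.plane hloc]; exact htest.plane.dZ.memLp
    have t2 : MemLp (conv (dY j k) (Yn n)) 2 := by
      rw [← dY_conv hk.plane hloc]; exact (htest.plane.dY j).memLp
    have i1 := integrable_mul_of_memLp hX t1
    have i2 := integrable_mul_of_memLp hF htest.plane.memLp
    have i3 := integrable_mul_of_memLp hD t2
    rw [integral_neg_add_sub i1 i2 i3] at h
    rw [← integral_mul_convolution hX (hYn2 n) hk.plane.dZ.integrable,
      ← integral_mul_convolution hF (hYn2 n) hk.plane.integrable,
      ← integral_mul_convolution hD (hYn2 n) (hk.plane.dY j).integrable]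
    exact h
  -- In the limit, `∂_y^j` is moved from `k` to `Y`.
  have hE' : ∫ s, k s * corr D E s = ∫ s, dY j k s * corr D Y s := by
    rw [← integral_mul_convolution hD hE hk.plane.integrable,
      ← integral_mul_convolution hD hY (hk.plane.dY j).integrable]
    exact congrArg (fun u : ℝ × ℝ → ℝ => ∫ p, D p * u p) (hYE.conv_eq hk.plane).symm
  rw [hE']
  refine tendsto_nhds_unique ((((hcorr hX hk.plane.dZ).neg).add (hcorr hF hk.plane)).sub
    (hcorr hD (hk.plane.dY j))) ?_
  simp only [hn]
  exact tendsto_const_nhds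

/-! ### The energy identity on the whole plane -/

/-- A continuous function that vanishes weakly on `(0, ∞)` vanishes also at the endpoint. -/
theorem eq_zero_of_integral_test_eq_zero {f : ℝ → ℝ} (hf : Continuous f)
    (h : ∀ κ : ℝ → ℝ, ContDiff ℝ ∞ κ → HasCompactSupport κ → tsupport κ ⊆ Ioi 0 →
      ∫ s, κ s * f s = 0) : f 0 = 0 := by
  have h1 : ∀ᵐ s : ℝ, s ∈ Ioi (0 : ℝ) → f s = 0 :=
    isOpen_Ioi.ae_eq_zero_of_integral_contDiff_smul_eq_zero
      (hf.locallyIntegrable.locallyIntegrableOn _) (fun g h1 h2 h3 => h g h1 h2 h3)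
  have h2 : EqOn f 0 (Ioi 0) := by
    refine Measure.eqOn_open_of_ae_eq (μ := volume) ?_ isOpen_Ioi hf.continuousOn continuousOn_const
    exact (ae_restrict_iff' measurableSet_Ioi).2 h1
  have h3 := h2.closure hf continuous_const
  rw [closure_Ioi] at h3
  exact h3 self_mem_Ici

theorem isTest_mul {T : Set ℝ} {κ ρ : ℝ → ℝ} (hκ : ContDiff ℝ ∞ κ) (hκc : HasCompactSupport κ)
    (hκ0 : tsupport κ ⊆ Ioi 0) (hρ : ContDiff ℝ ∞ ρ) (hρc : HasCompactSupport ρ)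
    (hρT : tsupport ρ ⊆ T) : IsTest T (fun p => κ p.1 * ρ p.2) := by
  have hsub : tsupport (fun p : ℝ × ℝ => κ p.1 * ρ p.2) ⊆ tsupport κ ×ˢ tsupport ρ := by
    refine closure_minimal ?_ ((isClosed_tsupport κ).prod (isClosed_tsupport ρ))
    intro p hp
    exact ⟨subset_tsupport κ (left_ne_zero_of_mul hp), subset_tsupport ρ (right_ne_zero_of_mul hp)⟩
  refine ⟨(hκ.comp contDiff_fst).mul (hρ.comp contDiff_snd), ?_, hsub.trans (prod_mono hκ0 hρT)⟩
  exact (hκc.isCompact.prod hρc.isCompact).of_isClosed_subset (isClosed_tsupport _) hsub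

/-- If `∂_t C + P = 0` weakly for `s > 0`, and `C` and `P` are continuous up to `s = 0`, then the
equation also holds weakly on the line `s = 0`. -/
theorem boundary_equation {C P : ℝ × ℝ → ℝ} {T : Set ℝ} (hC : Continuous C) (hP : Continuous P)
    (h : ∀ k, IsTest T k → -(∫ s, dZ k s * C s) + ∫ s, k s * P s = 0) {ρ : ℝ → ℝ}
    (hρ : ContDiff ℝ ∞ ρ) (hρc : HasCompactSupport ρ) (hρT : tsupport ρ ⊆ T) :
    -(∫ t, deriv ρ t * C (0, t)) + ∫ t, ρ t * P (0, t) = 0 := by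
  have hρ' : Continuous (deriv ρ) := hρ.continuous_deriv (by simp)
  have hint : ∀ {g : ℝ → ℝ} {G : ℝ × ℝ → ℝ}, Continuous g → HasCompactSupport g → Continuous G →
      Continuous fun s => ∫ t, g t * G (s, t) := by
    intro g G hg hgc hG
    have h1 : ∀ s, ∫ t, g t * G (s, t) = ∫ t in tsupport g, g t * G (s, t) := fun s => by
      refine (setIntegral_eq_integral_of_forall_compl_eq_zero fun t ht => ?_).symm
      rw [image_eq_zero_of_notMem_tsupport ht, zero_mul]
    simp only [h1]
    exact continuous_parametric_integral_of_continuous (by fun_prop) hgc.isCompact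
  -- With the kernel `κ(s) ρ(t)`, the equation says that a continuous function of `s` vanishes weakly.
  have h2 := (hint hρ' hρc.deriv hC).neg.add (hint hρ.continuous hρc hP)
  refine eq_zero_of_integral_test_eq_zero h2 fun κ hκ hκc hκ0 => ?_
  have hk := isTest_mul hκ hκc hκ0 hρ hρc hρT
  have hd : ∀ p : ℝ × ℝ, dZ (fun p => κ p.1 * ρ p.2) p = κ p.1 * deriv ρ p.2 := fun p => by
    simp [dZ]
  have hfub : ∀ {g : ℝ → ℝ} {G : ℝ × ℝ → ℝ}, Continuous g → HasCompactSupport g → Continuous G →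
      Integrable (fun s => κ s * ∫ t, g t * G (s, t)) ∧
      ∫ p : ℝ × ℝ, κ p.1 * g p.2 * G p = ∫ s, κ s * ∫ t, g t * G (s, t) := by
    intro g G hg hgc hG
    have hi : Integrable (fun p : ℝ × ℝ => κ p.1 * g p.2 * G p) (volume.prod volume) := by
      refine Continuous.integrable_of_hasCompactSupport ?_ ?_
      · have := hκ.continuous; fun_prop
      · refine HasCompactSupport.mul_right ?_
        refine HasCompactSupport.of_support_subset_isCompact
          (hκc.isCompact.prod hgc.isCompact) fun p hp => ?_
        exact ⟨subset_tsupport κ (left_ne_zero_of_mul hp),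
          subset_tsupport g (right_ne_zero_of_mul hp)⟩
    refine ⟨(hκ.continuous.mul (hint hg hgc hG)).integrable_of_hasCompactSupport
      hκc.mul_right, ?_⟩
    rw [Measure.volume_eq_prod, integral_prod _ hi]
    refine integral_congr_ae (.of_forall fun s => ?_)
    simp only [mul_assoc]
    exact integral_const_mul _ _
  have h3 := h _ hk
  simp only [hd] at h3
  obtain ⟨i1, e1⟩ := hfub hρ' hρc.deriv hC
  obtain ⟨i2, e2⟩ := hfub hρ.continuous hρc hP
  have e3 := integral_add i1.neg i2
  simp only [Pi.neg_apply, integral_neg] at e3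
  rw [e1, e2, ← e3] at h3
  rw [← h3]
  refine integral_congr_ae (.of_forall fun s => ?_)
  simp only [Pi.add_apply, Pi.neg_apply]
  ring

/-- The energy identity: `X` solves `∂_z X + F - (-∂_y)^j D = 0` and `Y` solves
`∂_z Y + G - (-∂_y)^i K = 0`, both weakly, where the equation of `X` admits translates of `Y` to the
upper right as tests and that of `Y` admits translates of `X` to the lower right. Testing them with
`Y` and `X` makes the terms with `∂_z` cancel.

Neither `X` nor `Y` has a derivative `∂_z`, so they are not admissible tests. Instead, the two
equations give `∂_t` of the correlation `C` of `X` and `Y` for `s > 0`, `t > 0`, and of that of `Y`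
and `X`, which is `C(-·)`, for `s > 0`, `t < 0`. Both extend to `s = 0`, and comparing them at `t`
and `-t` as `t → 0` gives the identity. -/
theorem energy_identity {J₁ J₂ S₁ S₂ : Set ℝ} {X F D L Y G K E : ℝ × ℝ → ℝ} {i j : ℕ}
    (hX : MemLp X 2) (hF : MemLp F 2) (hD : MemLp D 2) (hL : MemLp L 2)
    (hY : MemLp Y 2) (hG : MemLp G 2) (hK : MemLp K 2) (hE : MemLp E 2)
    (heqX : ∀ φ, IsTest J₁ φ → ∫ p, (-(X p * dZ φ p) + F p * φ p - D p * dY j φ p) = 0)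
    (heqY : ∀ φ, IsTest J₂ φ → ∫ p, (-(Y p * dZ φ p) + G p * φ p - K p * dY i φ p) = 0)
    (hYE : IsWeakPlane j Y E) (hXL : IsWeakPlane i X L)
    (hS₁ : IsClosed S₁) (hYS : ∀ p, ¬(0 ≤ p.1 ∧ p.2 ∈ S₁) → Y p = 0)
    (hJ₁ : ∀ z ∈ S₁, ∀ t ∈ Ioi (0 : ℝ), z + t ∈ J₁)
    (hS₂ : IsClosed S₂) (hXS : ∀ p, ¬(0 ≤ p.1 ∧ p.2 ∈ S₂) → X p = 0)
    (hJ₂ : ∀ z ∈ S₂, ∀ t ∈ Iio (0 : ℝ), z + t ∈ J₂) :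
    (∫ p, F p * Y p) - (∫ p, D p * E p) + (∫ p, G p * X p) - ∫ p, K p * L p = 0 := by
  have c1 := continuous_corr hF hY
  have c2 := continuous_corr hD hE
  have c3 := continuous_corr hG hX
  have c4 := continuous_corr hK hL
  have sub : ∀ {k a b : ℝ × ℝ → ℝ}, IsTestPlane k → Continuous a → Continuous b →
      ∫ s, k s * (a s - b s) = (∫ s, k s * a s) - ∫ s, k s * b s := by
    intro k a b hk ha hb
    simp only [mul_sub]
    exact integral_sub ((hk.continuous.mul ha).integrable_of_hasCompactSupport hk.compact.mul_right)
      ((hk.continuous.mul hb).integrable_of_hasCompactSupport hk.compact.mul_right)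
  have hP : ∀ k, IsTest (Ioi 0) k → -(∫ s, dZ k s * corr X Y s) +
      ∫ s, k s * (corr F Y s - corr D E s) = 0 := fun k hk => by
    rw [sub hk.plane c1 c2, ← add_sub_assoc]
    exact corr_equation hX hF hD hY hE heqX hYE hS₁ hYS hJ₁ hk
  have hQ : ∀ k, IsTest (Iio 0) k → -(∫ s, dZ k s * corr Y X s) +
      ∫ s, k s * (corr G X s - corr K L s) = 0 := fun k hk => by
    rw [sub hk.plane c3 c4, ← add_sub_assoc]
    exact corr_equation hY hG hK hX hL heqY hXL hS₂ hXS hJ₂ hk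
  have key := eq_zero_of_integral_test_eq_zero
    (f := fun t => (corr F Y (0, t) - corr D E (0, t)) + (corr G X (0, -t) - corr K L (0, -t)))
    (by fun_prop) fun ρ hρ hρc hρ0 => ?_
  · simp only [neg_zero] at key
    simp only [show ((0 : ℝ), (0 : ℝ)) = 0 from rfl, corr_zero] at key
    linarith
  -- On the line `s = 0`, both equations concern `∂_t C(0, t)` for `t > 0`.
  · have e1 := boundary_equation (continuous_corr hX hY) (c1.sub c2) hP hρ hρc hρ0
    have e2 := boundary_equation (continuous_corr hY hX) (c3.sub c4) hQ (ρ := fun t => ρ (-t))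
      (hρ.comp contDiff_neg) (hρc.comp_homeomorph (Homeomorph.neg ℝ)) ?_
    · have hd : ∀ t, deriv (fun t => ρ (-t)) t = -deriv ρ (-t) := fun t => by
        rw [deriv_comp_neg]
      have hsym : ∀ t, corr Y X (0, t) = corr X Y (0, -t) := fun t => by
        rw [← corr_neg]; simp
      simp only [hd, hsym] at e2
      rw [← integral_neg_eq_self (fun t => -deriv ρ (-t) * corr X Y (0, -t)),
        ← integral_neg_eq_self (fun t => ρ (-t) * _)] at e2
      simp only [neg_neg, neg_mul, integral_neg, Pi.sub_apply] at e1 e2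
      have i1 : ∀ {g : ℝ → ℝ}, Continuous g → Integrable (fun t => ρ t * g t) := fun hg =>
        (hρ.continuous.mul hg).integrable_of_hasCompactSupport hρc.mul_right
      simp only [mul_add]
      rw [integral_add (i1 (by fun_prop)) (i1 (by fun_prop))]
      linarith
    · intro t ht
      have : -t ∈ tsupport ρ := by
        have h := tsupport_comp_eq_preimage ρ (Homeomorph.neg ℝ)
        have ht' : t ∈ tsupport (ρ ∘ (Homeomorph.neg ℝ)) := ht
        rw [h] at ht'
        exact ht'
      have := hρ0 this
      simpa using this

/-! ### Extension by zero across the boundary -/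

/-- A smooth cutoff that vanishes for `y ≤ a + 1 / (n + 1)` and is `1` for `y ≥ a + 2 / (n + 1)`. -/
noncomputable def cutoff (a : ℝ) (n : ℕ) (y : ℝ) : ℝ :=
  Real.smoothTransition ((n + 1) * (y - a) - 1)

theorem contDiff_cutoff (a : ℝ) (n : ℕ) : ContDiff ℝ ∞ (cutoff a n) :=
  Real.smoothTransition.contDiff.comp (by fun_prop)

theorem abs_cutoff_le (a : ℝ) (n : ℕ) (y : ℝ) : |cutoff a n y| ≤ 1 := by
  rw [cutoff, abs_of_nonneg (Real.smoothTransition.nonneg _)]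
  exact Real.smoothTransition.le_one _

theorem tsupport_cutoff (a : ℝ) (n : ℕ) : tsupport (cutoff a n) ⊆ Ioi a := by
  have hn : (0 : ℝ) < n + 1 := by positivity
  have h : tsupport (cutoff a n) ⊆ {y | 1 ≤ (n + 1) * (y - a)} := by
    refine closure_minimal (fun y hy => ?_) (isClosed_le continuous_const (by fun_prop))
    by_contra h
    simp only [mem_ofPred_eq, not_le] at h
    exact hy (Real.smoothTransition.zero_of_nonpos (by linarith))
  intro y hy
  have h1 : 0 < (n + 1) * (y - a) := lt_of_lt_of_le one_pos (h hy)
  have := (mul_pos_iff_of_pos_left hn).1 h1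
  simpa using this

theorem eventually_cutoff_eq {a y : ℝ} (hy : a < y) :
    ∀ᶠ n in atTop, ∀ᶠ x in 𝓝 y, cutoff a n x = 1 := by
  obtain ⟨N, hN⟩ := exists_nat_gt (2 / ((y - a) / 2))
  filter_upwards [eventually_ge_atTop N] with n hn
  have h2 : a < (a + y) / 2 := by linarith
  filter_upwards [lt_mem_nhds (show (a + y) / 2 < y by linarith)] with x hx
  refine Real.smoothTransition.one_of_one_le ?_
  have h3 : (N : ℝ) ≤ n := by exact_mod_cast hn
  have h4 : 0 < (y - a) / 2 := by linarith
  have h5 : 2 < n * ((y - a) / 2) := by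
    rw [div_lt_iff₀ h4] at hN
    nlinarith
  have h6 : (y - a) / 2 ≤ x - a := by linarith
  nlinarith [mul_le_mul_of_nonneg_left h6 (show (0 : ℝ) ≤ n from Nat.cast_nonneg n)]

theorem tendsto_cutoff {a y : ℝ} (hy : a < y) : Tendsto (fun n => cutoff a n y) atTop (𝓝 1) := by
  refine tendsto_const_nhds.congr' ?_
  filter_upwards [eventually_cutoff_eq hy] with n hn
  exact hn.self_of_nhds.symm

/-- `I` is exhausted by smooth cutoffs supported in `I`. -/
def HasCutoffs (I : Set ℝ) : Prop :=
  ∃ θ : ℕ → ℝ → ℝ, (∀ n, ContDiff ℝ ∞ (θ n) ∧ tsupport (θ n) ⊆ I ∧ ∀ z, |θ n z| ≤ 1) ∧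
    ∀ z ∈ I, Tendsto (fun n => θ n z) atTop (𝓝 1)

theorem hasCutoffs_Ioi (a : ℝ) : HasCutoffs (Ioi a) :=
  ⟨cutoff a, fun n => ⟨contDiff_cutoff a n, tsupport_cutoff a n, abs_cutoff_le a n⟩,
    fun _ hz => tendsto_cutoff hz⟩

theorem hasCutoffs_Ioo (a b : ℝ) : HasCutoffs (Ioo a b) := by
  refine ⟨fun n z => cutoff a n z * cutoff (-b) n (-z), fun n => ⟨?_, ?_, fun z => ?_⟩,
    fun z hz => ?_⟩
  · exact (contDiff_cutoff a n).mul ((contDiff_cutoff (-b) n).comp contDiff_neg)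
  · intro z hz
    refine ⟨tsupport_cutoff a n (tsupport_mul_subset_left hz), ?_⟩
    have h := tsupport_mul_subset_right hz
    have h2 : -z ∈ tsupport (cutoff (-b) n) := by
      have h' : z ∈ tsupport (cutoff (-b) n ∘ (Homeomorph.neg ℝ)) := h
      rw [tsupport_comp_eq_preimage] at h'
      exact h'
    have := tsupport_cutoff _ _ h2
    simp only [mem_Ioi] at this
    linarith
  · rw [abs_mul]
    exact mul_le_one₀ (abs_cutoff_le _ _ _) (abs_nonneg _) (abs_cutoff_le _ _ _)
  · have := (tendsto_cutoff hz.1).mul (tendsto_cutoff (neg_lt_neg hz.2))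
    simpa using this

/-- Scale invariance: `y^j ∂_y^j` of the cutoffs at `0` is bounded uniformly in `n`. -/
theorem exists_bound_cutoff (j : ℕ) :
    ∃ B, ∀ n y, |y ^ j * iteratedDeriv j (cutoff 0 n) y| ≤ B := by
  rcases Nat.eq_zero_or_pos j with rfl | hj
  · exact ⟨1, fun n y => by simpa using abs_cutoff_le 0 n y⟩
  have hS : ContDiff ℝ j Real.smoothTransition := Real.smoothTransition.contDiff
  have hcont : Continuous (iteratedDeriv j Real.smoothTransition) :=
    hS.continuous_iteratedDeriv j le_rfl
  have hlt : ∀ u < 0, iteratedDeriv j Real.smoothTransition u = 0 := fun u hu => by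
    have h : Real.smoothTransition =ᶠ[𝓝 u] fun _ => 0 := by
      filter_upwards [gt_mem_nhds hu] with x hx
      exact Real.smoothTransition.zero_of_nonpos hx.le
    rw [h.iteratedDeriv_eq, iteratedDeriv_const, if_neg hj.ne']
  have hgt : ∀ u > 1, iteratedDeriv j Real.smoothTransition u = 0 := fun u hu => by
    have h : Real.smoothTransition =ᶠ[𝓝 u] fun _ => 1 := by
      filter_upwards [lt_mem_nhds hu] with x hx
      exact Real.smoothTransition.one_of_one_le hx.le
    rw [h.iteratedDeriv_eq, iteratedDeriv_const, if_neg hj.ne']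
  -- In the variable `u = (n + 1) y - 1` the function is independent of `n`, and for `j ≥ 1` it is
  -- supported in `0 ≤ u ≤ 1`.
  obtain ⟨B, hB⟩ := isCompact_Icc.exists_bound_of_continuousOn (s := Icc (0 : ℝ) 1)
    (f := fun u => (u + 1) ^ j * iteratedDeriv j Real.smoothTransition u) (by fun_prop)
  refine ⟨B, fun n y => ?_⟩
  have hd : iteratedDeriv j (cutoff 0 n) y =
      (n + 1) ^ j * iteratedDeriv j Real.smoothTransition ((n + 1) * y - 1) := by
    have h1 : cutoff 0 n = fun y => (fun u => Real.smoothTransition (u - 1)) ((n + 1) * y) := by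
      ext y; simp [cutoff]
    have hS' : ContDiff ℝ j (fun u : ℝ => Real.smoothTransition (u - 1)) := hS.comp (by fun_prop)
    rw [h1, iteratedDeriv_comp_const_mul hS', iteratedDeriv_comp_sub_const]
  have h2 : y ^ j * iteratedDeriv j (cutoff 0 n) y = (((n + 1) * y - 1) + 1) ^ j *
      iteratedDeriv j Real.smoothTransition ((n + 1) * y - 1) := by
    rw [hd, sub_add_cancel, mul_pow]; ring
  rw [h2]
  by_cases hu : (n + 1) * y - 1 ∈ Icc (0 : ℝ) 1
  · exact hB _ hu
  · have h0 : (0 : ℝ) ≤ B := (norm_nonneg _).trans (hB 0 (by simp))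
    have : iteratedDeriv j Real.smoothTransition ((n + 1) * y - 1) = 0 := by
      rw [mem_Icc, not_and_or, not_le, not_le] at hu
      exact hu.elim (hlt _) (hgt _)
    rw [this]; simpa using h0

theorem measurableSet_dom {I : Set ℝ} (hI : MeasurableSet I) : MeasurableSet (dom I) :=
  measurableSet_Ioi.prod hI

theorem integral_indicator_mul {I : Set ℝ} (hI : MeasurableSet I) (u v : ℝ × ℝ → ℝ) :
    ∫ p, (dom I).indicator u p * v p = ∫ p in dom I, u p * v p := by
  rw [← integral_indicator (measurableSet_dom hI)]
  refine integral_congr_ae (.of_forall fun p => ?_)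
  simp only [indicator]; split_ifs <;> simp

/-- If `f / y^k` is square integrable, the extension of `f` by zero has as weak derivative
`∂_y^k` on the whole plane the extension of that on `(0, ∞) × I`: test functions can be cut off near
`y = 0`, as `f` compensates for the growth of the derivatives of the cutoff. -/
theorem IsWeakDY.isWeakPlane {I : Set ℝ} (hI : HasCutoffs I) (hIm : MeasurableSet I) {k : ℕ}
    {f g : ℝ × ℝ → ℝ} (h : IsWeakDY I k f g) (hf : MemL2 I fun p => f p / p.1 ^ k)
    (hg : MemL2 I g) : IsWeakPlane k ((dom I).indicator f) ((dom I).indicator g) := by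
  intro φ hφ
  obtain ⟨θ, hθ, hθ1⟩ := hI
  choose B hB using exists_bound_cutoff
  have hdom := measurableSet_dom hIm
  set φn : ℕ → ℝ × ℝ → ℝ := fun n p => φ p * (cutoff 0 n p.1 * θ n p.2) with hφn
  have htest : ∀ n, IsTest I (φn n) := fun n => by
    refine ⟨hφ.smooth.mul (((contDiff_cutoff 0 n).comp contDiff_fst).mul
      ((hθ n).1.comp contDiff_snd)), hφ.compact.mul_right, ?_⟩
    have hsub : tsupport (φn n) ⊆ tsupport (cutoff 0 n) ×ˢ tsupport (θ n) := by
      refine closure_minimal (fun p hp => ?_)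
        ((isClosed_tsupport _).prod (isClosed_tsupport _))
      have h1 := right_ne_zero_of_mul hp
      exact ⟨subset_tsupport _ (left_ne_zero_of_mul h1), subset_tsupport _ (right_ne_zero_of_mul h1)⟩
    exact hsub.trans (prod_mono (tsupport_cutoff 0 n) (hθ n).2.1)
  have hdY : ∀ n p, dY k (φn n) p = θ n p.2 * ∑ i ∈ Finset.range (k + 1),
      (k.choose i : ℝ) * iteratedDeriv i (cutoff 0 n) p.1 * dY (k - i) φ p := fun n p => by
    have hs1 : ContDiff ℝ ∞ fun y => φ (y, p.2) := hφ.smooth.comp (by fun_prop)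
    have e : (fun y => φn n (y, p.2)) = fun y => θ n p.2 * (cutoff 0 n y * φ (y, p.2)) := by
      ext y; simp only [hφn]; ring
    unfold dY
    rw [e, iteratedDeriv_const_mul_field, iteratedDeriv_fun_mul]
    · exact (contDiff_cutoff 0 n).contDiffAt.of_le (by exact_mod_cast le_top)
    · exact hs1.contDiffAt.of_le (by exact_mod_cast le_top)
  -- By the Leibniz rule, `y^k ∂_y^k` of the cut off test functions is dominated by `Ψ ∈ L²`.
  set Ψ : ℝ × ℝ → ℝ := fun p => ∑ i ∈ Finset.range (k + 1),
      (k.choose i : ℝ) * B i * |dY (k - i) φ p * p.1 ^ (k - i)| with hΨ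
  have hΨ2 : MemLp Ψ 2 := by
    refine memLp_finsetSum _ fun i _ => MemLp.const_mul ?_ _
    exact ((hφ.dY (k - i)).mul (contDiff_fst.pow _)).memLp.norm
  have hbound : ∀ n p, |p.1 ^ k * dY k (φn n) p| ≤ Ψ p := fun n p => by
    rw [hdY, mul_left_comm, abs_mul, Finset.mul_sum]
    refine (mul_le_of_le_one_left (abs_nonneg _) ((hθ n).2.2 _)).trans ?_
    refine (Finset.abs_sum_le_sum_abs _ _).trans (Finset.sum_le_sum fun i hi => ?_)
    have hik : p.1 ^ k = p.1 ^ i * p.1 ^ (k - i) := by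
      rw [← pow_add, Nat.add_sub_cancel' (Nat.lt_succ_iff.1 (Finset.mem_range.1 hi))]
    have : p.1 ^ k * ((k.choose i : ℝ) * iteratedDeriv i (cutoff 0 n) p.1 * dY (k - i) φ p) =
        (k.choose i : ℝ) * (p.1 ^ i * iteratedDeriv i (cutoff 0 n) p.1) *
          (dY (k - i) φ p * p.1 ^ (k - i)) := by
      rw [hik]; ring
    rw [this, abs_mul, abs_mul, Nat.abs_cast]
    gcongr
    exact hB i n p.1
  have hl : Tendsto (fun n => ∫ p in dom I, f p * dY k (φn n) p) atTop
      (𝓝 (∫ p in dom I, f p * dY k φ p)) := by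
    refine tendsto_integral_of_dominated_convergence (fun p => |f p / p.1 ^ k| * Ψ p)
      (fun n => ?_) (integrable_mul_of_memLp hf.norm (hΨ2.restrict _)) (fun n => ?_) ?_
    · exact h.locInt.aestronglyMeasurable.mul
        ((htest n).plane.dY k).continuous.aestronglyMeasurable
    · filter_upwards [ae_restrict_mem hdom] with p hp
      have hp0 : (p.1 : ℝ) ^ k ≠ 0 := pow_ne_zero _ (ne_of_gt hp.1)
      have : f p * dY k (φn n) p = f p / p.1 ^ k * (p.1 ^ k * dY k (φn n) p) := by
        field_simp
      rw [this, norm_mul]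
      exact mul_le_mul_of_nonneg_left (hbound n p) (norm_nonneg _)
    · filter_upwards [ae_restrict_mem hdom] with p hp
      refine Tendsto.const_mul _ ?_
      have h1 := (hθ1 p.2 hp.2).mul_const (dY k φ p)
      rw [one_mul] at h1
      refine h1.congr' ?_
      filter_upwards [eventually_cutoff_eq hp.1] with n hn
      have e : (fun y => φn n (y, p.2)) =ᶠ[𝓝 p.1] fun y => θ n p.2 * φ (y, p.2) := by
        filter_upwards [hn] with y hy
        simp only [hφn, hy]; ring
      unfold dY
      rw [e.iteratedDeriv_eq, iteratedDeriv_const_mul_field]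
  have hr : Tendsto (fun n => (-1) ^ k * ∫ p in dom I, g p * φn n p) atTop
      (𝓝 ((-1) ^ k * ∫ p in dom I, g p * φ p)) := by
    refine Tendsto.const_mul _ ?_
    refine tendsto_integral_of_dominated_convergence (fun p => |g p| * |φ p|)
      (fun n => ?_) (integrable_mul_of_memLp hg.norm (hφ.memLp.norm.restrict _)) (fun n => ?_) ?_
    · exact hg.1.mul (htest n).plane.continuous.aestronglyMeasurable
    · refine .of_forall fun p => ?_
      rw [norm_mul, Real.norm_eq_abs, Real.norm_eq_abs]
      refine mul_le_mul_of_nonneg_left ?_ (abs_nonneg _)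
      simp only [hφn, abs_mul]
      exact mul_le_of_le_one_right (abs_nonneg _)
        (mul_le_one₀ (abs_cutoff_le _ _ _) (abs_nonneg _) ((hθ n).2.2 _))
    · filter_upwards [ae_restrict_mem hdom] with p hp
      have := (((tendsto_cutoff hp.1).mul (hθ1 p.2 hp.2)).const_mul (φ p)).const_mul (g p)
      simpa using this
  have heq := tendsto_nhds_unique (hl.congr fun n => h.eq _ (htest n)) hr
  rw [integral_indicator_mul hIm, integral_indicator_mul hIm, heq]

/-! ### Functions with vanishing derivative -/

/-- A function that vanishes for `y ≤ 0` and has a weak derivative `∂_y^k f = 0` vanishes: its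
regularizations are polynomials in `y` that vanish for large negative `y`. -/
theorem IsWeakPlane.ae_eq_zero {k : ℕ} {f : ℝ × ℝ → ℝ} (h : IsWeakPlane k f 0)
    (hf : LocallyIntegrable f) (h0 : ∀ p, p.1 ≤ 0 → f p = 0) : ∀ᵐ p, f p = 0 := by
  have hvanish : ∀ κ, IsTestPlane κ → ∃ M : ℝ, ∀ p : ℝ × ℝ, p.1 < M → conv κ f p = 0 := by
    intro κ hκ
    obtain ⟨M, hM⟩ := (hκ.compact.isCompact.image continuous_fst).bddBelow
    refine ⟨M, fun p hp => ?_⟩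
    refine integral_eq_zero_of_ae (.of_forall fun q => ?_)
    rcases le_or_gt q.1 0 with hq | hq
    · simp [h0 q hq]
    · have : κ (p - q) = 0 := by
        by_contra hne
        have := hM ⟨_, subset_tsupport κ hne, rfl⟩
        simp only [Prod.fst_sub] at this
        linarith
      simp [this]
  have hstep : ∀ κ, IsTestPlane κ → conv (dY 1 κ) f = 0 → conv κ f = 0 := by
    intro κ hκ hc
    ext p
    obtain ⟨M, hM⟩ := hvanish κ hκ
    have hd : ∀ y, HasDerivAt (fun y => conv κ f (y, p.2)) 0 y := fun y => by
      obtain ⟨L, h1, h2⟩ := hasFDerivAt_conv hκ hf (y, p.2)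
      have h3 := hasDerivAt_fst h1
      rw [h2, ← hκ.dY_one_eq, hc] at h3
      exact h3
    have := is_const_of_deriv_eq_zero (fun y => (hd y).differentiableAt) (fun y => (hd y).deriv)
      p.1 (M - 1)
    exact this.trans (hM _ (by simp))
  have hall : ∀ j, (∀ κ, IsTestPlane κ → conv (dY j κ) f = 0) →
      ∀ κ, IsTestPlane κ → conv κ f = 0 := by
    intro j
    induction j with
    | zero => intro h1 κ hκ; simpa only [dY_zero] using h1 κ hκ
    | succ j ih =>
      intro h1
      refine ih fun κ hκ => hstep _ (hκ.dY j) ?_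
      rw [← dY_succ]; exact h1 κ hκ
  have hz := hall k fun κ hκ => by
    rw [h.conv_eq hκ]; ext p; simp [conv]
  refine ae_eq_zero_of_integral_contDiff_smul_eq_zero hf fun g hg hgc => ?_
  have hg' : IsTestPlane (fun q => g (0 - q)) := IsTestPlane.comp_sub ⟨hg, hgc⟩ 0
  have := congrFun (hz _ hg') 0
  simpa [conv, mul_comm] using this

/-! ### Differences of weak solutions -/

/-- The part of the weak form that is tested with `φ`. -/
noncomputable def formV (I : Set ℝ) (v Dψ φ : ℝ × ℝ → ℝ) : ℝ :=
  ∫ p in dom I, (-(v p * dZ φ p) - p.2 * v p * dY 1 φ p - 1 / 2 * Dψ p * dY 2 φ p)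

/-- The part of the weak form that is tested with `w`. -/
noncomputable def formΨ (I : Set ℝ) (ψ Dv w : ℝ × ℝ → ℝ) : ℝ :=
  ∫ p in dom I, (-(ψ p * dZ w p) - p.2 * ψ p * dY 1 w p - 1 / 2 * Dv p * dY 1 w p)

theorem weakForm_eq (I : Set ℝ) (v ψ w φ : ℝ × ℝ → ℝ) :
    weakForm I v ψ w φ = formV I v (wDY I 2 ψ) φ + formΨ I ψ (wDY I 1 v) w := rfl

theorem dY_fun_zero (k : ℕ) : dY k (fun _ => 0) = fun _ => 0 := by
  induction k with
  | zero => rw [dY_zero]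
  | succ k ih => rw [dY_succ, ih]; ext p; simp [dY]

theorem dZ_fun_zero : dZ (fun _ => 0) = fun _ => 0 := by
  ext p; simp [dZ]

theorem formV_zero (I : Set ℝ) (v Dψ : ℝ × ℝ → ℝ) : formV I v Dψ (fun _ => 0) = 0 := by
  simp [formV, dY_fun_zero, dZ_fun_zero]

theorem formΨ_zero (I : Set ℝ) (ψ Dv : ℝ × ℝ → ℝ) : formΨ I ψ Dv (fun _ => 0) = 0 := by
  simp [formΨ, dY_fun_zero, dZ_fun_zero]

theorem integrable_mul_test {I : Set ℝ} {f φ : ℝ × ℝ → ℝ} (hf : MemL2 I f) (hφ : IsTestPlane φ) :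
    Integrable (fun p => f p * φ p) (volume.restrict (dom I)) :=
  integrable_mul_of_memLp hf (hφ.memLp.restrict _)

theorem integrable_formV {I : Set ℝ} {v Dψ φ : ℝ × ℝ → ℝ} (hv : MemL2 I v) (hD : MemL2 I Dψ)
    (hφ : IsTestPlane φ) : Integrable
      (fun p => -(v p * dZ φ p) - p.2 * v p * dY 1 φ p - 1 / 2 * Dψ p * dY 2 φ p)
      (volume.restrict (dom I)) := by
  have h2 := integrable_mul_test hv (hφ.dY_one.mul contDiff_snd)
  have h3 := (integrable_mul_test hD (hφ.dY 2)).const_mul (1 / 2)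
  refine (((integrable_mul_test hv hφ.dZ).neg.sub h2).sub h3).congr (.of_forall fun p => ?_)
  simp only [Pi.sub_apply, Pi.neg_apply]
  ring

theorem integrable_formΨ {I : Set ℝ} {ψ Dv w : ℝ × ℝ → ℝ} (hψ : MemL2 I ψ) (hD : MemL2 I Dv)
    (hw : IsTestPlane w) : Integrable
      (fun p => -(ψ p * dZ w p) - p.2 * ψ p * dY 1 w p - 1 / 2 * Dv p * dY 1 w p)
      (volume.restrict (dom I)) := by
  have h2 := integrable_mul_test hψ (hw.dY_one.mul contDiff_snd)
  have h3 := (integrable_mul_test hD (hw.dY 1)).const_mul (1 / 2)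
  refine (((integrable_mul_test hψ hw.dZ).neg.sub h2).sub h3).congr (.of_forall fun p => ?_)
  simp only [Pi.sub_apply, Pi.neg_apply]
  ring

theorem formV_sub {I : Set ℝ} {v₁ v₂ D₁ D₂ φ : ℝ × ℝ → ℝ} (h₁ : MemL2 I v₁) (h₂ : MemL2 I v₂)
    (k₁ : MemL2 I D₁) (k₂ : MemL2 I D₂) (hφ : IsTestPlane φ) :
    formV I (v₁ - v₂) (D₁ - D₂) φ = formV I v₁ D₁ φ - formV I v₂ D₂ φ := by
  unfold formV
  rw [← integral_sub (integrable_formV h₁ k₁ hφ) (integrable_formV h₂ k₂ hφ)]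
  refine integral_congr_ae (.of_forall fun p => ?_)
  simp only [Pi.sub_apply]
  ring

theorem formΨ_sub {I : Set ℝ} {ψ₁ ψ₂ D₁ D₂ w : ℝ × ℝ → ℝ} (h₁ : MemL2 I ψ₁) (h₂ : MemL2 I ψ₂)
    (k₁ : MemL2 I D₁) (k₂ : MemL2 I D₂) (hw : IsTestPlane w) :
    formΨ I (ψ₁ - ψ₂) (D₁ - D₂) w = formΨ I ψ₁ D₁ w - formΨ I ψ₂ D₂ w := by
  unfold formΨ
  rw [← integral_sub (integrable_formΨ h₁ k₁ hw) (integrable_formΨ h₂ k₂ hw)]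
  refine integral_congr_ae (.of_forall fun p => ?_)
  simp only [Pi.sub_apply]
  ring

theorem wDY_spec {I : Set ℝ} {k : ℕ} {f : ℝ × ℝ → ℝ} (h : HasWeakDY I k f) :
    IsWeakDY I k f (wDY I k f) := by
  rw [wDY, dif_pos h]
  exact h.choose_spec

theorem IsWeakDY.sub {I : Set ℝ} {k : ℕ} {f₁ f₂ g₁ g₂ : ℝ × ℝ → ℝ} (h₁ : IsWeakDY I k f₁ g₁)
    (h₂ : IsWeakDY I k f₂ g₂) (hf₁ : MemL2 I f₁) (hf₂ : MemL2 I f₂) (hg₁ : MemL2 I g₁)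
    (hg₂ : MemL2 I g₂) : IsWeakDY I k (f₁ - f₂) (g₁ - g₂) := by
  refine ⟨h₁.locInt.sub h₂.locInt, h₁.locInt'.sub h₂.locInt', fun φ hφ => ?_⟩
  simp only [Pi.sub_apply, sub_mul]
  rw [integral_sub (integrable_mul_test hf₁ (hφ.plane.dY k))
    (integrable_mul_test hf₂ (hφ.plane.dY k)), integral_sub (integrable_mul_test hg₁ hφ.plane)
    (integrable_mul_test hg₂ hφ.plane), h₁.eq φ hφ, h₂.eq φ hφ, mul_sub]

/-- Square integrable `v`, `ψ` on `(0, ∞) × I` with weak derivatives `Dv = ∂_y v` and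
`Dψ = ∂_y² ψ` in `L²`, and with homogeneous conditions at `y = 0`, in the sense that these relations
hold on the whole plane after extension by zero. -/
structure IsHomogeneousPair (I : Set ℝ) (v ψ Dv Dψ : ℝ × ℝ → ℝ) : Prop where
  memV : MemL2 I v
  memΨ : MemL2 I ψ
  memDv : MemL2 I Dv
  memDψ : MemL2 I Dψ
  weakV : IsWeakPlane 1 ((dom I).indicator v) ((dom I).indicator Dv)
  weakΨ : IsWeakPlane 2 ((dom I).indicator ψ) ((dom I).indicator Dψ)

theorem IsAdmissible.isHomogeneousPair_sub {I : Set ℝ} (hI : HasCutoffs I) (hIm : MeasurableSet I)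
    {rv rψ v₁ ψ₁ v₂ ψ₂ : ℝ × ℝ → ℝ} (h₁ : IsAdmissible I rv rψ v₁ ψ₁)
    (h₂ : IsAdmissible I rv rψ v₂ ψ₂) :
    IsHomogeneousPair I (v₁ - v₂) (ψ₁ - ψ₂) (wDY I 1 v₁ - wDY I 1 v₂)
      (wDY I 2 ψ₁ - wDY I 2 ψ₂) := by
  have e₁ := h₁.mem.energy
  have e₂ := h₂.mem.energy
  have hdv : MemL2 I (wDY I 1 v₁ - wDY I 1 v₂) := MemLp.sub e₁.dv e₂.dv
  have hdψ : MemL2 I (wDY I 2 ψ₁ - wDY I 2 ψ₂) := MemLp.sub e₁.dψ e₂.dψ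
  refine ⟨MemLp.sub h₁.mem.v h₂.mem.v, MemLp.sub h₁.mem.ψ h₂.mem.ψ, hdv, hdψ, ?_, ?_⟩
  · refine ((wDY_spec e₁.hasDv).sub (wDY_spec e₂.hasDv) h₁.mem.v h₂.mem.v e₁.dv
      e₂.dv).isWeakPlane hI hIm ?_ hdv
    refine (memLp_congr_ae (.of_forall fun p => ?_)).1
      (MemLp.sub h₁.boundary.v h₂.boundary.v)
    simp only [Pi.sub_apply, pow_one]
    ring
  · refine ((wDY_spec e₁.hasDψ).sub (wDY_spec e₂.hasDψ) h₁.mem.ψ h₂.mem.ψ e₁.dψ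
      e₂.dψ).isWeakPlane hI hIm ?_ hdψ
    refine (memLp_congr_ae (.of_forall fun p => ?_)).1
      (MemLp.sub h₁.boundary.ψ h₂.boundary.ψ)
    simp only [Pi.sub_apply]
    ring

theorem integral_indicator_mul_indicator {I : Set ℝ} (hI : MeasurableSet I) (u v : ℝ × ℝ → ℝ) :
    ∫ p, (dom I).indicator u p * (dom I).indicator v p = ∫ p in dom I, u p * v p := by
  rw [integral_indicator_mul hI]
  refine setIntegral_congr_fun (measurableSet_dom hI) fun p hp => ?_
  rw [indicator_of_mem hp]

theorem MemL2.indicator {I : Set ℝ} (hI : MeasurableSet I) {f : ℝ × ℝ → ℝ} (hf : MemL2 I f) :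
    MemLp ((dom I).indicator f) 2 :=
  (memLp_indicator_iff_restrict (measurableSet_dom hI)).2 hf

theorem indicator_dom_eq_zero {I S : Set ℝ} (hIS : I ⊆ S) (f : ℝ × ℝ → ℝ) (p : ℝ × ℝ)
    (hp : ¬(0 ≤ p.1 ∧ p.2 ∈ S)) : (dom I).indicator f p = 0 :=
  indicator_of_notMem (fun h => hp ⟨le_of_lt h.1, hIS h.2⟩) _

/-- The energy `∫ (∂_y v)² + (∂_y² ψ)²` controls the pair. -/
theorem IsHomogeneousPair.eq_zero {I : Set ℝ} (hI : MeasurableSet I) {v ψ Dv Dψ : ℝ × ℝ → ℝ}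
    (h : IsHomogeneousPair I v ψ Dv Dψ) (h0 : ∫ p in dom I, (Dv p ^ 2 + Dψ p ^ 2) ≤ 0) :
    ∀ᵐ p ∂(volume.restrict (dom I)), v p = 0 ∧ ψ p = 0 := by
  have hdom := measurableSet_dom hI
  have hint : Integrable (fun p => Dv p ^ 2 + Dψ p ^ 2) (volume.restrict (dom I)) :=
    h.memDv.integrable_sq.add h.memDψ.integrable_sq
  have h1 : ∀ᵐ p ∂(volume.restrict (dom I)), Dv p ^ 2 + Dψ p ^ 2 = 0 := by
    refine (integral_eq_zero_iff_of_nonneg (fun p => by positivity) hint).1 (le_antisymm h0 ?_)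
    exact integral_nonneg fun p => by positivity
  have key : ∀ {k : ℕ} {f D : ℝ × ℝ → ℝ}, MemL2 I f →
      IsWeakPlane k ((dom I).indicator f) ((dom I).indicator D) →
      (∀ᵐ p ∂(volume.restrict (dom I)), D p = 0) →
      ∀ᵐ p ∂(volume.restrict (dom I)), f p = 0 := by
    intro k f D hf hw hD
    have hD' : (dom I).indicator D =ᵐ[volume] 0 := by
      rw [ae_restrict_iff' hdom] at hD
      filter_upwards [hD] with p hp
      by_cases hpd : p ∈ dom I
      · rw [indicator_of_mem hpd, hp hpd]; rfl
      · rw [indicator_of_notMem hpd]; rfl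
    have hw' : IsWeakPlane k ((dom I).indicator f) 0 := fun φ hφ => by
      rw [hw φ hφ]
      congr 1
      refine integral_congr_ae ?_
      filter_upwards [hD'] with p hp
      rw [hp]
    have := hw'.ae_eq_zero ((hf.indicator hI).locallyIntegrable (by norm_num)) fun p hp =>
      indicator_of_notMem (fun hp' => absurd hp'.1 (not_lt.2 hp)) _
    rw [ae_restrict_iff' hdom]
    filter_upwards [this] with p hp hpd
    rwa [indicator_of_mem hpd] at hp
  have hv := key h.memV h.weakV (by
    filter_upwards [h1] with p hp
    exact (pow_eq_zero_iff two_ne_zero).1 (by linarith [sq_nonneg (Dv p), sq_nonneg (Dψ p)]))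
  have hψ := key h.memΨ h.weakΨ (by
    filter_upwards [h1] with p hp
    exact (pow_eq_zero_iff two_ne_zero).1 (by linarith [sq_nonneg (Dv p), sq_nonneg (Dψ p)]))
  filter_upwards [hv, hψ] with p h1 h2 using ⟨h1, h2⟩

/-- Integrating the transport term by parts in `y`. -/
theorem IsHomogeneousPair.formV_eq {I : Set ℝ} (hI : MeasurableSet I) {v ψ Dv Dψ : ℝ × ℝ → ℝ}
    (h : IsHomogeneousPair I v ψ Dv Dψ) {φ : ℝ × ℝ → ℝ} (hφ : IsTestPlane φ) :
    formV I v Dψ φ =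
      ∫ p in dom I, (-(v p * dZ φ p) + p.2 * Dv p * φ p - 1 / 2 * Dψ p * dY 2 φ p) := by
  have hd : dY 1 (fun p => φ p * p.2) = fun p => dY 1 φ p * p.2 := by
    ext p
    simp only [dY, iteratedDeriv_one]
    exact deriv_mul_const_field _
  have hw := h.weakV _ (hφ.mul contDiff_snd)
  rw [integral_indicator_mul hI, integral_indicator_mul hI, hd, pow_one, neg_one_mul] at hw
  have i2 := integrable_mul_test h.memV (hφ.dY_one.mul contDiff_snd)
  have i2' := integrable_mul_test h.memDv (hφ.mul contDiff_snd)
  have i1 := integrable_mul_test h.memV hφ.dZ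
  have i3 := (integrable_mul_test h.memDψ (hφ.dY 2)).const_mul (1 / 2)
  have e1 := integral_neg_add_sub i1 i2.neg i3
  have e2 := integral_neg_add_sub i1 i2' i3
  simp only [Pi.neg_apply, integral_neg, hw, neg_neg] at e1
  rw [← e2] at e1
  refine Eq.trans ?_ (e1.trans ?_)
  · refine integral_congr_ae (.of_forall fun p => ?_)
    simp only
    ring
  · refine integral_congr_ae (.of_forall fun p => ?_)
    simp only
    ring

/-! ### Uniqueness on unbounded layers -/

theorem dY_mul_snd (k : ℕ) (φ : ℝ × ℝ → ℝ) (χ : ℝ → ℝ) :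
    dY k (fun p => φ p * χ p.2) = fun p => dY k φ p * χ p.2 := by
  ext p
  simp only [dY]
  have : (fun y => φ (y, p.2) * χ p.2) = fun y => χ p.2 * φ (y, p.2) := by
    ext y; ring
  rw [this, iteratedDeriv_const_mul_field, mul_comm]

theorem IsTestPlane.dZ_mul_snd {φ : ℝ × ℝ → ℝ} (hφ : IsTestPlane φ) {χ : ℝ → ℝ}
    (hχ : Differentiable ℝ χ) (p : ℝ × ℝ) :
    EquatorialLayer.dZ (fun p => φ p * χ p.2) p =
      EquatorialLayer.dZ φ p * χ p.2 + φ p * deriv χ p.2 := by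
  have h := hasDerivAt_snd (hφ.hasFDerivAt p)
  rw [dZ_of_hasFDerivAt (hφ.hasFDerivAt p)]
  exact (h.mul (hχ p.2).hasDerivAt).deriv

theorem MemL2.mul_bounded {I : Set ℝ} {f : ℝ × ℝ → ℝ} (hf : MemL2 I f) {g : ℝ → ℝ}
    (hg : Continuous g) {C : ℝ} (hC : ∀ z ∈ I, |g z| ≤ C) (hI : MeasurableSet I) :
    MemL2 I (fun p => g p.2 * f p) := by
  refine MemLp.of_le_mul (c := C) hf
    ((hg.comp continuous_snd).aestronglyMeasurable.mul hf.1) ?_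
  filter_upwards [ae_restrict_mem (measurableSet_dom hI)] with p hp
  rw [norm_mul]
  exact mul_le_mul_of_nonneg_right (hC _ hp.2) (norm_nonneg _)

theorem MemL2.mul_compact {I : Set ℝ} {f : ℝ × ℝ → ℝ} (hf : MemL2 I f) {g : ℝ → ℝ}
    (hg : Continuous g) (hc : HasCompactSupport g) (hI : MeasurableSet I) :
    MemL2 I (fun p => g p.2 * f p) := by
  obtain ⟨C, hC⟩ := hc.exists_bound_of_continuous hg
  exact hf.mul_bounded hg (fun z _ => hC z) hI

theorem IsWeakPlane.mul_snd {I : Set ℝ} {k : ℕ} {f g : ℝ × ℝ → ℝ}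
    (h : IsWeakPlane k ((dom I).indicator f) ((dom I).indicator g)) {χ : ℝ → ℝ}
    (hχ : ContDiff ℝ ∞ χ) : IsWeakPlane k ((dom I).indicator fun p => χ p.2 * f p)
      ((dom I).indicator fun p => χ p.2 * g p) := by
  intro φ hφ
  have := h _ (hφ.mul (hχ.comp contDiff_snd))
  simp only [Function.comp_def] at this
  rw [dY_mul_snd] at this
  have e : ∀ (u : ℝ × ℝ → ℝ) (p : ℝ × ℝ) (c : ℝ),
      (dom I).indicator (fun p => χ p.2 * u p) p * c = (dom I).indicator u p * (c * χ p.2) := by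
    intro u p c
    simp only [indicator]
    split_ifs <;> ring
  simp only [e]
  exact this

/-- The four terms of the energy identity, for functions extended by zero. -/
theorem integral_indicator_combination {I : Set ℝ} (hI : MeasurableSet I)
    {F Y D E G X K L : ℝ × ℝ → ℝ} (hF : MemL2 I F) (hY : MemL2 I Y) (hD : MemL2 I D)
    (hE : MemL2 I E) (hG : MemL2 I G) (hX : MemL2 I X) (hK : MemL2 I K) (hL : MemL2 I L) :
    (∫ p, (dom I).indicator F p * (dom I).indicator Y p) -
      (∫ p, (dom I).indicator D p * (dom I).indicator E p) +
      (∫ p, (dom I).indicator G p * (dom I).indicator X p) -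
      (∫ p, (dom I).indicator K p * (dom I).indicator L p) =
    ∫ p in dom I, (F p * Y p - D p * E p + G p * X p - K p * L p) := by
  simp only [integral_indicator_mul_indicator hI]
  have h1 := integrable_mul_of_memLp hF hY
  have h2 := integrable_mul_of_memLp hD hE
  have h3 := integrable_mul_of_memLp hG hX
  have h4 := integrable_mul_of_memLp hK hL
  have e1 := integral_sub h1 h2
  have e2 := integral_add (h1.sub h2) h3
  have e3 := integral_sub ((h1.sub h2).add h3) h4
  simp only [Pi.add_apply, Pi.sub_apply] at e1 e2 e3
  rw [e3, e2, e1]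

theorem eq_indicator_form {I : Set ℝ} (hI : MeasurableSet I) {j : ℕ} (X F D φ : ℝ × ℝ → ℝ) :
    ∫ p, (-((dom I).indicator X p * dZ φ p) + (dom I).indicator F p * φ p -
      (dom I).indicator D p * dY j φ p) =
    ∫ p in dom I, (-(X p * dZ φ p) + F p * φ p - D p * dY j φ p) := by
  rw [← integral_indicator (measurableSet_dom hI)]
  refine integral_congr_ae (.of_forall fun p => ?_)
  simp only [indicator]
  split_ifs <;> simp

/-- The energy identity for a solution of the homogeneous equations, localized by a cutoff `χ(z)`.
The tests may reach the boundary of the layer on the sides given by `J₁` and `J₂`. -/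
theorem IsHomogeneousPair.cutoff_energy {I J₁ J₂ S : Set ℝ} (hI : MeasurableSet I)
    {v ψ Dv Dψ : ℝ × ℝ → ℝ} (h : IsHomogeneousPair I v ψ Dv Dψ)
    (h₁ : ∀ φ, IsTest J₁ φ → formV I v Dψ φ = 0) (h₂ : ∀ w, IsTest J₂ w → formΨ I ψ Dv w = 0)
    (hS : IsClosed S) (hIS : I ⊆ S)
    (hJ : (∀ z ∈ S, (∀ t ∈ Ioi (0 : ℝ), z + t ∈ J₁) ∧ ∀ t ∈ Iio (0 : ℝ), z + t ∈ J₂) ∨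
      (∀ z ∈ S, (∀ t ∈ Iio (0 : ℝ), z + t ∈ J₁) ∧ ∀ t ∈ Ioi (0 : ℝ), z + t ∈ J₂))
    {χ : ℝ → ℝ} (hχ : ContDiff ℝ ∞ χ) (hχc : HasCompactSupport χ) :
    ∫ p in dom I, χ p.2 ^ 2 * (Dv p ^ 2 + Dψ p ^ 2) =
      -4 * ∫ p in dom I, χ p.2 * deriv χ p.2 * (v p * ψ p) := by
  have hχ' : Continuous (deriv χ) := hχ.continuous_deriv (by simp)
  have hzc : Continuous fun z => z * χ z := continuous_id.mul hχ.continuous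
  have hz : HasCompactSupport fun z => z * χ z := hχc.mul_left
  -- `X = χ v` and `Y = χ ψ` solve the equations with the additional terms `-χ' v` and `-χ' ψ`.
  set X : ℝ × ℝ → ℝ := fun p => χ p.2 * v p with hXd
  set L : ℝ × ℝ → ℝ := fun p => χ p.2 * Dv p with hLd
  set F : ℝ × ℝ → ℝ := fun p => p.2 * χ p.2 * Dv p - deriv χ p.2 * v p with hFd
  set D : ℝ × ℝ → ℝ := fun p => 1 / 2 * (χ p.2 * Dψ p) with hDd
  set Y : ℝ × ℝ → ℝ := fun p => χ p.2 * ψ p with hYd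
  set E : ℝ × ℝ → ℝ := fun p => χ p.2 * Dψ p with hEd
  set G : ℝ × ℝ → ℝ := fun p => -(deriv χ p.2 * ψ p) with hGd
  set K : ℝ × ℝ → ℝ := fun p => p.2 * χ p.2 * ψ p + 1 / 2 * (χ p.2 * Dv p) with hKd
  have mX : MemL2 I X := h.memV.mul_compact hχ.continuous hχc hI
  have mL : MemL2 I L := h.memDv.mul_compact hχ.continuous hχc hI
  have mF : MemL2 I F := MemLp.sub (h.memDv.mul_compact hzc hz hI)
    (h.memV.mul_compact hχ' hχc.deriv hI)
  have mE : MemL2 I E := h.memDψ.mul_compact hχ.continuous hχc hI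
  have mD : MemL2 I D := MemLp.const_mul mE _
  have mY : MemL2 I Y := h.memΨ.mul_compact hχ.continuous hχc hI
  have mG : MemL2 I G := MemLp.neg (h.memΨ.mul_compact hχ' hχc.deriv hI)
  have mK : MemL2 I K := MemLp.add (h.memΨ.mul_compact hzc hz hI) (MemLp.const_mul mL _)
  have eqX : ∀ φ, IsTest J₁ φ → ∫ p, (-((dom I).indicator X p * dZ φ p) +
      (dom I).indicator F p * φ p - (dom I).indicator D p * dY 2 φ p) = 0 := by
    intro φ hφ
    have hφχ := hφ.mul (hχ.comp contDiff_snd)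
    rw [eq_indicator_form hI, ← h₁ _ hφχ, h.formV_eq hI hφχ.plane]
    refine integral_congr_ae (.of_forall fun p => ?_)
    simp only [Function.comp_def, hXd, hFd, hDd]
    rw [dY_mul_snd, hφ.plane.dZ_mul_snd (hχ.differentiable (by simp))]
    ring
  have eqY : ∀ φ, IsTest J₂ φ → ∫ p, (-((dom I).indicator Y p * dZ φ p) +
      (dom I).indicator G p * φ p - (dom I).indicator K p * dY 1 φ p) = 0 := by
    intro φ hφ
    have hφχ := hφ.mul (hχ.comp contDiff_snd)
    rw [eq_indicator_form hI, ← h₂ _ hφχ, formΨ]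
    refine integral_congr_ae (.of_forall fun p => ?_)
    simp only [Function.comp_def, hYd, hGd, hKd]
    rw [dY_mul_snd, hφ.plane.dZ_mul_snd (hχ.differentiable (by simp))]
    ring
  have key : ∫ p in dom I, (F p * Y p - D p * E p + G p * X p - K p * L p) = 0 := by
    rw [← integral_indicator_combination hI mF mY mD mE mG mX mK mL]
    rcases hJ with hJ | hJ
    · exact energy_identity (mX.indicator hI) (mF.indicator hI) (mD.indicator hI)
        (mL.indicator hI) (mY.indicator hI) (mG.indicator hI) (mK.indicator hI) (mE.indicator hI)
        eqX eqY (h.weakΨ.mul_snd hχ) (h.weakV.mul_snd hχ) hS (indicator_dom_eq_zero hIS _)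
        (fun z hz => (hJ z hz).1) hS (indicator_dom_eq_zero hIS _) (fun z hz => (hJ z hz).2)
    · have := energy_identity (mY.indicator hI) (mG.indicator hI) (mK.indicator hI)
        (mE.indicator hI) (mX.indicator hI) (mF.indicator hI) (mD.indicator hI) (mL.indicator hI)
        eqY eqX (h.weakV.mul_snd hχ) (h.weakΨ.mul_snd hχ) hS (indicator_dom_eq_zero hIS _)
        (fun z hz => (hJ z hz).2) hS (indicator_dom_eq_zero hIS _) (fun z hz => (hJ z hz).1)
      linarith
  have i1 : Integrable (fun p => χ p.2 ^ 2 * (Dv p ^ 2 + Dψ p ^ 2)) (volume.restrict (dom I)) := by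
    refine (mL.integrable_sq.add mE.integrable_sq).congr (.of_forall fun p => ?_)
    simp only [hLd, hEd, Pi.add_apply]
    ring
  have i2 : Integrable (fun p => χ p.2 * deriv χ p.2 * (v p * ψ p)) (volume.restrict (dom I)) := by
    refine (integrable_mul_of_memLp mX mG).neg.congr (.of_forall fun p => ?_)
    simp only [hXd, hGd, Pi.neg_apply]
    ring
  have e1 := integral_add (i1.const_mul (-1 / 2)) (i2.const_mul (-2))
  rw [integral_const_mul, integral_const_mul] at e1
  have e2 : ∫ p in dom I, (F p * Y p - D p * E p + G p * X p - K p * L p) =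
      ∫ p in dom I, (-1 / 2 * (χ p.2 ^ 2 * (Dv p ^ 2 + Dψ p ^ 2)) +
        -2 * (χ p.2 * deriv χ p.2 * (v p * ψ p))) := by
    refine integral_congr_ae (.of_forall fun p => ?_)
    simp only [hXd, hLd, hFd, hDd, hYd, hEd, hGd, hKd]
    ring
  linarith

/-- There are smooth cutoffs with compact support that tend to `1` and whose derivatives tend
uniformly to `0`. -/
theorem exists_expanding_cutoffs : ∃ (χ : ℕ → ℝ → ℝ) (C : ℝ), ∀ n, ContDiff ℝ ∞ (χ n) ∧
    HasCompactSupport (χ n) ∧ (∀ z, |χ n z| ≤ 1) ∧ (∀ z, |deriv (χ n) z| ≤ C / (n + 1)) ∧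
    ∀ z : ℝ, |z| ≤ n + 1 → χ n z = 1 := by
  let b : ContDiffBump (0 : ℝ) := ⟨1, 2, one_pos, one_lt_two⟩
  have hb : ContDiff ℝ ∞ b := b.contDiff
  obtain ⟨C, hC⟩ := b.hasCompactSupport.deriv.exists_bound_of_continuous
    (hb.continuous_deriv (by simp))
  refine ⟨fun n z => b ((n + 1 : ℝ)⁻¹ * z), C, fun n => ⟨hb.comp (by fun_prop), ?_, ?_, ?_, ?_⟩⟩
  · have hn : ((n : ℝ) + 1)⁻¹ ≠ 0 := by positivity
    exact b.hasCompactSupport.comp_homeomorph (Homeomorph.mulLeft₀ _ hn)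
  · intro z
    rw [abs_of_nonneg b.nonneg]
    exact b.le_one
  · intro z
    have : deriv (fun z => b ((n + 1 : ℝ)⁻¹ * z)) z =
        (n + 1 : ℝ)⁻¹ * deriv b ((n + 1 : ℝ)⁻¹ * z) := by
      exact deriv_comp_mul_left _ b z
    rw [this, abs_mul, abs_of_nonneg (by positivity), div_eq_inv_mul]
    exact mul_le_mul_of_nonneg_left (hC _) (by positivity)
  · intro z hz
    refine b.one_of_mem_closedBall ?_
    rw [mem_closedBall_zero_iff, Real.norm_eq_abs, abs_mul, abs_of_nonneg (by positivity)]
    rw [inv_mul_le_iff₀ (by positivity)]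
    exact hz.trans_eq (mul_one _).symm

/-- In a layer on which the homogeneous equations can be tested up to the boundary on complementary
sides, the only square-integrable solution is zero. -/
theorem IsHomogeneousPair.eq_zero_of_equations {I J₁ J₂ S : Set ℝ} (hI : MeasurableSet I)
    {v ψ Dv Dψ : ℝ × ℝ → ℝ} (h : IsHomogeneousPair I v ψ Dv Dψ)
    (h₁ : ∀ φ, IsTest J₁ φ → formV I v Dψ φ = 0) (h₂ : ∀ w, IsTest J₂ w → formΨ I ψ Dv w = 0)
    (hS : IsClosed S) (hIS : I ⊆ S)
    (hJ : (∀ z ∈ S, (∀ t ∈ Ioi (0 : ℝ), z + t ∈ J₁) ∧ ∀ t ∈ Iio (0 : ℝ), z + t ∈ J₂) ∨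
      (∀ z ∈ S, (∀ t ∈ Iio (0 : ℝ), z + t ∈ J₁) ∧ ∀ t ∈ Ioi (0 : ℝ), z + t ∈ J₂)) :
    ∀ᵐ p ∂(volume.restrict (dom I)), v p = 0 ∧ ψ p = 0 := by
  obtain ⟨χ, C, hχ⟩ := exists_expanding_cutoffs
  have hint : Integrable (fun p => Dv p ^ 2 + Dψ p ^ 2) (volume.restrict (dom I)) :=
    h.memDv.integrable_sq.add h.memDψ.integrable_sq
  have hvψ := integrable_mul_of_memLp h.memV h.memΨ
  refine h.eq_zero hI (le_of_eq ?_)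
  have l1 : Tendsto (fun n => ∫ p in dom I, χ n p.2 ^ 2 * (Dv p ^ 2 + Dψ p ^ 2)) atTop
      (𝓝 (∫ p in dom I, (Dv p ^ 2 + Dψ p ^ 2))) := by
    refine tendsto_integral_of_dominated_convergence (fun p => Dv p ^ 2 + Dψ p ^ 2)
      (fun n => ?_) hint (fun n => .of_forall fun p => ?_) (.of_forall fun p => ?_)
    · exact (((hχ n).1.continuous.comp continuous_snd).pow 2).aestronglyMeasurable.mul hint.1
    · rw [norm_mul, Real.norm_of_nonneg (by positivity : 0 ≤ Dv p ^ 2 + Dψ p ^ 2)]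
      refine mul_le_of_le_one_left (by positivity) ?_
      rw [norm_pow]
      exact pow_le_one₀ (norm_nonneg _) ((hχ n).2.2.1 _)
    · refine tendsto_const_nhds.congr' ?_
      filter_upwards [eventually_ge_atTop ⌈|p.2|⌉₊] with n hn
      rw [(hχ n).2.2.2.2, one_pow, one_mul]
      have : |p.2| ≤ n := (Nat.le_ceil _).trans (by exact_mod_cast hn)
      linarith
  have l2 : Tendsto (fun n => -4 * ∫ p in dom I, χ n p.2 * deriv (χ n) p.2 * (v p * ψ p)) atTop
      (𝓝 0) := by
    rw [← mul_zero (-4 : ℝ)]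
    refine Tendsto.const_mul _ ?_
    have l3 : Tendsto (fun n : ℕ => C / ((n : ℝ) + 1) * ∫ p in dom I, |v p * ψ p|) atTop (𝓝 0) := by
      have h0 := tendsto_one_div_add_atTop_nhds_zero_nat (𝕜 := ℝ)
      have := (h0.const_mul C).mul_const (∫ p in dom I, |v p * ψ p|)
      simpa [div_eq_mul_inv] using this
    refine squeeze_zero_norm (fun n => ?_) l3
    rw [← integral_const_mul]
    refine norm_integral_le_of_norm_le (hvψ.abs.const_mul _) (.of_forall fun p => ?_)
    rw [norm_mul]
    refine mul_le_mul_of_nonneg_right ?_ (abs_nonneg _)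
    rw [norm_mul]
    exact (mul_le_of_le_one_left (abs_nonneg _) ((hχ n).2.2.1 _)).trans ((hχ n).2.2.2.1 _)
  refine tendsto_nhds_unique l1 (l2.congr fun n => ?_)
  exact (h.cutoff_energy hI h₁ h₂ hS hIS hJ (hχ n).1 (hχ n).2.1).symm

theorem IsSolutionA.unique {s : (ℝ × ℝ → ℝ) → (ℝ × ℝ → ℝ) → ℝ} {rv rψ v₁ ψ₁ v₂ ψ₂ : ℝ × ℝ → ℝ}
    (h₁ : IsSolutionA s rv rψ v₁ ψ₁) (h₂ : IsSolutionA s rv rψ v₂ ψ₂) :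
    ∀ᵐ p ∂(volume.restrict (dom (Ioi 0))), v₁ p = v₂ p ∧ ψ₁ p = ψ₂ p := by
  have a₁ := h₁.admissible.mem
  have a₂ := h₂.admissible.mem
  have hp := h₁.admissible.isHomogeneousPair_sub (hasCutoffs_Ioi 0) measurableSet_Ioi h₂.admissible
  have := hp.eq_zero_of_equations (J₁ := Ioi 0) (J₂ := univ) (S := Ici 0) measurableSet_Ioi
    (fun φ hφ => ?_) (fun w hw => ?_) isClosed_Ici Ioi_subset_Ici_self
    (Or.inl fun z hz => ⟨fun t ht => mem_Ioi.2 (add_pos_of_nonneg_of_pos hz ht), fun _ _ => mem_univ _⟩)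
  · filter_upwards [this] with p hp
    exact ⟨sub_eq_zero.1 hp.1, sub_eq_zero.1 hp.2⟩
  · rw [formV_sub a₁.v a₂.v a₁.energy.dψ a₂.energy.dψ hφ.plane]
    have e := (h₁.eq _ φ (IsTest.zero univ) hφ).trans (h₂.eq _ φ (IsTest.zero univ) hφ).symm
    simp only [weakForm_eq, formΨ_zero, add_zero] at e
    rw [e, sub_self]
  · rw [formΨ_sub a₁.ψ a₂.ψ a₁.energy.dv a₂.energy.dv hw.plane]
    have e := (h₁.eq w _ hw (IsTest.zero _)).trans (h₂.eq w _ hw (IsTest.zero _)).symm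
    simp only [weakForm_eq, formV_zero, zero_add] at e
    rw [e, sub_self]

theorem IsSolutionC.unique {H : ℝ} {vH : HHalf} {s : (ℝ × ℝ → ℝ) → (ℝ × ℝ → ℝ) → ℝ}
    {rv rψ v₁ ψ₁ v₂ ψ₂ : ℝ × ℝ → ℝ}
    (h₁ : IsSolutionC H vH s rv rψ v₁ ψ₁) (h₂ : IsSolutionC H vH s rv rψ v₂ ψ₂) :
    ∀ᵐ p ∂(volume.restrict (dom (Ioi H))), v₁ p = v₂ p ∧ ψ₁ p = ψ₂ p := by
  have a₁ := h₁.admissible.mem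
  have a₂ := h₂.admissible.mem
  have hp := h₁.admissible.isHomogeneousPair_sub (hasCutoffs_Ioi H) measurableSet_Ioi h₂.admissible
  have := hp.eq_zero_of_equations (J₁ := univ) (J₂ := Ioi H) (S := Ici H) measurableSet_Ioi
    (fun φ hφ => ?_) (fun w hw => ?_) isClosed_Ici Ioi_subset_Ici_self
    (Or.inr fun z hz => ⟨fun _ _ => mem_univ _, fun t ht => mem_Ioi.2 (lt_add_of_le_of_pos hz ht)⟩)
  · filter_upwards [this] with p hp
    exact ⟨sub_eq_zero.1 hp.1, sub_eq_zero.1 hp.2⟩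
  · rw [formV_sub a₁.v a₂.v a₁.energy.dψ a₂.energy.dψ hφ.plane]
    have e := (h₁.eq _ φ (IsTest.zero _) hφ).trans (h₂.eq _ φ (IsTest.zero _) hφ).symm
    simp only [weakForm_eq, formΨ_zero, add_zero] at e
    linarith
  · rw [formΨ_sub a₁.ψ a₂.ψ a₁.energy.dv a₂.energy.dv hw.plane]
    have e := (h₁.eq w _ hw (IsTest.zero _)).trans (h₂.eq w _ hw (IsTest.zero _)).symm
    simp only [weakForm_eq, formV_zero, zero_add] at e
    linarith

/-! ### Averages of square-integrable functions -/

section Average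

variable {α : Type*} [MeasurableSpace α] {μ : Measure α}

theorem eLpNorm_two_sq (f : α → ℝ) : eLpNorm f 2 μ ^ 2 = ∫⁻ x, ‖f x‖ₑ ^ 2 ∂μ := by
  have h := eLpNorm_nnreal_pow_eq_lintegral (f := f) (μ := μ) (p := 2) two_ne_zero
  simpa using h

theorem lintegral_sq_le {f : α → ENNReal} (hf : AEMeasurable f μ) :
    (∫⁻ x, f x ∂μ) ^ 2 ≤ μ univ * ∫⁻ x, f x ^ 2 ∂μ := by
  have h := ENNReal.lintegral_mul_le_Lp_mul_Lq μ Real.HolderConjugate.two_two hf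
    (aemeasurable_const (b := (1 : ENNReal)))
  simp only [Pi.mul_apply, mul_one, ENNReal.one_rpow, lintegral_const, one_mul] at h
  have h2 := pow_le_pow_left₀ zero_le h 2
  rw [mul_pow, ← ENNReal.rpow_natCast, ← ENNReal.rpow_natCast, ← ENNReal.rpow_natCast,
    ← ENNReal.rpow_mul, ← ENNReal.rpow_mul] at h2
  norm_num at h2
  rwa [mul_comm] at h2

/-- The `L²` norm of an average is bounded by the average of the `L²` norms. -/
theorem lintegral_average_sq_le [SFinite μ] {m : ℝ → ℝ} (hm : Measurable m) {h : ℝ → α → ℝ}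
    (hh : Measurable (Function.uncurry h)) :
    ∫⁻ x, ‖∫ s, m s * h s x‖ₑ ^ 2 ∂μ ≤
      (∫⁻ s, ‖m s‖ₑ) * ∫⁻ s, ‖m s‖ₑ * ∫⁻ x, ‖h s x‖ₑ ^ 2 ∂μ := by
  set ν : Measure ℝ := volume.withDensity fun s => ‖m s‖ₑ with hν
  have hν1 : ν univ = ∫⁻ s, ‖m s‖ₑ := by rw [hν, withDensity_apply _ .univ, setLIntegral_univ]
  have hx : ∀ x, Measurable fun s => h s x := fun x => hh.comp measurable_prodMk_right
  have h1 : ∀ x, ‖∫ s, m s * h s x‖ₑ ^ 2 ≤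
      (∫⁻ s, ‖m s‖ₑ) * ∫⁻ s, ‖m s‖ₑ * ‖h s x‖ₑ ^ 2 := fun x => by
    have e1 : ∫⁻ s, ‖m s * h s x‖ₑ = ∫⁻ s, ‖h s x‖ₑ ∂ν := by
      rw [hν, lintegral_withDensity_eq_lintegral_mul _ hm.enorm (hx x).enorm]
      simp only [Pi.mul_apply, enorm_mul]
    have e2 : ∫⁻ s, ‖m s‖ₑ * ‖h s x‖ₑ ^ 2 = ∫⁻ s, ‖h s x‖ₑ ^ 2 ∂ν := by
      rw [hν, lintegral_withDensity_eq_lintegral_mul _ hm.enorm ((hx x).enorm.pow_const 2)]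
      simp only [Pi.mul_apply]
    rw [e2, ← hν1]
    refine le_trans (pow_le_pow_left₀ zero_le (enorm_integral_le_lintegral_enorm _) 2) ?_
    rw [e1]
    exact lintegral_sq_le (hx x).enorm.aemeasurable
  have hmeas : Measurable (Function.uncurry fun (x : α) (s : ℝ) => ‖m s‖ₑ * ‖h s x‖ₑ ^ 2) :=
    (hm.enorm.comp measurable_snd).mul (((hh.comp measurable_swap).enorm).pow_const 2)
  have hmeas' : Measurable fun x => ∫⁻ s, ‖m s‖ₑ * ‖h s x‖ₑ ^ 2 := hmeas.lintegral_prod_right'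
  refine (lintegral_mono h1).trans ?_
  rw [lintegral_const_mul _ hmeas', lintegral_lintegral_swap hmeas.aemeasurable]
  refine mul_le_mul_right (lintegral_mono fun s => ?_) _
  have hs : Measurable fun x => h s x := hh.comp measurable_prodMk_left
  rw [lintegral_const_mul _ (hs.enorm.pow_const 2)]

/-- If all `h s` in the support of a probability density `κ` are small in `L²`, so is their
average. -/
theorem eLpNorm_average_le [SFinite μ] {κ : ℝ → ℝ} (hκ : Measurable κ) (hκ0 : ∀ s, 0 ≤ κ s)
    (hκi : Integrable κ) (hκ1 : ∫ s, κ s = 1) {h : ℝ → α → ℝ}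
    (hh : Measurable (Function.uncurry h)) {ε : ENNReal}
    (hε : ∀ s, κ s ≠ 0 → eLpNorm (h s) 2 μ ≤ ε) :
    eLpNorm (fun x => ∫ s, κ s * h s x) 2 μ ≤ ε := by
  have h1 : ∫⁻ s, ‖κ s‖ₑ = 1 := by
    have : ∀ s, ‖κ s‖ₑ = ENNReal.ofReal (κ s) := fun s => Real.enorm_of_nonneg (hκ0 s)
    simp only [this]
    rw [← ofReal_integral_eq_lintegral_ofReal hκi (.of_forall hκ0), hκ1, ENNReal.ofReal_one]
  refine (ENNReal.pow_le_pow_left_iff two_ne_zero).1 ?_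
  rw [eLpNorm_two_sq]
  refine (lintegral_average_sq_le hκ hh).trans ?_
  rw [h1, one_mul]
  have : ∫⁻ s, ‖κ s‖ₑ * ∫⁻ x, ‖h s x‖ₑ ^ 2 ∂μ ≤ ∫⁻ s, ‖κ s‖ₑ * ε ^ 2 := by
    refine lintegral_mono fun s => ?_
    rcases eq_or_ne (κ s) 0 with h0 | h0
    · simp [h0]
    · rw [← eLpNorm_two_sq]
      exact mul_le_mul_right (pow_le_pow_left₀ zero_le (hε s h0) 2) _
  refine this.trans ?_
  rw [lintegral_mul_const _ hκ.enorm, h1, one_mul]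

end Average

/-! ### The space `H^{1/2}_0` through extension by zero -/

/-- The difference quotient of `f`, whose `L²` norm on the plane is the Gagliardo seminorm. It is `0`
on the diagonal, which is a null set. -/
noncomputable def quot (f : ℝ → ℝ) (q : ℝ × ℝ) : ℝ := (f q.1 - f q.2) / (q.1 - q.2)

theorem measurable_quot {f : ℝ → ℝ} (hf : Measurable f) : Measurable (quot f) := by
  unfold quot; fun_prop

theorem quot_sub (f g : ℝ → ℝ) : quot (f - g) = quot f - quot g := by
  ext q
  simp only [quot, Pi.sub_apply]
  ring

/-- `∫_{y ≤ 0} dy / (x - y)² = 1 / x`. -/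
theorem integral_Iic_inv_sq {x : ℝ} (hx : 0 < x) :
    IntegrableOn (fun y => ((x - y) ^ 2)⁻¹) (Iic 0) ∧
      ∫ y in Iic 0, ((x - y) ^ 2)⁻¹ = x⁻¹ := by
  have hd : ∀ y ∈ Iic (0 : ℝ), HasDerivAt (fun y => (x - y)⁻¹) (((x - y) ^ 2)⁻¹) y := by
    intro y hy
    have hne : x - y ≠ 0 := by simp only [mem_Iic] at hy; linarith
    have := ((hasDerivAt_id y).const_sub x).fun_inv hne
    simpa using this
  have hlim : Tendsto (fun y : ℝ => (x - y)⁻¹) atBot (𝓝 0) :=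
    tendsto_inv_atTop_zero.comp (tendsto_const_nhds.add_atTop tendsto_neg_atBot_atTop)
  have hint : IntegrableOn (fun y => ((x - y) ^ 2)⁻¹) (Iic 0) := by
    have h1 := integrableOn_Ioi_deriv_of_nonneg' (g := fun y => -(x + y)⁻¹)
      (g' := fun y => ((x + y) ^ 2)⁻¹) (a := 0) (l := 0) (fun y hy => ?_) (fun y _ => by positivity)
      ?_
    · rw [← integrableOn_Ici_iff_integrableOn_Ioi] at h1
      have := (Measure.measurePreserving_neg (volume : Measure ℝ)).integrableOn_comp_preimage
        (Homeomorph.neg ℝ).measurableEmbedding (f := fun y => ((x + y) ^ 2)⁻¹) (s := Ici 0)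
      have h2 := this.2 h1
      simpa [Function.comp_def, sub_eq_add_neg] using h2
    · have hne : x + y ≠ 0 := by simp only [mem_Ici] at hy; linarith
      have := (((hasDerivAt_id y).const_add x).fun_inv hne).neg
      exact this.congr_deriv (by simp [neg_div])
    · have := (tendsto_inv_atTop_zero.comp (tendsto_const_nhds (x := x).add_atTop
        (tendsto_id (α := ℝ)))).neg
      simpa using this
  refine ⟨hint, ?_⟩
  rw [integral_Iic_of_hasDerivAt_of_tendsto' hd hint hlim]
  simp

theorem integral_quot_sq_Iic {f : ℝ → ℝ} (hf0 : ∀ y ≤ 0, f y = 0) {x : ℝ} (hx : 0 < x) :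
    IntegrableOn (fun y => quot f (x, y) ^ 2) (Iic 0) ∧
      ∫ y in Iic 0, quot f (x, y) ^ 2 = f x ^ 2 / x := by
  have e : EqOn (fun y => quot f (x, y) ^ 2) (fun y => f x ^ 2 * ((x - y) ^ 2)⁻¹) (Iic 0) := by
    intro y hy
    simp only [quot, hf0 y hy, sub_zero]
    rw [div_pow, div_eq_mul_inv]
  obtain ⟨h1, h2⟩ := integral_Iic_inv_sq hx
  refine ⟨(integrableOn_congr_fun e measurableSet_Iic).2 (h1.const_mul _), ?_⟩
  rw [setIntegral_congr_fun measurableSet_Iic e, integral_const_mul, h2, div_eq_mul_inv]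

theorem quot_swap (f : ℝ → ℝ) (q : ℝ × ℝ) : quot f q.swap = quot f q := by
  simp only [quot, Prod.fst_swap, Prod.snd_swap]
  rw [← neg_sub (f q.1), ← neg_sub q.1, neg_div_neg_eq]

/-- The weight `∫ |f|² / y` is the part of the Gagliardo seminorm of the extension of `f` by zero
over points on opposite sides of the origin. -/
theorem memLp_quot_of_half {f : ℝ → ℝ} (hf : Measurable f) (hf0 : ∀ y ≤ 0, f y = 0)
    (h1 : MemLp (quot f) 2 (halfLine.prod halfLine))
    (h2 : Integrable (fun y => f y ^ 2 / y) halfLine) : MemLp (quot f) 2 := by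
  have hB : MemLp ((Ioi (0 : ℝ) ×ˢ Iic (0 : ℝ)).indicator (quot f)) 2 := by
    rw [memLp_indicator_iff_restrict (measurableSet_Ioi.prod measurableSet_Iic),
      Measure.volume_eq_prod, ← Measure.prod_restrict,
      memLp_two_iff_integrable_sq (measurable_quot hf).aestronglyMeasurable,
      integrable_prod_iff ((measurable_quot hf).pow_const 2).aestronglyMeasurable]
    constructor
    · filter_upwards [ae_restrict_mem measurableSet_Ioi] with x hx
      exact (integral_quot_sq_Iic hf0 hx).1
    · refine h2.congr ?_
      filter_upwards [ae_restrict_mem measurableSet_Ioi] with x hx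
      simp only [norm_pow, Real.norm_eq_abs, sq_abs]
      exact (integral_quot_sq_Iic hf0 hx).2.symm
  have hC : MemLp ((Iic (0 : ℝ) ×ˢ Ioi (0 : ℝ)).indicator (quot f)) 2 := by
    have := hB.comp_measurePreserving (Measure.measurePreserving_swap (μ := volume) (ν := volume))
    refine (memLp_congr_ae (.of_forall fun q => ?_)).1 this
    simp only [Function.comp_apply, indicator, mem_prod, Prod.fst_swap, Prod.snd_swap, quot_swap,
      and_comm]
  have hA : MemLp ((Ioi (0 : ℝ) ×ˢ Ioi (0 : ℝ)).indicator (quot f)) 2 := by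
    rw [memLp_indicator_iff_restrict (measurableSet_Ioi.prod measurableSet_Ioi),
      Measure.volume_eq_prod, ← Measure.prod_restrict]
    exact h1
  refine (memLp_congr_ae (.of_forall fun q => ?_)).1 ((hA.add hB).add hC)
  simp only [Pi.add_apply, indicator, mem_prod, mem_Ioi, mem_Iic]
  rcases lt_or_ge 0 q.1 with h | h <;> rcases lt_or_ge 0 q.2 with h' | h'
  · simp [h, h', not_le.2 h, not_le.2 h']
  · simp [h, h', not_le.2 h, not_lt.2 h']
  · simp [h, h', not_lt.2 h, not_le.2 h']
  · have : quot f q = 0 := by simp [quot, hf0 _ h, hf0 _ h']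
    simp [this]

theorem ae_prod_halfLine {f g : ℝ → ℝ} (h : f =ᵐ[halfLine] g) :
    ∀ᵐ q ∂(halfLine.prod halfLine), f q.1 = g q.1 ∧ f q.2 = g q.2 := by
  have h1 := (Measure.quasiMeasurePreserving_fst (μ := halfLine) (ν := halfLine)).ae h
  have h2 := (Measure.quasiMeasurePreserving_snd (μ := halfLine) (ν := halfLine)).ae h
  exact h1.and h2

/-- Elements of `H^{1/2}_0(0, ∞)`, extended by zero, belong to `H^{1/2}(ℝ)`. -/
theorem exists_extension (a : HHalf) : ∃ f : ℝ → ℝ, Measurable f ∧ (∀ y ≤ 0, f y = 0) ∧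
    (a : ℝ → ℝ) =ᵐ[halfLine] f ∧ MemLp f 2 ∧ MemLp (quot f) 2 := by
  obtain ⟨h1, h2, h3⟩ := a.2
  set f : ℝ → ℝ := (Ioi 0).indicator (h1.1.mk _) with hfd
  have hfm : Measurable f := h1.1.stronglyMeasurable_mk.measurable.indicator measurableSet_Ioi
  have hf0 : ∀ y ≤ 0, f y = 0 := fun y hy => indicator_of_notMem (by simpa using hy) _
  have hae : (a : ℝ → ℝ) =ᵐ[halfLine] f := by
    filter_upwards [h1.1.ae_eq_mk, ae_restrict_mem measurableSet_Ioi] with y hy hy0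
    rw [hfd, indicator_of_mem hy0, ← hy]
  have hf2 : MemLp f 2 halfLine := (memLp_congr_ae hae).1 h1
  refine ⟨f, hfm, hf0, hae, ?_, memLp_quot_of_half hfm hf0 ?_ ?_⟩
  · rw [hfd, memLp_indicator_iff_restrict measurableSet_Ioi]
    exact (memLp_congr_ae h1.1.ae_eq_mk).1 h1
  · refine (memLp_congr_ae ?_).1 h3
    filter_upwards [ae_prod_halfLine hae] with q ⟨hq1, hq2⟩
    simp only [quot, hq1, hq2]
  · have hm : Measurable fun y => f y ^ 2 / y := (hfm.pow_const 2).div measurable_id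
    change IntegrableOn (fun y => f y ^ 2 / y) (Ioi 0) volume
    rw [← Ioo_union_Ici_eq_Ioi (zero_lt_one' ℝ)]
    refine IntegrableOn.union ?_ ?_
    · refine h2.integrable_sq.congr ?_
      have hae' := ae_restrict_of_ae_restrict_of_subset
        (Ioo_subset_Ioi_self : Ioo (0 : ℝ) 1 ⊆ Ioi 0) hae
      filter_upwards [hae', ae_restrict_mem measurableSet_Ioo] with y hy hy0
      rw [hy, div_pow, Real.sq_sqrt hy0.1.le]
    · have hi : IntegrableOn (fun y => f y ^ 2) (Ici 1) :=
        IntegrableOn.mono_set (t := Ioi 0) hf2.integrable_sq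
          fun y hy => mem_Ioi.2 (lt_of_lt_of_le one_pos hy)
      refine hi.mono' hm.aestronglyMeasurable ?_
      filter_upwards [ae_restrict_mem measurableSet_Ici] with y hy
      have hy1 : (1 : ℝ) ≤ y := hy
      rw [Real.norm_of_nonneg (by positivity)]
      exact div_le_self (by positivity) hy1

/-- The norm of `H^{1/2}_0(0, ∞)` is bounded by the norm of `H^{1/2}(ℝ)` of the extension by
zero. -/
theorem hHalfNorm_le {f g : ℝ → ℝ} (hf0 : ∀ y ≤ 0, f y = 0)
    (hfg : g =ᵐ[halfLine] f) (h1 : MemLp f 2) (h2 : MemLp (quot f) 2) :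
    hHalfNorm g ≤ √((∫ y, f y ^ 2) + 2 * ∫ q, quot f q ^ 2) := by
  unfold hHalfNorm
  refine Real.sqrt_le_sqrt ?_
  have i1 := h1.integrable_sq
  have i2 := h2.integrable_sq
  have e1 : ∫ y in Ioi (0 : ℝ), g y ^ 2 ≤ ∫ y, f y ^ 2 := by
    rw [integral_congr_ae (g := fun y => f y ^ 2) (by filter_upwards [hfg] with y hy; rw [hy])]
    exact setIntegral_le_integral i1 (.of_forall fun y => sq_nonneg _)
  have e3 : ∫ q, ((g q.1 - g q.2) / (q.1 - q.2)) ^ 2 ∂(halfLine.prod halfLine) ≤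
      ∫ q, quot f q ^ 2 := by
    have : ∫ q, ((g q.1 - g q.2) / (q.1 - q.2)) ^ 2 ∂(halfLine.prod halfLine) =
        ∫ q, quot f q ^ 2 ∂(halfLine.prod halfLine) := by
      refine integral_congr_ae ?_
      filter_upwards [ae_prod_halfLine hfg] with q ⟨hq1, hq2⟩
      simp only [quot, hq1, hq2]
    rw [this, Measure.prod_restrict]
    exact setIntegral_le_integral i2 (.of_forall fun y => sq_nonneg _)
  have e2 : ∫ y in Ioo (0 : ℝ) 1, g y ^ 2 / y ≤ ∫ q, quot f q ^ 2 := by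
    have i3 : Integrable (fun q => quot f q ^ 2) (halfLine.prod (volume.restrict (Iic 0))) := by
      rw [Measure.prod_restrict]
      exact i2.restrict
    have a1 : ∫ y in Ioo (0 : ℝ) 1, g y ^ 2 / y = ∫ y in Ioo (0 : ℝ) 1, f y ^ 2 / y := by
      refine integral_congr_ae ?_
      have hae' := ae_restrict_of_ae_restrict_of_subset
        (Ioo_subset_Ioi_self : Ioo (0 : ℝ) 1 ⊆ Ioi 0) hfg
      filter_upwards [hae'] with y hy
      rw [hy]
    have a2 : (fun x => ∫ y in Iic 0, quot f (x, y) ^ 2) =ᵐ[halfLine] fun x => f x ^ 2 / x := by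
      filter_upwards [ae_restrict_mem measurableSet_Ioi] with x hx
      exact (integral_quot_sq_Iic hf0 hx).2
    have a3 : ∫ y in Ioi (0 : ℝ), f y ^ 2 / y =
        ∫ q, quot f q ^ 2 ∂(halfLine.prod (volume.restrict (Iic 0))) := by
      rw [integral_prod _ i3]
      exact (integral_congr_ae a2).symm
    rw [a1]
    refine (setIntegral_mono_set (t := Ioi 0) ?_ ?_ ?_).trans ?_
    · exact i3.integral_prod_left.congr a2
    · filter_upwards [ae_restrict_mem measurableSet_Ioi] with y hy
      have hy0 : (0 : ℝ) < y := hy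
      exact div_nonneg (sq_nonneg _) hy0.le
    · exact Ioo_subset_Ioi_self.eventuallyLE
    · rw [a3, Measure.prod_restrict]
      exact setIntegral_le_integral i2 (.of_forall fun y => sq_nonneg _)
  linarith

/-! ### Density of test functions in `H^{1/2}_0` -/

/-- This function dominates the commutator of a cutoff with the difference quotient. -/
theorem memLp_mul_inv_sqrt {f : ℝ → ℝ} (hf : Measurable f) (h1 : MemLp f 2) :
    MemLp (fun q : ℝ × ℝ => f q.2 * (√(1 + (q.1 - q.2) ^ 2))⁻¹) 2 := by
  have hm : Measurable fun q : ℝ × ℝ => f q.2 * (√(1 + (q.1 - q.2) ^ 2))⁻¹ :=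
    (hf.comp measurable_snd).mul (by fun_prop)
  rw [memLp_two_iff_integrable_sq hm.aestronglyMeasurable]
  have := h1.integrable_sq.convolution_integrand (ContinuousLinearMap.mul ℝ ℝ)
    integrable_inv_one_add_sq
  refine this.congr (.of_forall fun q => ?_)
  simp only [ContinuousLinearMap.mul_apply', mul_pow, inv_pow]
  rw [Real.sq_sqrt (by positivity)]

/-- The bound is uniform in the cutoff, as its Lipschitz constant handles close points and its size
handles distant ones. -/
theorem abs_quot_cutoff_sub_le {f χ : ℝ → ℝ} {C : ℝ} (hC : 0 ≤ C) (hχ1 : ∀ z, |χ z| ≤ 1)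
    (hχ : ∀ x y, |χ x - χ y| ≤ C * |x - y|) (q : ℝ × ℝ) :
    |quot (fun y => χ y * f y) q - quot f q| ≤
      2 * |quot f q| + (C + 2) * |f q.2 * (√(1 + (q.1 - q.2) ^ 2))⁻¹| := by
  rcases eq_or_ne (q.1 - q.2) 0 with h0 | h0
  · simp only [quot, h0, div_zero, sub_zero, abs_zero]
    positivity
  have e : quot (fun y => χ y * f y) q - quot f q =
      (χ q.1 - 1) * quot f q + f q.2 * ((χ q.1 - χ q.2) / (q.1 - q.2)) := by
    simp only [quot]
    field_simp
    ring
  rw [e]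
  refine (abs_add_le _ _).trans (add_le_add ?_ ?_)
  · rw [abs_mul]
    refine mul_le_mul_of_nonneg_right ?_ (abs_nonneg _)
    have := abs_sub (χ q.1) 1
    rw [abs_one] at this
    linarith [hχ1 q.1]
  · rw [abs_mul, abs_mul, mul_left_comm]
    refine mul_le_mul_of_nonneg_left ?_ (abs_nonneg _)
    set d := |q.1 - q.2| with hd
    have hd0 : 0 < d := abs_pos.2 h0
    have hs : √(1 + (q.1 - q.2) ^ 2) ≤ 1 + d := by
      rw [Real.sqrt_le_left (by positivity), ← sq_abs (q.1 - q.2), ← hd]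
      nlinarith
    have hs0 : 0 < √(1 + (q.1 - q.2) ^ 2) := Real.sqrt_pos.2 (by positivity)
    have h2 : |χ q.1 - χ q.2| ≤ 2 := by
      have := abs_sub (χ q.1) (χ q.2)
      linarith [hχ1 q.1, hχ1 q.2]
    have h3 := hχ q.1 q.2
    rw [abs_div, abs_inv, abs_of_pos hs0, ← hd, ← div_eq_mul_inv, div_le_div_iff₀ hd0 hs0]
    calc |χ q.1 - χ q.2| * √(1 + (q.1 - q.2) ^ 2) ≤ |χ q.1 - χ q.2| * (1 + d) :=
          mul_le_mul_of_nonneg_left hs (abs_nonneg _)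
      _ = |χ q.1 - χ q.2| + |χ q.1 - χ q.2| * d := by ring
      _ ≤ C * d + 2 * d := add_le_add h3 (mul_le_mul_of_nonneg_right h2 hd0.le)
      _ = (C + 2) * d := by ring

/-- Approximation by functions with bounded support. -/
theorem exists_cutoff_approx {f : ℝ → ℝ} (hf : Measurable f) (hf0 : ∀ y ≤ 0, f y = 0)
    (h1 : MemLp f 2) (h2 : MemLp (quot f) 2) {ε : ℝ} (hε : 0 < ε) :
    ∃ g : ℝ → ℝ, Measurable g ∧ (∀ y ≤ 0, g y = 0) ∧ HasCompactSupport g ∧ MemLp g 2 ∧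
      MemLp (quot g) 2 ∧ (eLpNorm (g - f) 2).toReal < ε ∧
      (eLpNorm (quot g - quot f) 2).toReal < ε := by
  obtain ⟨χ, C, hχ⟩ := exists_expanding_cutoffs
  have hC : 0 ≤ C := by simpa using (abs_nonneg _).trans ((hχ 0).2.2.2.1 0)
  have hlip : ∀ n x y, |χ n x - χ n y| ≤ C * |x - y| := fun n x y => by
    have hd : Differentiable ℝ (χ n) := (hχ n).1.differentiable (by simp)
    refine Convex.norm_image_sub_le_of_norm_deriv_le (s := univ) (fun z _ => hd z) (fun z _ => ?_)
      convex_univ (mem_univ y) (mem_univ x)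
    exact ((hχ n).2.2.2.1 z).trans (div_le_self hC (by linarith [Nat.cast_nonneg (α := ℝ) n]))
  set g : ℕ → ℝ → ℝ := fun n y => χ n y * f y with hg
  have hgm : ∀ n, Measurable (g n) := fun n => (hχ n).1.continuous.measurable.mul hf
  have hone : ∀ x : ℝ, ∀ᶠ n in atTop, χ n x = 1 := fun x => by
    filter_upwards [eventually_ge_atTop ⌈|x|⌉₊] with n hn
    refine (hχ n).2.2.2.2 x ?_
    have : |x| ≤ n := (Nat.le_ceil _).trans (by exact_mod_cast hn)
    linarith
  have hb2 : MemLp (fun q => 2 * |quot f q| +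
      (C + 2) * |f q.2 * (√(1 + (q.1 - q.2) ^ 2))⁻¹|) 2 :=
    (h2.abs.const_mul 2).add ((memLp_mul_inv_sqrt hf h1).abs.const_mul _)
  have hb1 : MemLp (fun y => 2 * |f y|) 2 := h1.abs.const_mul 2
  have hbd1 : ∀ n y, |g n y - f y| ≤ 2 * |f y| := fun n y => by
    have : g n y - f y = (χ n y - 1) * f y := by simp only [hg]; ring
    rw [this, abs_mul]
    refine mul_le_mul_of_nonneg_right ?_ (abs_nonneg _)
    have := abs_sub (χ n y) 1
    rw [abs_one] at this
    linarith [(hχ n).2.2.1 y]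
  have hbd2 := fun n => abs_quot_cutoff_sub_le (f := f) hC (hχ n).2.2.1 (hlip n)
  have l1 : Tendsto (fun n => (eLpNorm (g n - f) 2).toReal) atTop (𝓝 0) := by
    refine tendsto_eLpNorm_of_dominated _ hb1 h1 (fun n => (hgm n).aestronglyMeasurable)
      (fun n => .of_forall (hbd1 n)) (.of_forall fun y => ?_)
    refine tendsto_const_nhds.congr' ?_
    filter_upwards [hone y] with n hn
    simp only [hg, hn, one_mul]
  have l2 : Tendsto (fun n => (eLpNorm (quot (g n) - quot f) 2).toReal) atTop (𝓝 0) := by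
    refine tendsto_eLpNorm_of_dominated _ hb2 h2
      (fun n => (measurable_quot (hgm n)).aestronglyMeasurable)
      (fun n => .of_forall (hbd2 n)) (.of_forall fun q => ?_)
    refine tendsto_const_nhds.congr' ?_
    filter_upwards [hone q.1, hone q.2] with n hn hn'
    simp only [quot, hg, hn, hn', one_mul]
  obtain ⟨n, hn1, hn2⟩ := ((l1.eventually (gt_mem_nhds hε)).and
    (l2.eventually (gt_mem_nhds hε))).exists
  have m1 : MemLp (g n - f) 2 := hb1.mono ((hgm n).sub hf).aestronglyMeasurable
    (.of_forall fun y => (hbd1 n y).trans (le_abs_self _))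
  have m2 : MemLp (quot (g n) - quot f) 2 := hb2.mono
    ((measurable_quot (hgm n)).sub (measurable_quot hf)).aestronglyMeasurable
    (.of_forall fun y => (hbd2 n y).trans (le_abs_self _))
  refine ⟨g n, hgm n, fun y hy => by simp [hg, hf0 y hy], (hχ n).2.1.mul_right, ?_, ?_, hn1, hn2⟩
  · simpa using m1.add h1
  · simpa using m2.add h2

/-- Averaging over small translations to the right keeps the support in `(0, ∞)`. -/
theorem exists_mollify_approx {g : ℝ → ℝ} (hg : Measurable g) (hg0 : ∀ y ≤ 0, g y = 0)
    (hgc : HasCompactSupport g) (h1 : MemLp g 2) (h2 : MemLp (quot g) 2) {ε : ℝ} (hε : 0 < ε) :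
    ∃ b : ℝ → ℝ, ContDiff ℝ ∞ b ∧ HasCompactSupport b ∧ tsupport b ⊆ Ioi 0 ∧
      MemLp (quot b) 2 ∧ (eLpNorm (b - g) 2).toReal ≤ ε ∧
      (eLpNorm (quot b - quot g) 2).toReal ≤ ε := by
  have c1 := continuous_eLpNorm_translate_sub h1
  have c2 := (continuous_eLpNorm_translate_sub h2).comp
    (continuous_id.prodMk continuous_id : Continuous fun s : ℝ => (s, s))
  have z1 := c1.tendsto 0
  have z2 := c2.tendsto 0
  simp only [Function.comp_def, id, sub_zero, sub_self,
    show ((0 : ℝ), (0 : ℝ)) = 0 from rfl] at z1 z2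
  have e0 : (eLpNorm (fun _ : ℝ => (0 : ℝ)) 2).toReal = 0 := by simp
  have e0' : (eLpNorm (fun _ : ℝ × ℝ => (0 : ℝ)) 2).toReal = 0 := by simp
  rw [e0] at z1
  rw [e0'] at z2
  obtain ⟨δ, hδ, hball⟩ := Metric.eventually_nhds_iff.1
    ((z1.eventually (gt_mem_nhds hε)).and (z2.eventually (gt_mem_nhds hε)))
  -- The mollifier is supported in `δ / 4 ≤ s ≤ 3 δ / 4`.
  let B : ContDiffBump (δ / 2) := ⟨δ / 8, δ / 4, by linarith, by linarith⟩
  set κ : ℝ → ℝ := B.normed volume with hκ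
  have hκs : ContDiff ℝ ∞ κ := B.contDiff_normed
  have hκc : HasCompactSupport κ := B.hasCompactSupport_normed
  have hκ0 : ∀ s, 0 ≤ κ s := B.nonneg_normed
  have hκi : Integrable κ := hκs.continuous.integrable_of_hasCompactSupport hκc
  have hκ1 : ∫ s, κ s = 1 := B.integral_normed
  have hκsupp : ∀ s ∈ tsupport κ, δ / 4 ≤ s ∧ s ≤ 3 / 4 * δ := fun s hs => by
    rw [hκ, B.tsupport_normed_eq, Metric.mem_closedBall, Real.dist_eq, abs_le] at hs
    have : B.rOut = δ / 4 := rfl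
    constructor <;> linarith [hs.1, hs.2]
  set b : ℝ → ℝ := convolution κ g (ContinuousLinearMap.mul ℝ ℝ) volume with hb
  have hbe : ∀ y, b y = ∫ s, κ s * g (y - s) := fun y => rfl
  have hloc : LocallyIntegrable g := h1.locallyIntegrable (by norm_num)
  have hint : ∀ y, Integrable fun s => κ s * g (y - s) := fun y =>
    hκc.convolutionExists_left (ContinuousLinearMap.mul ℝ ℝ) hκs.continuous hloc y
  have hsupp : tsupport b ⊆ Ioi 0 := by
    have : tsupport b ⊆ Ici (δ / 4) := by
      refine closure_minimal (fun y hy => ?_) isClosed_Ici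
      by_contra hlt
      refine hy ?_
      rw [hbe]
      refine integral_eq_zero_of_ae (.of_forall fun s => ?_)
      by_cases hs : s ∈ tsupport κ
      · simp only [mem_Ici, not_le] at hlt
        simp [hg0 (y - s) (by linarith [(hκsupp s hs).1])]
      · simp [image_eq_zero_of_notMem_tsupport hs]
    exact this.trans fun y hy => lt_of_lt_of_le (by positivity : 0 < δ / 4) hy
  have hsmall : ∀ s, κ s ≠ 0 → (eLpNorm (fun x => g (x - s) - g x) 2).toReal < ε ∧
      (eLpNorm (fun x => quot g (x - (s, s)) - quot g x) 2).toReal < ε := fun s hs => by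
    refine hball ?_
    have := hκsupp s (subset_tsupport κ hs)
    rw [Real.dist_eq, sub_zero, abs_lt]
    constructor <;> linarith [this.1, this.2]
  have hbs : ContDiff ℝ ∞ b := hκc.contDiff_convolution_left (n := ⊤) _ hκs hloc
  have hquot : eLpNorm (quot b - quot g) 2 ≤ ENNReal.ofReal ε := by
    have hq : ∀ s q, quot g (q - (s, s)) = (g (q.1 - s) - g (q.2 - s)) / (q.1 - q.2) := by
      intro s q
      simp only [quot, Prod.fst_sub, Prod.snd_sub, sub_sub_sub_cancel_right]
    have hqi : ∀ q, Integrable fun s => κ s * quot g (q - (s, s)) := fun q => by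
      refine (((hint q.1).sub (hint q.2)).div_const (q.1 - q.2)).congr (.of_forall fun s => ?_)
      simp only [Pi.sub_apply, hq]
      ring
    have hqe : ∀ q, quot b q = ∫ s, κ s * quot g (q - (s, s)) := fun q => by
      rw [quot, hbe, hbe, ← integral_sub (hint q.1) (hint q.2), ← integral_div]
      refine integral_congr_ae (.of_forall fun s => ?_)
      simp only [hq]
      ring
    have e : quot b - quot g = fun q => ∫ s, κ s * (quot g (q - (s, s)) - quot g q) := by
      ext q
      simp only [mul_sub]
      rw [integral_sub (hqi q) (hκi.mul_const _), integral_mul_const, hκ1, one_mul, ← hqe]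
      rfl
    rw [e]
    have hqm := measurable_quot hg
    refine eLpNorm_average_le hκs.continuous.measurable hκ0 hκi hκ1
      (h := fun s q => quot g (q - (s, s)) - quot g q) (by unfold Function.uncurry; fun_prop)
      fun s hs => ?_
    have hm : MemLp (fun x => quot g (x - (s, s)) - quot g x) 2 :=
      (memLp_translate h2 (s, s)).sub h2
    exact (ENNReal.le_ofReal_iff_toReal_le hm.2.ne hε.le).2 (hsmall s hs).2.le
  have hmq : MemLp (quot b - quot g) 2 :=
    ⟨((measurable_quot hbs.continuous.measurable).sub (measurable_quot hg)).aestronglyMeasurable,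
      hquot.trans_lt ENNReal.ofReal_lt_top⟩
  refine ⟨b, hbs, hκc.convolution _ hgc, hsupp, by simpa using hmq.add h2, ?_,
    ENNReal.toReal_le_of_le_ofReal hε.le hquot⟩
  · have e : b - g = fun y => ∫ s, κ s * (g (y - s) - g y) := by
      ext y
      simp only [mul_sub]
      rw [integral_sub (hint y) (hκi.mul_const _), integral_mul_const, hκ1, one_mul]
      rfl
    rw [e]
    refine ENNReal.toReal_le_of_le_ofReal hε.le ?_
    refine eLpNorm_average_le hκs.continuous.measurable hκ0 hκi hκ1
      (h := fun s y => g (y - s) - g y) (by unfold Function.uncurry; fun_prop) fun s hs => ?_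
    have hm : MemLp (fun x => g (x - s) - g x) 2 := (memLp_translate h1 s).sub h1
    exact (ENNReal.le_ofReal_iff_toReal_le hm.2.ne hε.le).2 (hsmall s hs).1.le

/-- Smooth functions on the line with compact support in `(0, ∞)`. -/
structure IsTestHalf (b : ℝ → ℝ) : Prop where
  smooth : ContDiff ℝ ∞ b
  compact : HasCompactSupport b
  supp : tsupport b ⊆ Ioi 0

theorem IsTestHalf.memLp {b : ℝ → ℝ} (hb : IsTestHalf b) : MemLp b 2 :=
  hb.smooth.continuous.memLp_of_hasCompactSupport hb.compact

theorem IsTestHalf.eq_zero {b : ℝ → ℝ} (hb : IsTestHalf b) {y : ℝ} (hy : y ≤ 0) : b y = 0 :=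
  image_eq_zero_of_notMem_tsupport fun h => absurd (hb.supp h) (not_lt.2 hy)

/-- Density of test functions in `H^{1/2}_0(0, ∞)`. The extensions `f` by zero are approximated in
`H^{1/2}(ℝ)`. -/
theorem exists_approx_sequence {f : ℝ → ℝ} (hf : Measurable f) (hf0 : ∀ y ≤ 0, f y = 0)
    (h1 : MemLp f 2) (h2 : MemLp (quot f) 2) : ∃ b : ℕ → ℝ → ℝ, (∀ n, IsTestHalf (b n)) ∧
      (∀ n, MemLp (quot (b n)) 2) ∧
      Tendsto (fun n => (eLpNorm (b n - f) 2).toReal) atTop (𝓝 0) ∧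
      Tendsto (fun n => (eLpNorm (quot (b n) - quot f) 2).toReal) atTop (𝓝 0) := by
  have key : ∀ n : ℕ, ∃ b, IsTestHalf b ∧ MemLp (quot b) 2 ∧
      (eLpNorm (b - f) 2).toReal ≤ 2 * (1 / ((n : ℝ) + 1)) ∧
      (eLpNorm (quot b - quot f) 2).toReal ≤ 2 * (1 / ((n : ℝ) + 1)) := fun n => by
    have hε : 0 < 1 / ((n : ℝ) + 1) := by positivity
    obtain ⟨g, hg, hg0, hgc, k1, k2, hg1, hg2⟩ := exists_cutoff_approx hf hf0 h1 h2 hε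
    obtain ⟨b, hb, hbc, hbs, mq, hb1, hb2⟩ := exists_mollify_approx hg hg0 hgc k1 k2 hε
    have hbt : IsTestHalf b := ⟨hb, hbc, hbs⟩
    have mb := hbt.memLp
    refine ⟨b, hbt, mq, ?_, ?_⟩
    · linarith [toReal_eLpNorm_sub_le mb k1 h1]
    · linarith [toReal_eLpNorm_sub_le mq k2 h2]
  choose b hb hq h3 h4 using key
  have hlim : Tendsto (fun n : ℕ => 2 * (1 / ((n : ℝ) + 1))) atTop (𝓝 0) := by
    simpa using (tendsto_one_div_add_atTop_nhds_zero_nat (𝕜 := ℝ)).const_mul 2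
  exact ⟨b, hb, hq, squeeze_zero (fun _ => ENNReal.toReal_nonneg) h3 hlim,
    squeeze_zero (fun _ => ENNReal.toReal_nonneg) h4 hlim⟩

/-! ### Averages of a boundary value -/

/-- The function `(y, z) ↦ ∫ κ(τ) b(y + τ (z - H)) dτ`, which has the boundary values `b` at `z = H`
if `κ` has integral `1`. For `κ` supported in `τ > 0` and `z < H` it averages `b` to the left
of `y`, at a distance comparable to `H - z`. -/
noncomputable def lift (H : ℝ) (κ b : ℝ → ℝ) (p : ℝ × ℝ) : ℝ :=
  ∫ τ, κ τ * b (p.1 + τ * (p.2 - H))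

theorem contDiff_lift (H : ℝ) {κ b : ℝ → ℝ} (hκ : ContDiff ℝ ∞ κ) (hκc : HasCompactSupport κ)
    (hb : ContDiff ℝ ∞ b) : ContDiff ℝ ∞ (lift H κ b) := by
  -- The integral is the convolution of the constant `1` with a function depending on `p`.
  have h := contDiffOn_convolution_right_with_param_comp (𝕜 := ℝ) (n := ⊤) (μ := volume)
    (ContinuousLinearMap.mul ℝ ℝ) (s := (univ : Set (ℝ × ℝ))) (v := fun _ => (0 : ℝ))
    (f := fun _ : ℝ => (1 : ℝ))
    (g := fun p x => κ (-x) * b (p.1 + (-x) * (p.2 - H)))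
    (k := (fun x => -x) ⁻¹' tsupport κ) contDiffOn_const isOpen_univ
    ((Homeomorph.neg ℝ).isCompact_preimage.2 hκc.isCompact)
    (fun p x _ hx => by
      rw [image_eq_zero_of_notMem_tsupport hx, zero_mul])
    continuous_const.locallyIntegrable
    (ContDiff.contDiffOn (by
      change ContDiff ℝ ∞ fun q : (ℝ × ℝ) × ℝ => κ (-q.2) * b (q.1.1 + (-q.2) * (q.1.2 - H))
      exact (hκ.comp (by fun_prop)).mul (hb.comp (by fun_prop))))
  rw [contDiffOn_univ] at h
  convert h using 2 with p
  simp only [lift, convolution, ContinuousLinearMap.mul_apply', one_mul, zero_sub, neg_neg]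

theorem hasDerivAt_lift_fst (H : ℝ) {κ b : ℝ → ℝ} (hκ : Continuous κ) (hκc : HasCompactSupport κ)
    (hb : ContDiff ℝ 1 b) (hbc : HasCompactSupport b) (p : ℝ × ℝ) :
    HasDerivAt (fun y => lift H κ b (y, p.2)) (lift H κ (deriv b) p) p.1 := by
  have hb' : Continuous (deriv b) := hb.continuous_deriv le_rfl
  obtain ⟨M, hM⟩ := hbc.deriv.exists_bound_of_continuous hb'
  have hcont := hb.continuous
  refine (hasDerivAt_integral_of_dominated_loc_of_deriv_le (μ := volume)
    (F := fun y τ => κ τ * b (y + τ * (p.2 - H)))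
    (F' := fun y τ => κ τ * deriv b (y + τ * (p.2 - H))) (bound := fun τ => |κ τ| * M)
    univ_mem (.of_forall fun y => ?_) ?_ ?_ (.of_forall fun τ y _ => ?_) ?_
    (.of_forall fun τ y _ => ?_)).2
  · exact (hκ.mul (by fun_prop)).aestronglyMeasurable
  · exact (hκ.mul (by fun_prop)).integrable_of_hasCompactSupport hκc.mul_right
  · exact (hκ.mul (by fun_prop)).aestronglyMeasurable
  · rw [norm_mul]
    exact mul_le_mul_of_nonneg_left (hM _) (norm_nonneg _)
  · exact (hκ.integrable_of_hasCompactSupport hκc).abs.mul_const M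
  · refine HasDerivAt.const_mul _ ?_
    exact ((hb.differentiable (by simp)) _).hasDerivAt.comp_add_const y (τ * (p.2 - H))

theorem hasDerivAt_lift_snd (H : ℝ) {κ b : ℝ → ℝ} (hκ : Continuous κ) (hκc : HasCompactSupport κ)
    (hb : ContDiff ℝ 1 b) (hbc : HasCompactSupport b) (p : ℝ × ℝ) :
    HasDerivAt (fun z => lift H κ b (p.1, z)) (lift H (fun τ => κ τ * τ) (deriv b) p) p.2 := by
  have hb' : Continuous (deriv b) := hb.continuous_deriv le_rfl
  obtain ⟨M, hM⟩ := hbc.deriv.exists_bound_of_continuous hb'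
  have hcont := hb.continuous
  have hκ' : Continuous fun τ => κ τ * τ := hκ.mul continuous_id
  refine (hasDerivAt_integral_of_dominated_loc_of_deriv_le (μ := volume)
    (F := fun z τ => κ τ * b (p.1 + τ * (z - H)))
    (F' := fun z τ => κ τ * τ * deriv b (p.1 + τ * (z - H))) (bound := fun τ => |κ τ * τ| * M)
    univ_mem (.of_forall fun y => ?_) ?_ ?_ (.of_forall fun τ y _ => ?_) ?_
    (.of_forall fun τ z _ => ?_)).2
  · exact (hκ.mul (by fun_prop)).aestronglyMeasurable
  · exact (hκ.mul (by fun_prop)).integrable_of_hasCompactSupport hκc.mul_right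
  · exact (hκ'.mul (by fun_prop)).aestronglyMeasurable
  · rw [norm_mul]
    exact mul_le_mul_of_nonneg_left (hM _) (norm_nonneg _)
  · exact (hκ'.integrable_of_hasCompactSupport hκc.mul_right).abs.mul_const M
  · have h1 : HasDerivAt (fun z => p.1 + τ * (z - H)) τ z := by
      simpa using (((hasDerivAt_id z).sub_const H).const_mul τ).const_add p.1
    have h2 := ((hb.differentiable (by simp)) (p.1 + τ * (z - H))).hasDerivAt.comp z h1
    have := h2.const_mul (κ τ)
    exact this.congr_deriv (by ring)

/-- Integration by parts in `τ` turns derivatives of the lift into averages of difference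
quotients. -/
theorem lift_deriv_eq (H : ℝ) {k b : ℝ → ℝ} (hk : ContDiff ℝ 1 k) (hkc : HasCompactSupport k)
    (hb : ContDiff ℝ 1 b) {p : ℝ × ℝ} (hp : p.2 ≠ H) :
    lift H k (deriv b) p =
      -∫ τ, τ * deriv k τ * quot b (p.1 + τ * (p.2 - H), p.1) := by
  have hζ : p.2 - H ≠ 0 := sub_ne_zero.2 hp
  have hb' : Continuous (deriv b) := hb.continuous_deriv le_rfl
  have hk' : Continuous (deriv k) := hk.continuous_deriv le_rfl
  have hcont := hb.continuous
  set u : ℝ → ℝ := fun τ => (b (p.1 + τ * (p.2 - H)) - b p.1) / (p.2 - H) with hu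
  have hud : ∀ τ, HasDerivAt u (deriv b (p.1 + τ * (p.2 - H))) τ := fun τ => by
    have h1 : HasDerivAt (fun τ => p.1 + τ * (p.2 - H)) (p.2 - H) τ := by
      simpa using ((hasDerivAt_id τ).mul_const (p.2 - H)).const_add p.1
    have h2 := ((hb.differentiable (by simp)) (p.1 + τ * (p.2 - H))).hasDerivAt.comp τ h1
    refine ((h2.sub_const (b p.1)).div_const (p.2 - H)).congr_deriv ?_
    field_simp
  have huc : Continuous u := by fun_prop
  have hibp := integral_mul_deriv_eq_deriv_mul_of_integrable (u := k) (v := u)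
    (fun τ _ => ((hk.differentiable (by simp)) τ).hasDerivAt) (fun τ _ => hud τ)
    ((hk.continuous.mul (by fun_prop)).integrable_of_hasCompactSupport hkc.mul_right)
    ((hk'.mul huc).integrable_of_hasCompactSupport hkc.deriv.mul_right)
    ((hk.continuous.mul huc).integrable_of_hasCompactSupport hkc.mul_right)
  unfold lift
  rw [hibp]
  congr 1
  refine integral_congr_ae (.of_forall fun τ => ?_)
  simp only [hu, quot, add_sub_cancel_left]
  rcases eq_or_ne τ 0 with rfl | hτ
  · simp
  · field_simp

theorem lintegral_comp_affine {F : ℝ → ENNReal} (hF : Measurable F) {τ : ℝ} (hτ : τ ≠ 0)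
    (y H : ℝ) : ∫⁻ z, F (y + τ * (z - H)) = ENNReal.ofReal |τ⁻¹| * ∫⁻ x, F x := by
  have e1 : ∫⁻ z, F (y + τ * (z - H)) = ∫⁻ z, F (y + τ * z) :=
    lintegral_sub_right_eq_self (fun z => F (y + τ * z)) H
  have e2 : ∫⁻ z, F (y + τ * z) = ∫⁻ x, F (y + x) ∂(Measure.map (τ * ·) volume) :=
    (lintegral_map (hF.comp (measurable_const_add y)) (measurable_const_mul τ)).symm
  rw [e1, e2, Real.map_volume_mul_left hτ, lintegral_smul_measure, smul_eq_mul,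
    lintegral_add_left_eq_self]

/-- The substitution `x = y + τ (z - H)` for fixed `y` and `τ` turns the integral over `z` into that of
the Gagliardo seminorm. -/
theorem lintegral_average_quot_le (H : ℝ) {k b : ℝ → ℝ} (hk : Measurable k) (hb : Measurable b) :
    ∫⁻ p : ℝ × ℝ, ‖∫ τ, τ * k τ * quot b (p.1 + τ * (p.2 - H), p.1)‖ₑ ^ 2 ≤
      (∫⁻ τ, ‖τ * k τ‖ₑ) * (∫⁻ τ, ‖k τ‖ₑ) * ∫⁻ q, ‖quot b q‖ₑ ^ 2 := by
  have hq := measurable_quot hb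
  refine (lintegral_average_sq_le (m := fun τ => τ * k τ)
    (h := fun τ (p : ℝ × ℝ) => quot b (p.1 + τ * (p.2 - H), p.1)) (measurable_id.mul hk)
    (hq.comp (by fun_prop : Measurable fun x : ℝ × (ℝ × ℝ) =>
      (x.2.1 + x.1 * (x.2.2 - H), x.2.1)))).trans ?_
  rw [mul_assoc]
  refine mul_le_mul_right ?_ _
  rw [← lintegral_mul_const _ hk.enorm]
  refine lintegral_mono fun τ => ?_
  rcases eq_or_ne τ 0 with rfl | hτ
  · simp
  have e : ∫⁻ p : ℝ × ℝ, ‖quot b (p.1 + τ * (p.2 - H), p.1)‖ₑ ^ 2 =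
      ENNReal.ofReal |τ⁻¹| * ∫⁻ q, ‖quot b q‖ₑ ^ 2 := by
    have m1 : Measurable fun q => ‖quot b q‖ₑ ^ 2 := hq.enorm.pow_const 2
    have m2 : Measurable fun p : ℝ × ℝ => ‖quot b (p.1 + τ * (p.2 - H), p.1)‖ₑ ^ 2 :=
      m1.comp (by fun_prop)
    rw [Measure.volume_eq_prod, lintegral_prod _ m2.aemeasurable,
      lintegral_prod_symm _ m1.aemeasurable, ← lintegral_const_mul _ m1.lintegral_prod_left']
    refine lintegral_congr fun y => ?_
    exact lintegral_comp_affine (F := fun x => ‖quot b (x, y)‖ₑ ^ 2)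
      (m1.comp measurable_prodMk_right) hτ y H
  rw [e, ← mul_assoc]
  refine mul_le_mul_left (le_of_eq ?_) _
  rw [← Real.enorm_of_nonneg (abs_nonneg _), ← enorm_mul]
  rw [← enorm_norm, norm_mul, norm_mul, Real.norm_eq_abs |τ⁻¹|, abs_abs, abs_inv, Real.norm_eq_abs τ,
    mul_right_comm, mul_inv_cancel₀ (abs_ne_zero.2 hτ), one_mul, enorm_norm]

theorem lintegral_lift_le (H : ℝ) {κ b : ℝ → ℝ} (hκ : Measurable κ) (hb : Measurable b) :
    ∫⁻ p in dom (Ioo 0 H), ‖lift H κ b p‖ₑ ^ 2 ≤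
      (∫⁻ τ, ‖κ τ‖ₑ) * (∫⁻ τ, ‖κ τ‖ₑ) * ENNReal.ofReal H * ∫⁻ y, ‖b y‖ₑ ^ 2 := by
  refine (lintegral_average_sq_le (m := κ) (h := fun τ (p : ℝ × ℝ) => b (p.1 + τ * (p.2 - H))) hκ
    (by unfold Function.uncurry; fun_prop)).trans ?_
  rw [mul_assoc, mul_assoc]
  refine mul_le_mul_right ?_ _
  rw [← lintegral_mul_const _ hκ.enorm]
  refine lintegral_mono fun τ => mul_le_mul_right ?_ _
  have m1 : Measurable fun p : ℝ × ℝ => ‖b (p.1 + τ * (p.2 - H))‖ₑ ^ 2 :=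
    (hb.comp (by fun_prop)).enorm.pow_const 2
  have hsub : dom (Ioo 0 H) ⊆ univ ×ˢ Ioo 0 H := prod_mono (subset_univ _) subset_rfl
  refine (lintegral_mono_set hsub).trans ?_
  rw [Measure.volume_eq_prod, ← Measure.prod_restrict, Measure.restrict_univ,
    lintegral_prod_symm _ m1.aemeasurable]
  have : ∀ z, ∫⁻ y, ‖b (y + τ * (z - H))‖ₑ ^ 2 = ∫⁻ y, ‖b y‖ₑ ^ 2 := fun z =>
    lintegral_add_right_eq_self (fun y => ‖b y‖ₑ ^ 2) _
  simp only [this, lintegral_const, Measure.restrict_apply_univ, Real.volume_Ioo, sub_zero]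
  rw [mul_comm]

theorem lift_at_top {H : ℝ} {κ b : ℝ → ℝ} (hκ1 : ∫ τ, κ τ = 1) (y : ℝ) :
    lift H κ b (y, H) = b y := by
  simp [lift, integral_mul_const, hκ1]

theorem lift_sub (H : ℝ) {κ b₁ b₂ : ℝ → ℝ} (hκ : Continuous κ) (hκc : HasCompactSupport κ)
    (h₁ : Continuous b₁) (h₂ : Continuous b₂) :
    lift H κ (b₁ - b₂) = lift H κ b₁ - lift H κ b₂ := by
  ext p
  simp only [lift, Pi.sub_apply, mul_sub]
  exact integral_sub ((hκ.mul (by fun_prop)).integrable_of_hasCompactSupport hκc.mul_right)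
    ((hκ.mul (by fun_prop)).integrable_of_hasCompactSupport hκc.mul_right)

theorem dY_one_sub {u v : ℝ × ℝ → ℝ} (hu : ContDiff ℝ ∞ u) (hv : ContDiff ℝ ∞ v) :
    dY 1 (u - v) = dY 1 u - dY 1 v := by
  ext p
  have h1 := ((hu.differentiable (by simp)) p).hasFDerivAt
  have h2 := ((hv.differentiable (by simp)) p).hasFDerivAt
  rw [Pi.sub_apply, dY_one_of_hasFDerivAt h1, dY_one_of_hasFDerivAt h2,
    dY_one_of_hasFDerivAt (h1.sub h2)]
  rfl

theorem dZ_sub {u v : ℝ × ℝ → ℝ} (hu : ContDiff ℝ ∞ u) (hv : ContDiff ℝ ∞ v) :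
    dZ (u - v) = dZ u - dZ v := by
  ext p
  have h1 := ((hu.differentiable (by simp)) p).hasFDerivAt
  have h2 := ((hv.differentiable (by simp)) p).hasFDerivAt
  rw [Pi.sub_apply, dZ_of_hasFDerivAt h1, dZ_of_hasFDerivAt h2, dZ_of_hasFDerivAt (h1.sub h2)]
  rfl

theorem IsTestHalf.sub {b₁ b₂ : ℝ → ℝ} (h₁ : IsTestHalf b₁) (h₂ : IsTestHalf b₂) :
    IsTestHalf (b₁ - b₂) :=
  ⟨h₁.smooth.sub h₂.smooth, h₁.compact.sub h₂.compact,
    (tsupport_sub b₁ b₂).trans (union_subset h₁.supp h₂.supp)⟩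

/-- On the layer `0 ≤ z ≤ H`, the lift of a test function agrees with a test function. -/
theorem IsTestHalf.exists_test_lift {H : ℝ} (hH : 0 < H) {κ b : ℝ → ℝ} (hκ : ContDiff ℝ ∞ κ)
    (hκc : HasCompactSupport κ) (hκs : ∀ τ, κ τ ≠ 0 → 1 ≤ τ ∧ τ ≤ 2) (hb : IsTestHalf b) :
    ∃ w, IsTest univ w ∧ ∀ p : ℝ × ℝ, 0 ≤ p.2 → p.2 ≤ H → w p = lift H κ b p := by
  obtain ⟨α, hα, hαb⟩ := hb.compact.isCompact.exists_forall_le' continuousOn_id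
    (a := 0) fun y hy => hb.supp hy
  obtain ⟨β, hβ⟩ := hb.compact.isCompact.bddAbove
  -- Below `z = 0` and above `z = H` the lift is cut off at height `α / 4`, where `b` is supported in
  -- `y ≥ α`: as `τ ≤ 2`, it still vanishes for `y < α / 2`.
  let ξ : ContDiffBump (H / 2) := ⟨H / 2, H / 2 + α / 4, by linarith, by linarith⟩
  have hsupp : ∀ p : ℝ × ℝ, lift H κ b p * ξ p.2 ≠ 0 →
      p ∈ Icc (α / 2) (β + 2 * (H + α / 4)) ×ˢ Icc (-(α / 4)) (H + α / 4) := by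
    intro p hp
    have h1 : ∃ τ, κ τ * b (p.1 + τ * (p.2 - H)) ≠ 0 := by
      by_contra hall
      push Not at hall
      exact left_ne_zero_of_mul hp (integral_eq_zero_of_ae (.of_forall hall))
    obtain ⟨τ, hτ⟩ := h1
    obtain ⟨t1, t2⟩ := hκs τ (left_ne_zero_of_mul hτ)
    have hmem := subset_tsupport b (right_ne_zero_of_mul hτ)
    have b1 : α ≤ p.1 + τ * (p.2 - H) := hαb _ hmem
    have b2 : p.1 + τ * (p.2 - H) ≤ β := hβ hmem
    have hz : p.2 ∈ Metric.ball (H / 2) ξ.rOut := by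
      rw [← ξ.support_eq]; exact right_ne_zero_of_mul hp
    have hr : ξ.rOut = H / 2 + α / 4 := rfl
    rw [Metric.mem_ball, Real.dist_eq, hr, abs_lt] at hz
    have z1 : -(α / 4) < p.2 := by linarith [hz.1]
    have z2 : p.2 < H + α / 4 := by linarith [hz.2]
    refine ⟨⟨?_, ?_⟩, z1.le, z2.le⟩
    · nlinarith
    · nlinarith
  have hK : IsCompact (Icc (α / 2) (β + 2 * (H + α / 4)) ×ˢ Icc (-(α / 4)) (H + α / 4)) :=
    isCompact_Icc.prod isCompact_Icc
  refine ⟨fun p => lift H κ b p * ξ p.2, ⟨(contDiff_lift H hκ hκc hb.smooth).mul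
    (ξ.contDiff.comp contDiff_snd), HasCompactSupport.of_support_subset_isCompact hK hsupp, ?_⟩,
    fun p h0 h1 => ?_⟩
  · refine (closure_minimal hsupp hK.isClosed).trans (prod_mono (fun y hy => ?_) (subset_univ _))
    exact lt_of_lt_of_le (by positivity) hy.1
  · have : ξ p.2 = 1 := ξ.one_of_mem_closedBall (by
      rw [Metric.mem_closedBall, Real.dist_eq, abs_le]
      have hr : ξ.rIn = H / 2 := rfl
      constructor <;> linarith)
    simp only [this, mul_one]

theorem memLp_of_lintegral_sq_le {α β : Type*} [MeasurableSpace α] [MeasurableSpace β]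
    {μ : Measure α} {ν : Measure β} {f : α → ℝ} {g : β → ℝ} {K : ENNReal} (hK : K ≠ ⊤)
    (hf : AEStronglyMeasurable f μ) (hg : MemLp g 2 ν)
    (h : ∫⁻ x, ‖f x‖ₑ ^ 2 ∂μ ≤ K * ∫⁻ x, ‖g x‖ₑ ^ 2 ∂ν) :
    MemLp f 2 μ ∧ (eLpNorm f 2 μ).toReal ≤ √K.toReal * (eLpNorm g 2 ν).toReal := by
  rw [← eLpNorm_two_sq, ← eLpNorm_two_sq] at h
  have htop : K * eLpNorm g 2 ν ^ 2 ≠ ⊤ := ENNReal.mul_ne_top hK (ENNReal.pow_ne_top hg.2.ne)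
  have hf2 : eLpNorm f 2 μ ^ 2 ≠ ⊤ := ne_top_of_le_ne_top htop h
  refine ⟨⟨hf, lt_top_iff_ne_top.2 fun h0 => hf2 (by rw [h0]; simp)⟩, ?_⟩
  have h2 := ENNReal.toReal_mono htop h
  rw [ENNReal.toReal_mul, ENNReal.toReal_pow, ENNReal.toReal_pow] at h2
  refine le_of_sq_le_sq ?_ (by positivity)
  rwa [mul_pow, Real.sq_sqrt ENNReal.toReal_nonneg]

/-- The lift is bounded from `H^{1/2}_0` to `H¹` of the layer. The derivatives are estimated by the
Gagliardo seminorm alone. -/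
theorem exists_lift_bound (H : ℝ) {κ : ℝ → ℝ} (hκ : ContDiff ℝ ∞ κ) (hκc : HasCompactSupport κ) :
    ∃ C : ℝ, ∀ b, IsTestHalf b → MemLp (quot b) 2 →
      (MemL2 (Ioo 0 H) (lift H κ b) ∧ (eLpNorm (lift H κ b) 2
        (volume.restrict (dom (Ioo 0 H)))).toReal ≤ C * (eLpNorm b 2).toReal) ∧
      (MemL2 (Ioo 0 H) (dY 1 (lift H κ b)) ∧ (eLpNorm (dY 1 (lift H κ b)) 2
        (volume.restrict (dom (Ioo 0 H)))).toReal ≤ C * (eLpNorm (quot b) 2).toReal) ∧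
      (MemL2 (Ioo 0 H) (dZ (lift H κ b)) ∧ (eLpNorm (dZ (lift H κ b)) 2
        (volume.restrict (dom (Ioo 0 H)))).toReal ≤ C * (eLpNorm (quot b) 2).toReal) := by
  have hfin : ∀ {g : ℝ → ℝ}, Continuous g → HasCompactSupport g → ∫⁻ τ, ‖g τ‖ₑ ≠ ⊤ :=
    fun hg hgc => (hg.integrable_of_hasCompactSupport hgc).2.ne
  have hκτ : ContDiff ℝ ∞ fun τ => κ τ * τ := hκ.mul contDiff_id
  have hκτc : HasCompactSupport fun τ => κ τ * τ := hκc.mul_right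
  -- The averaging bound for difference quotients, applied to `κ` and to `τ κ`.
  have key : ∀ {k : ℝ → ℝ}, ContDiff ℝ ∞ k → HasCompactSupport k → ∃ C : ℝ, ∀ b, IsTestHalf b →
      MemLp (quot b) 2 → ∀ u : ℝ × ℝ → ℝ, Continuous u →
      (∀ p, u p = lift H k (deriv b) p) → MemL2 (Ioo 0 H) u ∧
      (eLpNorm u 2 (volume.restrict (dom (Ioo 0 H)))).toReal ≤ C * (eLpNorm (quot b) 2).toReal := by
    intro k hk hkc
    have hk' : Continuous (deriv k) := hk.continuous_deriv (by simp)
    refine ⟨√((∫⁻ τ, ‖τ * deriv k τ‖ₑ) * ∫⁻ τ, ‖deriv k τ‖ₑ).toReal, fun b hb hq u hu hul => ?_⟩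
    refine memLp_of_lintegral_sq_le (ENNReal.mul_ne_top (hfin (by fun_prop) hkc.deriv.mul_left)
      (hfin hk' hkc.deriv)) hu.aestronglyMeasurable hq ?_
    refine le_trans ?_ (lintegral_average_quot_le H hk'.measurable hb.smooth.continuous.measurable)
    refine le_trans (setLIntegral_mono' (measurableSet_dom measurableSet_Ioo) fun p hp => ?_)
      (setLIntegral_le_lintegral _ _)
    rw [hul, lift_deriv_eq H (hk.of_le (by exact_mod_cast le_top)) hkc
      (hb.smooth.of_le (by exact_mod_cast le_top)) hp.2.2.ne, enorm_neg]
  obtain ⟨C₁, hC₁⟩ := key hκ hκc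
  obtain ⟨C₂, hC₂⟩ := key hκτ hκτc
  set C₀ : ℝ := √((∫⁻ τ, ‖κ τ‖ₑ) * (∫⁻ τ, ‖κ τ‖ₑ) * ENNReal.ofReal H).toReal with hC₀
  refine ⟨max C₀ (max C₁ C₂), fun b hb hq => ?_⟩
  have hL := contDiff_lift H hκ hκc hb.smooth
  have hL1 : ContDiff ℝ 1 (lift H κ b) := hL.of_le (by exact_mod_cast le_top)
  have hb1 : ContDiff ℝ 1 b := hb.smooth.of_le (by exact_mod_cast le_top)
  have hcY : Continuous (dY 1 (lift H κ b)) := by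
    have : dY 1 (lift H κ b) = fun p => fderiv ℝ (lift H κ b) p (1, 0) := by
      ext p; exact dY_one_of_hasFDerivAt (hL1.differentiable (by simp) p).hasFDerivAt
    rw [this]; exact (hL1.continuous_fderiv (by simp)).clm_apply continuous_const
  have hcZ : Continuous (dZ (lift H κ b)) := by
    have : dZ (lift H κ b) = fun p => fderiv ℝ (lift H κ b) p (0, 1) := by
      ext p; exact dZ_of_hasFDerivAt (hL1.differentiable (by simp) p).hasFDerivAt
    rw [this]; exact (hL1.continuous_fderiv (by simp)).clm_apply continuous_const
  have mono : ∀ {x c d r : ℝ}, x ≤ c * r → c ≤ d → 0 ≤ r → x ≤ d * r :=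
    fun h1 h2 h3 => h1.trans (mul_le_mul_of_nonneg_right h2 h3)
  refine ⟨?_, ?_, ?_⟩
  · have hκi := hfin hκ.continuous hκc
    have := memLp_of_lintegral_sq_le (ENNReal.mul_ne_top (ENNReal.mul_ne_top hκi hκi)
      ENNReal.ofReal_ne_top) hL.continuous.aestronglyMeasurable hb.memLp
      (lintegral_lift_le H hκ.continuous.measurable hb.smooth.continuous.measurable)
    exact ⟨this.1, mono this.2 (le_max_left _ _) ENNReal.toReal_nonneg⟩
  · have := hC₁ b hb hq _ hcY fun p => by
      simpa [dY] using (hasDerivAt_lift_fst H hκ.continuous hκc hb1 hb.compact p).deriv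
    exact ⟨this.1, mono this.2 (le_max_of_le_right (le_max_left _ _)) ENNReal.toReal_nonneg⟩
  · have := hC₂ b hb hq _ hcZ fun p =>
      (hasDerivAt_lift_snd H hκ.continuous hκc hb1 hb.compact p).deriv
    exact ⟨this.1, mono this.2 (le_max_of_le_right (le_max_right _ _)) ENNReal.toReal_nonneg⟩

theorem exists_limit_L2 {α : Type*} [MeasurableSpace α] {μ : Measure α} {u : ℕ → α → ℝ}
    (hu : ∀ n, MemLp (u n) 2 μ) {c : ℕ → ℝ} (hc : Tendsto c atTop (𝓝 0))
    (h : ∀ n m, (eLpNorm (u n - u m) 2 μ).toReal ≤ c n + c m) :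
    ∃ U, MemLp U 2 μ ∧ Tendsto (fun n => (eLpNorm (u n - U) 2 μ).toReal) atTop (𝓝 0) := by
  have hdist : ∀ n m, dist ((hu n).toLp (u n)) ((hu m).toLp (u m)) ≤ c n + c m := fun n m => by
    rw [dist_eq_norm, ← MemLp.toLp_sub, Lp.norm_toLp]
    exact h n m
  have hcau : CauchySeq fun n => (hu n).toLp (u n) := by
    rw [Metric.cauchySeq_iff']
    intro ε hε
    obtain ⟨N, hN⟩ := eventually_atTop.1 (hc.eventually (gt_mem_nhds (half_pos hε)))
    refine ⟨N, fun n hn => (hdist n N).trans_lt ?_⟩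
    linarith [hN n hn, hN N le_rfl]
  obtain ⟨U, hU⟩ := cauchySeq_tendsto_of_complete hcau
  refine ⟨U, Lp.memLp U, ?_⟩
  rw [tendsto_iff_norm_sub_tendsto_zero] at hU
  refine hU.congr fun n => ?_
  have : U = (Lp.memLp U).toLp U := (Lp.toLp_coeFn U _).symm
  conv_lhs => rw [this]
  rw [← MemLp.toLp_sub, Lp.norm_toLp]

/-! ### Integration by parts in the layer -/

theorem IsTestPlane.integral_dZ {u : ℝ × ℝ → ℝ} (hu : IsTestPlane u) {H : ℝ} (hH : 0 < H) :
    ∫ p in dom (Ioo 0 H), EquatorialLayer.dZ u p = ∫ y in Ioi (0 : ℝ), (u (y, H) - u (y, 0)) := by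
  have hi : IntegrableOn (EquatorialLayer.dZ u) (Ioi (0 : ℝ) ×ˢ Ioo 0 H) (volume.prod volume) :=
    hu.dZ.integrable.integrableOn
  rw [dom, Measure.volume_eq_prod, setIntegral_prod _ hi]
  refine integral_congr_ae (.of_forall fun y => ?_)
  have hd : ∀ z, HasDerivAt (fun z => u (y, z)) (EquatorialLayer.dZ u (y, z)) z := fun z => by
    have h := hasDerivAt_snd (hu.hasFDerivAt (y, z))
    rwa [← dZ_of_hasFDerivAt (hu.hasFDerivAt (y, z))] at h
  have hc : Continuous fun z => EquatorialLayer.dZ u (y, z) := by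
    have := hu.dZ.continuous; fun_prop
  simp only
  rw [← integral_Ioc_eq_integral_Ioo, ← intervalIntegral.integral_of_le hH.le]
  exact intervalIntegral.integral_eq_sub_of_hasDerivAt (fun z _ => hd z)
    (hc.intervalIntegrable _ _)

theorem IsTest.integral_dY {u : ℝ × ℝ → ℝ} (hu : IsTest univ u) {I : Set ℝ} :
    ∫ p in dom I, dY 1 u p = 0 := by
  have hi : Integrable (dY 1 u) (halfLine.prod (volume.restrict I)) := by
    rw [Measure.prod_restrict]; exact (hu.plane.dY 1).integrable.integrableOn
  rw [dom, Measure.volume_eq_prod, ← Measure.prod_restrict, integral_prod_symm _ hi]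
  refine integral_eq_zero_of_ae (.of_forall fun z => ?_)
  have hd : ∀ y, HasDerivAt (fun y => u (y, z)) (dY 1 u (y, z)) y := fun y => by
    have h := hasDerivAt_fst (hu.plane.hasFDerivAt (y, z))
    rwa [← dY_one_of_hasFDerivAt (hu.plane.hasFDerivAt (y, z))] at h
  have hcs : HasCompactSupport fun y => u (y, z) :=
    HasCompactSupport.of_support_subset_isCompact (hu.compact.isCompact.image continuous_fst)
      fun y hy => ⟨(y, z), subset_tsupport u hy, rfl⟩
  have hc : Continuous fun y => u (y, z) := by have := hu.plane.continuous; fun_prop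
  have hcs' : HasCompactSupport fun y => dY 1 u (y, z) :=
    HasCompactSupport.of_support_subset_isCompact
      ((hu.plane.dY 1).compact.isCompact.image continuous_fst)
      fun y hy => ⟨(y, z), subset_tsupport _ hy, rfl⟩
  have hc' : Continuous fun y => dY 1 u (y, z) := by
    have := (hu.plane.dY 1).continuous; fun_prop
  have h0 : u (0, z) = 0 := image_eq_zero_of_notMem_tsupport fun h =>
    lt_irrefl (0 : ℝ) (hu.supp h).1
  have htop : Tendsto (fun y => u (y, z)) atTop (𝓝 0) :=
    (hcs.is_zero_at_infty).mono_left atTop_le_cocompact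
  have := integral_Ioi_of_hasDerivAt_of_tendsto' (a := 0) (fun y _ => hd y)
    (hc'.integrable_of_hasCompactSupport hcs').integrableOn htop
  rw [h0, sub_zero] at this
  exact this

theorem IsTestPlane.dY_one_mul {u v : ℝ × ℝ → ℝ} (hu : IsTestPlane u) (hv : IsTestPlane v)
    (p : ℝ × ℝ) : EquatorialLayer.dY 1 (fun p => u p * v p) p =
      EquatorialLayer.dY 1 u p * v p + u p * EquatorialLayer.dY 1 v p := by
  have h1 := hasDerivAt_fst (hu.hasFDerivAt p)
  have h2 := hasDerivAt_fst (hv.hasFDerivAt p)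
  rw [dY_one_of_hasFDerivAt (hu.hasFDerivAt p), dY_one_of_hasFDerivAt (hv.hasFDerivAt p)]
  simp only [EquatorialLayer.dY, iteratedDeriv_one]
  exact (h1.mul h2).deriv

theorem IsTestPlane.dZ_mul {u v : ℝ × ℝ → ℝ} (hu : IsTestPlane u) (hv : IsTestPlane v)
    (p : ℝ × ℝ) : EquatorialLayer.dZ (fun p => u p * v p) p =
      EquatorialLayer.dZ u p * v p + u p * EquatorialLayer.dZ v p := by
  have h1 := hasDerivAt_snd (hu.hasFDerivAt p)
  have h2 := hasDerivAt_snd (hv.hasFDerivAt p)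
  rw [dZ_of_hasFDerivAt (hu.hasFDerivAt p), dZ_of_hasFDerivAt (hv.hasFDerivAt p)]
  exact (h1.mul h2).deriv

/-! ### Lifting of a boundary value into the layer -/

/-- `A ∈ H¹` of the layer `0 < z < H`, with derivatives `Ay`, `Az`, has the trace `a` at `z = H` and
vanishes at `y = 0`: it is the limit of the test functions `w n`, whose traces at `z = H` tend to
`a` in `H^{1/2}_0`. -/
structure IsLifting (H : ℝ) (a : HHalf) (A Ay Az : ℝ × ℝ → ℝ) (w : ℕ → ℝ × ℝ → ℝ) : Prop where
  test : ∀ n, IsTest univ (w n)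
  mem : MemL2 (Ioo 0 H) A
  memY : MemL2 (Ioo 0 H) Ay
  memZ : MemL2 (Ioo 0 H) Az
  lim : Tendsto (fun n => (eLpNorm (w n - A) 2 (volume.restrict (dom (Ioo 0 H)))).toReal)
    atTop (𝓝 0)
  limY : Tendsto (fun n => (eLpNorm (dY 1 (w n) - Ay) 2
    (volume.restrict (dom (Ioo 0 H)))).toReal) atTop (𝓝 0)
  limZ : Tendsto (fun n => (eLpNorm (dZ (w n) - Az) 2
    (volume.restrict (dom (Ioo 0 H)))).toReal) atTop (𝓝 0)
  limTrace : Tendsto (fun n => hHalfNorm ((a - (test n).trace H : HHalf) : ℝ → ℝ)) atTop (𝓝 0)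

/-- Lifting test functions that approximate the extension of `a` by zero gives a Cauchy sequence in
`H¹` of the layer. -/
theorem exists_isLifting {H : ℝ} (hH : 0 < H) (a : HHalf) :
    ∃ A Ay Az w, IsLifting H a A Ay Az w := by
  obtain ⟨f, hf, hf0, haf, h1, h2⟩ := exists_extension a
  obtain ⟨b, hb, hbq, l1, l2⟩ := exists_approx_sequence hf hf0 h1 h2
  -- A probability density supported in `1 ≤ τ ≤ 2`, so that the lift averages strictly to the left.
  let ξ : ContDiffBump (3 / 2 : ℝ) := ⟨1 / 4, 1 / 2, by norm_num, by norm_num⟩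
  set κ : ℝ → ℝ := ξ.normed volume with hκd
  have hκ : ContDiff ℝ ∞ κ := ξ.contDiff_normed
  have hκc : HasCompactSupport κ := ξ.hasCompactSupport_normed
  have hκ1 : ∫ τ, κ τ = 1 := ξ.integral_normed
  have hκs : ∀ τ, κ τ ≠ 0 → 1 ≤ τ ∧ τ ≤ 2 := fun τ hτ => by
    have : τ ∈ Function.support (ξ.normed volume) := hτ
    rw [ξ.support_normed_eq, Metric.mem_ball, Real.dist_eq, abs_lt] at this
    have h : ξ.rOut = 1 / 2 := rfl
    rw [h] at this
    constructor <;> linarith [this.1, this.2]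
  choose w hw hwl using fun n => (hb n).exists_test_lift hH hκ hκc hκs
  obtain ⟨C, hC⟩ := exists_lift_bound H hκ hκc
  have hsm : ∀ n, ContDiff ℝ ∞ (lift H κ (b n)) := fun n => contDiff_lift H hκ hκc (hb n).smooth
  have hsub : ∀ n m, lift H κ (b n - b m) = lift H κ (b n) - lift H κ (b m) := fun n m =>
    lift_sub H hκ.continuous hκc (hb n).smooth.continuous (hb m).smooth.continuous
  have hqm : ∀ n m, MemLp (quot (b n - b m)) 2 := fun n m => by
    rw [quot_sub]; exact (hbq n).sub (hbq m)
  have hCn := fun n m => hC _ ((hb n).sub (hb m)) (hqm n m)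
  have bound : ∀ {x p q r : ℝ}, x ≤ C * r → r ≤ p + q → 0 ≤ r → x ≤ |C| * p + |C| * q :=
    fun {x p q r} hx hr hr0 => by
      rw [← mul_add]
      exact hx.trans ((mul_le_mul_of_nonneg_right (le_abs_self C) hr0).trans
        (mul_le_mul_of_nonneg_left hr (abs_nonneg C)))
  have c1 := l1.const_mul |C|
  have c2 := l2.const_mul |C|
  rw [mul_zero] at c1 c2
  have tri := fun n m => toReal_eLpNorm_sub_le (hb n).memLp h1 (hb m).memLp
  have triq := fun n m => toReal_eLpNorm_sub_le (hbq n) h2 (hbq m)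
  simp only [eLpNorm_sub_comm f] at tri
  simp only [eLpNorm_sub_comm (quot f)] at triq
  obtain ⟨A, mA, lA⟩ := exists_limit_L2 (fun n => (hC _ (hb n) (hbq n)).1.1) c1 fun n m => by
    have := (hCn n m).1.2
    rw [hsub] at this
    exact bound this (tri n m) ENNReal.toReal_nonneg
  obtain ⟨Ay, mAy, lAy⟩ := exists_limit_L2 (fun n => (hC _ (hb n) (hbq n)).2.1.1) c2 fun n m => by
    have := (hCn n m).2.1.2
    rw [hsub, dY_one_sub (hsm n) (hsm m), quot_sub] at this
    exact bound this (triq n m) ENNReal.toReal_nonneg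
  obtain ⟨Az, mAz, lAz⟩ := exists_limit_L2 (fun n => (hC _ (hb n) (hbq n)).2.2.1) c2 fun n m => by
    have := (hCn n m).2.2.2
    rw [hsub, dZ_sub (hsm n) (hsm m), quot_sub] at this
    exact bound this (triq n m) ENNReal.toReal_nonneg
  -- The lifts may be replaced by test functions, which agree with them on the layer.
  have hmem := ae_restrict_mem (μ := volume) (measurableSet_dom (measurableSet_Ioo (a := 0) (b := H)))
  refine ⟨A, Ay, Az, w, hw, mA, mAy, mAz, lA.congr fun n => ?_, lAy.congr fun n => ?_,
    lAz.congr fun n => ?_, ?_⟩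
  · congr 1
    refine eLpNorm_congr_ae ?_
    filter_upwards [hmem] with p hp
    simp only [Pi.sub_apply]
    rw [hwl n p hp.2.1.le hp.2.2.le]
  · congr 1
    refine eLpNorm_congr_ae ?_
    filter_upwards [hmem] with p hp
    simp only [Pi.sub_apply, dY]
    congr 2
    ext y
    exact (hwl n (y, p.2) hp.2.1.le hp.2.2.le).symm
  · congr 1
    refine eLpNorm_congr_ae ?_
    filter_upwards [hmem] with p hp
    simp only [Pi.sub_apply, dZ]
    congr 1
    refine Filter.EventuallyEq.deriv_eq ?_
    filter_upwards [Ioo_mem_nhds hp.2.1 hp.2.2] with z hz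
    exact (hwl n (p.1, z) hz.1.le hz.2.le).symm
  · have l3 : Tendsto (fun n => √((eLpNorm (b n - f) 2).toReal ^ 2 +
        2 * (eLpNorm (quot (b n) - quot f) 2).toReal ^ 2)) atTop (𝓝 0) := by
      have := ((l1.pow 2).add ((l2.pow 2).const_mul 2)).sqrt
      simpa using this
    refine squeeze_zero (fun n => Real.sqrt_nonneg _) (fun n => ?_) l3
    have m1 : MemLp (b n - f) 2 := (hb n).memLp.sub h1
    have m2 : MemLp (quot (b n) - quot f) 2 := (hbq n).sub h2
    have e1 : (eLpNorm (b n - f) 2).toReal ^ 2 = ∫ y, (f - b n) y ^ 2 := by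
      rw [toReal_eLpNorm_two m1, Real.sq_sqrt (integral_nonneg fun y => sq_nonneg _)]
      refine integral_congr_ae (.of_forall fun y => ?_)
      simp only [Pi.sub_apply]
      ring
    have e2 : (eLpNorm (quot (b n) - quot f) 2).toReal ^ 2 = ∫ q, quot (f - b n) q ^ 2 := by
      rw [toReal_eLpNorm_two m2, Real.sq_sqrt (integral_nonneg fun y => sq_nonneg _)]
      refine integral_congr_ae (.of_forall fun y => ?_)
      simp only [quot_sub, Pi.sub_apply]
      ring
    rw [e1, e2]
    refine hHalfNorm_le (fun y hy => ?_) ?_ (h1.sub (hb n).memLp) ?_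
    · rw [Pi.sub_apply, hf0 y hy, (hb n).eq_zero hy, sub_zero]
    · filter_upwards [haf] with y hy
      change (a : ℝ → ℝ) y - w n (y, H) = f y - b n y
      rw [hy, hwl n (y, H) hH.le le_rfl, lift_at_top hκ1]
    · rw [quot_sub]; exact h2.sub (hbq n)

theorem toReal_eLpNorm_le_hHalfNorm (a : HHalf) :
    (eLpNorm (a : ℝ → ℝ) 2 halfLine).toReal ≤ hHalfNorm a := by
  rw [toReal_eLpNorm_two a.2.1, hHalfNorm]
  refine Real.sqrt_le_sqrt ?_
  have h1 : 0 ≤ ∫ y in Ioo (0 : ℝ) 1, (a : ℝ → ℝ) y ^ 2 / y :=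
    setIntegral_nonneg measurableSet_Ioo fun y hy => div_nonneg (sq_nonneg _) hy.1.le
  have h2 : 0 ≤ ∫ q, (((a : ℝ → ℝ) q.1 - (a : ℝ → ℝ) q.2) / (q.1 - q.2)) ^ 2
      ∂(halfLine.prod halfLine) := integral_nonneg fun q => sq_nonneg _
  linarith

namespace IsLifting

variable {H : ℝ} {a : HHalf} {A Ay Az : ℝ × ℝ → ℝ} {w : ℕ → ℝ × ℝ → ℝ}

theorem tendsto_integral_trace (h : IsLifting H a A Ay Az w) {φ : ℝ × ℝ → ℝ}
    (hφ : IsTest (Ioi 0) φ) :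
    Tendsto (fun n => ∫ y in Ioi (0 : ℝ), φ (y, H) * w n (y, H)) atTop
      (𝓝 (∫ y in Ioi (0 : ℝ), φ (y, H) * (a : ℝ → ℝ) y)) := by
  refine tendsto_integral_mul (hφ.trace_mem H).1 a.2.1 (fun n => ((h.test n).trace_mem H).1)
    (squeeze_zero (fun n => ENNReal.toReal_nonneg) (fun n => ?_) h.limTrace)
  refine le_trans (le_of_eq ?_) (toReal_eLpNorm_le_hHalfNorm _)
  rw [eLpNorm_sub_comm]
  rfl

/-- Green's formula for `∂_z` and the lifting. -/
theorem integral_dZ (h : IsLifting H a A Ay Az w) (hH : 0 < H) {φ : ℝ × ℝ → ℝ}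
    (hφ : IsTest (Ioi 0) φ) :
    (∫ p in dom (Ioo 0 H), A p * dZ φ p) + ∫ p in dom (Ioo 0 H), Az p * φ p =
      ∫ y in Ioi (0 : ℝ), (a : ℝ → ℝ) y * φ (y, H) := by
  have e : ∀ n, (∫ p in dom (Ioo 0 H), dZ φ p * w n p) + ∫ p in dom (Ioo 0 H), φ p * dZ (w n) p =
      ∫ y in Ioi (0 : ℝ), φ (y, H) * w n (y, H) := fun n => by
    have hw := (h.test n).plane
    rw [← integral_add (integrable_mul_test (hφ.plane.dZ.memLp.restrict _) hw)
      (integrable_mul_test (hφ.plane.memLp.restrict _) hw.dZ)]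
    have := (hφ.plane.mul hw.smooth).integral_dZ hH
    simp only [hφ.plane.dZ_mul hw] at this
    rw [this]
    refine integral_congr_ae (.of_forall fun y => ?_)
    have h0 : φ (y, 0) = 0 := image_eq_zero_of_notMem_tsupport fun h =>
      lt_irrefl (0 : ℝ) (hφ.supp h).2
    simp only [h0, zero_mul, sub_zero]
  have t1 := tendsto_integral_mul (hφ.plane.dZ.memLp.restrict _) h.mem
    (fun n => (h.test n).plane.memLp.restrict _) h.lim
  have t2 := tendsto_integral_mul (hφ.plane.memLp.restrict _) h.memZ
    (fun n => (h.test n).plane.dZ.memLp.restrict _) h.limZ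
  have := tendsto_nhds_unique ((t1.add t2).congr e) (h.tendsto_integral_trace hφ)
  simpa only [mul_comm] using this

/-- The lifting satisfies homogeneous conditions at `y = 0`. -/
theorem isWeakPlane (h : IsLifting H a A Ay Az w) :
    IsWeakPlane 1 ((dom (Ioo 0 H)).indicator A) ((dom (Ioo 0 H)).indicator Ay) := by
  intro φ hφ
  rw [integral_indicator_mul measurableSet_Ioo, integral_indicator_mul measurableSet_Ioo, pow_one,
    neg_one_mul]
  have e : ∀ n, (∫ p in dom (Ioo 0 H), dY 1 φ p * w n p) +
      ∫ p in dom (Ioo 0 H), φ p * dY 1 (w n) p = 0 := fun n => by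
    have hw := (h.test n).plane
    rw [← integral_add (integrable_mul_test ((hφ.dY 1).memLp.restrict _) hw)
      (integrable_mul_test (hφ.memLp.restrict _) (hw.dY 1))]
    have := ((h.test n).mul hφ.smooth).integral_dY (I := Ioo 0 H)
    simp only [hw.dY_one_mul hφ] at this
    refine Eq.trans ?_ this
    refine integral_congr_ae (.of_forall fun p => ?_)
    simp only
    ring
  have t1 := tendsto_integral_mul ((hφ.dY 1).memLp.restrict _) h.mem
    (fun n => (h.test n).plane.memLp.restrict _) h.lim
  have t2 := tendsto_integral_mul (hφ.memLp.restrict _) h.memY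
    (fun n => ((h.test n).plane.dY 1).memLp.restrict _) h.limY
  have := tendsto_nhds_unique ((t1.add t2).congr e) tendsto_const_nhds
  simp only [mul_comm _ (dY 1 φ _), mul_comm (Ay _)]
  linarith

/-- An equation with a boundary term `⟨Λ a, w(·, H)⟩` extends from test functions to the lifting. -/
theorem form_eq (h : IsLifting H a A Ay Az w) {Λ : HHalf →ₗ[ℝ] Module.Dual ℝ HHalf}
    (hΛ : IsNonposOperator Λ) {ψ Dv : ℝ × ℝ → ℝ} (hψ : MemL2 (Ioo 0 H) ψ)
    (hDv : MemL2 (Ioo 0 H) Dv)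
    (heq : ∀ (w : ℝ × ℝ → ℝ) (hw : IsTest univ w),
      formΨ (Ioo 0 H) ψ Dv w + Λ a (hw.trace H) = 0) :
    (∫ p in dom (Ioo 0 H), ψ p * Az p) +
      ∫ p in dom (Ioo 0 H), (p.2 * ψ p + 1 / 2 * Dv p) * Ay p = Λ a a := by
  have hK : MemL2 (Ioo 0 H) fun p => p.2 * ψ p + 1 / 2 * Dv p :=
    MemLp.add (hψ.mul_bounded (g := fun z => z) continuous_id (C := H) (fun z hz => by
      rw [abs_of_pos hz.1]; exact hz.2.le) measurableSet_Ioo) (MemLp.const_mul hDv _)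
  have e : ∀ n, (∫ p in dom (Ioo 0 H), ψ p * dZ (w n) p) +
      ∫ p in dom (Ioo 0 H), (p.2 * ψ p + 1 / 2 * Dv p) * dY 1 (w n) p =
        Λ a ((h.test n).trace H) := fun n => by
    have hw := (h.test n).plane
    have := heq _ (h.test n)
    rw [← integral_add (integrable_mul_test hψ hw.dZ) (integrable_mul_test hK (hw.dY 1)),
      eq_neg_of_add_eq_zero_right this, formΨ, ← integral_neg]
    refine integral_congr_ae (.of_forall fun p => ?_)
    simp only
    ring
  have t1 := tendsto_integral_mul hψ h.memZ
    (fun n => (h.test n).plane.dZ.memLp.restrict _) h.limZ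
  have t2 := tendsto_integral_mul hK h.memY
    (fun n => ((h.test n).plane.dY 1).memLp.restrict _) h.limY
  have t3 : Tendsto (fun n => Λ a ((h.test n).trace H)) atTop (𝓝 (Λ a a)) := by
    obtain ⟨C, hC⟩ := hΛ.bounded
    have l := h.limTrace.const_mul (C * hHalfNorm a)
    rw [mul_zero] at l
    rw [tendsto_iff_norm_sub_tendsto_zero]
    refine squeeze_zero (fun n => norm_nonneg _) (fun n => ?_) l
    rw [norm_sub_rev, ← map_sub]
    exact hC _ _
  exact tendsto_nhds_unique ((t1.add t2).congr e) t3

end IsLifting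

/-! ### Uniqueness on the layer of finite height -/

/-- The energy identity on `0 < z < H`. The trace `a` of `v` at `z = H` is removed from `v` by
subtracting a lifting, which reappears as the boundary term. -/
theorem IsHomogeneousPair.energy_eq {H : ℝ} (hH : 0 < H) {a : HHalf}
    {Λ : HHalf →ₗ[ℝ] Module.Dual ℝ HHalf} (hΛ : IsNonposOperator Λ) {v ψ Dv Dψ : ℝ × ℝ → ℝ}
    (h : IsHomogeneousPair (Ioo 0 H) v ψ Dv Dψ)
    (h₁ : ∀ φ, IsTest (Ioi 0) φ → formV (Ioo 0 H) v Dψ φ +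
      ∫ y in Ioi (0 : ℝ), (a : ℝ → ℝ) y * φ (y, H) = 0)
    (h₂ : ∀ (w : ℝ × ℝ → ℝ) (hw : IsTest univ w),
      formΨ (Ioo 0 H) ψ Dv w + Λ a (hw.trace H) = 0) :
    ∫ p in dom (Ioo 0 H), (Dv p ^ 2 + Dψ p ^ 2) = 2 * Λ a a := by
  obtain ⟨A, Ay, Az, w, hA⟩ := exists_isLifting hH a
  have hI : MeasurableSet (Ioo 0 H) := measurableSet_Ioo
  have hIS : Ioo 0 H ⊆ Icc 0 H := Ioo_subset_Icc_self
  have mz : ∀ {f : ℝ × ℝ → ℝ}, MemL2 (Ioo 0 H) f → MemL2 (Ioo 0 H) fun p => p.2 * f p :=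
    fun hf => hf.mul_bounded (g := fun z => z) continuous_id (C := H) (fun z hz => by
      rw [abs_of_pos hz.1]; exact hz.2.le) hI
  -- The equation of `v` holds for `X = v - A` and tests up to `z = H` without a boundary term, at the
  -- price of the source `∂_z A`. The equation of `ψ` is used only for tests that vanish at `z = H`.
  set X : ℝ × ℝ → ℝ := fun p => v p - A p with hXd
  set L : ℝ × ℝ → ℝ := fun p => Dv p - Ay p with hLd
  set F : ℝ × ℝ → ℝ := fun p => Az p + p.2 * Dv p with hFd
  set D : ℝ × ℝ → ℝ := fun p => 1 / 2 * Dψ p with hDd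
  set K : ℝ × ℝ → ℝ := fun p => p.2 * ψ p + 1 / 2 * Dv p with hKd
  have mX : MemL2 (Ioo 0 H) X := MemLp.sub h.memV hA.mem
  have mL : MemL2 (Ioo 0 H) L := MemLp.sub h.memDv hA.memY
  have mF : MemL2 (Ioo 0 H) F := MemLp.add hA.memZ (mz h.memDv)
  have mD : MemL2 (Ioo 0 H) D := MemLp.const_mul h.memDψ _
  have mK : MemL2 (Ioo 0 H) K := MemLp.add (mz h.memΨ) (MemLp.const_mul h.memDv _)
  have mG : MemL2 (Ioo 0 H) fun _ => 0 := MemLp.zero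
  have eqX : ∀ φ, IsTest (Ioi 0) φ → ∫ p, (-((dom (Ioo 0 H)).indicator X p * dZ φ p) +
      (dom (Ioo 0 H)).indicator F p * φ p - (dom (Ioo 0 H)).indicator D p * dY 2 φ p) = 0 := by
    intro φ hφ
    have hp := hφ.plane
    have i0 := integrable_mul_test hA.mem hp.dZ
    have i0' := integrable_mul_test hA.memZ hp
    have i1 := ((integrable_mul_test h.memV hp.dZ).neg.add
      (integrable_mul_test (mz h.memDv) hp)).sub (integrable_mul_test mD (hp.dY 2))
    have e0 := h₁ φ hφ
    have e1 := integral_add i1 (i0.add i0')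
    rw [integral_add' i0 i0', hA.integral_dZ hH hφ] at e1
    rw [h.formV_eq hI hp] at e0
    rw [eq_indicator_form hI]
    refine Eq.trans ?_ (e1.trans (Eq.trans ?_ e0))
    · refine integral_congr_ae (.of_forall fun p => ?_)
      simp only [hXd, hFd, hDd, Pi.add_apply, Pi.sub_apply, Pi.neg_apply]
      ring
    · rfl
  have eqY : ∀ φ, IsTest (Iio H) φ → ∫ p, (-((dom (Ioo 0 H)).indicator ψ p * dZ φ p) +
      (dom (Ioo 0 H)).indicator (fun _ => 0) p * φ p -
        (dom (Ioo 0 H)).indicator K p * dY 1 φ p) = 0 := by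
    intro φ hφ
    have hφ' : IsTest univ φ :=
      ⟨hφ.smooth, hφ.compact, hφ.supp.trans (prod_mono subset_rfl (subset_univ _))⟩
    have h0 : hφ'.trace H = 0 := Subtype.ext <| funext fun y =>
      image_eq_zero_of_notMem_tsupport (f := φ) (x := (y, H)) fun h => lt_irrefl H (hφ.supp h).2
    have := h₂ φ hφ'
    rw [h0, map_zero, add_zero] at this
    rw [eq_indicator_form hI]
    refine Eq.trans ?_ this
    refine integral_congr_ae (.of_forall fun p => ?_)
    simp only [hKd]
    ring
  have hXL : IsWeakPlane 1 ((dom (Ioo 0 H)).indicator X) ((dom (Ioo 0 H)).indicator L) := by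
    intro φ hφ
    have e1 := h.weakV φ hφ
    have e2 := hA.isWeakPlane φ hφ
    simp only [integral_indicator_mul hI] at e1 e2 ⊢
    simp only [hXd, hLd, sub_mul]
    rw [integral_sub (integrable_mul_test h.memV (hφ.dY 1))
      (integrable_mul_test hA.mem (hφ.dY 1)), integral_sub (integrable_mul_test h.memDv hφ)
      (integrable_mul_test hA.memY hφ), e1, e2, mul_sub]
  have key := energy_identity (mX.indicator hI) (mF.indicator hI) (mD.indicator hI)
    (mL.indicator hI) (h.memΨ.indicator hI) (mG.indicator hI) (mK.indicator hI)
    (h.memDψ.indicator hI) eqX eqY h.weakΨ hXL isClosed_Icc (indicator_dom_eq_zero hIS _)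
    (fun z hz t ht => mem_Ioi.2 (add_pos_of_nonneg_of_pos hz.1 ht)) isClosed_Icc
    (indicator_dom_eq_zero hIS _)
    (fun z hz t ht => mem_Iio.2 (by have := mem_Iio.1 ht; linarith [hz.2]))
  rw [integral_indicator_combination hI mF h.memΨ mD h.memDψ mG mX mK mL] at key
  have hb := hA.form_eq hΛ h.memΨ h.memDv h₂
  have i1 := integrable_mul_of_memLp h.memΨ hA.memZ
  have i2 := integrable_mul_of_memLp mK hA.memY
  have i3 : Integrable (fun p => Dv p ^ 2 + Dψ p ^ 2) (volume.restrict (dom (Ioo 0 H))) :=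
    h.memDv.integrable_sq.add h.memDψ.integrable_sq
  have e1 := integral_sub (i1.add i2) (i3.const_mul (1 / 2))
  rw [integral_const_mul, integral_add' i1 i2, hb] at e1
  have e2 : ∫ p in dom (Ioo 0 H), (F p * ψ p - D p * Dψ p + 0 * X p - K p * L p) =
      ∫ p in dom (Ioo 0 H), (((fun p => ψ p * Az p) + fun p => K p * Ay p) p -
        1 / 2 * (Dv p ^ 2 + Dψ p ^ 2)) := by
    refine integral_congr_ae (.of_forall fun p => ?_)
    simp only [hLd, hFd, hDd, hKd, Pi.add_apply]
    ring
  linarith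

theorem IsSolutionB.unique {H : ℝ} (hH : 0 < H) {Λ : HHalf →ₗ[ℝ] Module.Dual ℝ HHalf}
    (hΛ : IsNonposOperator Λ) {s : (ℝ × ℝ → ℝ) → (ℝ × ℝ → ℝ) → ℝ} {rv rψ v₁ ψ₁ v₂ ψ₂ : ℝ × ℝ → ℝ}
    (h₁ : IsSolutionB H Λ s rv rψ v₁ ψ₁) (h₂ : IsSolutionB H Λ s rv rψ v₂ ψ₂) :
    ∀ᵐ p ∂(volume.restrict (dom (Ioo 0 H))), v₁ p = v₂ p ∧ ψ₁ p = ψ₂ p := by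
  have m₁ := h₁.admissible.mem
  have m₂ := h₂.admissible.mem
  obtain ⟨a₁, k₁⟩ := h₁.eq
  obtain ⟨a₂, k₂⟩ := h₂.eq
  have hp := h₁.admissible.isHomogeneousPair_sub (hasCutoffs_Ioo 0 H) measurableSet_Ioo
    h₂.admissible
  have e := hp.energy_eq hH (a := a₁ - a₂) hΛ (fun φ hφ => ?_) (fun w hw => ?_)
  · have h0 := hΛ.nonpos (a₁ - a₂)
    filter_upwards [hp.eq_zero measurableSet_Ioo (by rw [e]; linarith)] with p hp
    exact ⟨sub_eq_zero.1 hp.1, sub_eq_zero.1 hp.2⟩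
  · rw [formV_sub m₁.v m₂.v m₁.energy.dψ m₂.energy.dψ hφ.plane]
    have t0 : (IsTest.zero univ).trace H = 0 := rfl
    have e := (k₁ _ φ (IsTest.zero univ) hφ).trans (k₂ _ φ (IsTest.zero univ) hφ).symm
    simp only [weakForm_eq, formΨ_zero, add_zero, t0, map_zero] at e
    have i₁ := integrable_mul_of_memLp a₁.2.1 (hφ.trace_mem H).1
    have i₂ := integrable_mul_of_memLp a₂.2.1 (hφ.trace_mem H).1
    have : ∫ y in Ioi (0 : ℝ), ((a₁ - a₂ : HHalf) : ℝ → ℝ) y * φ (y, H) =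
        (∫ y in Ioi (0 : ℝ), (a₁ : ℝ → ℝ) y * φ (y, H)) -
          ∫ y in Ioi (0 : ℝ), (a₂ : ℝ → ℝ) y * φ (y, H) := by
      rw [← integral_sub i₁ i₂]
      refine integral_congr_ae (.of_forall fun y => ?_)
      exact sub_mul _ _ _
    linarith
  · rw [formΨ_sub m₁.ψ m₂.ψ m₁.energy.dv m₂.energy.dv hw.plane, map_sub, LinearMap.sub_apply]
    have e := (k₁ w _ hw (IsTest.zero _)).trans (k₂ w _ hw (IsTest.zero _)).symm
    simp only [weakForm_eq, formV_zero, zero_add, mul_zero, integral_zero, add_zero] at e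
    linarith

end EquatorialLayer

theorem theorem3 :
    (∀ (s : (ℝ × ℝ → ℝ) → (ℝ × ℝ → ℝ) → ℝ) (rv rψ v₁ ψ₁ v₂ ψ₂ : ℝ × ℝ → ℝ),
      EquatorialLayer.IsSolutionA s rv rψ v₁ ψ₁ → EquatorialLayer.IsSolutionA s rv rψ v₂ ψ₂ →
      (∀ᵐ p ∂(volume.restrict (EquatorialLayer.dom (Ioi 0))), v₁ p = v₂ p ∧ ψ₁ p = ψ₂ p)) ∧
    (∀ (H : ℝ), 0 < H →
      ∀ (Λ : EquatorialLayer.HHalf →ₗ[ℝ] Module.Dual ℝ EquatorialLayer.HHalf),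
      EquatorialLayer.IsNonposOperator Λ →
      ∀ (s : (ℝ × ℝ → ℝ) → (ℝ × ℝ → ℝ) → ℝ) (rv rψ v₁ ψ₁ v₂ ψ₂ : ℝ × ℝ → ℝ),
      EquatorialLayer.IsSolutionB H Λ s rv rψ v₁ ψ₁ →
      EquatorialLayer.IsSolutionB H Λ s rv rψ v₂ ψ₂ →
      (∀ᵐ p ∂(volume.restrict (EquatorialLayer.dom (Ioo 0 H))), v₁ p = v₂ p ∧ ψ₁ p = ψ₂ p)) ∧
    (∀ (H : ℝ), 0 < H → ∀ (vH : EquatorialLayer.HHalf)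
      (s : (ℝ × ℝ → ℝ) → (ℝ × ℝ → ℝ) → ℝ) (rv rψ v₁ ψ₁ v₂ ψ₂ : ℝ × ℝ → ℝ),
      EquatorialLayer.IsSolutionC H vH s rv rψ v₁ ψ₁ →
      EquatorialLayer.IsSolutionC H vH s rv rψ v₂ ψ₂ →
      (∀ᵐ p ∂(volume.restrict (EquatorialLayer.dom (Ioi H))), v₁ p = v₂ p ∧ ψ₁ p = ψ₂ p)) := by
  refine ⟨fun _ _ _ _ _ _ _ h₁ h₂ => h₁.unique h₂,
    fun _ hH _ hΛ _ _ _ _ _ _ _ h₁ h₂ => h₁.unique hH hΛ h₂,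
    fun _ _ _ _ _ _ _ _ _ _ h₁ h₂ => h₁.unique h₂⟩
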